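/- **Setting.** For $t\in SU(2)$ put $T_m{}^j{}_k(t)=\binom mj^{1/2}\binom mk^{1/2}\,t^{(b_1}{}_{(a_1}\cdots t^{b_m)_j}{}_{a_m)_k}$ (symmetrise, then set $j$ of the upper and $k$ of the lower indices equal to $1$, the others equal to $0$), and let $X_\pm=-(Z_{u_2}\pm iZ_{u_1})$, where $Z_u$ is the left invariant vector field on $SU(2)$ generated by $u$, with $u_1=\tfrac12\begin{pmatrix}0&i\\ i&0\end{pmatrix}$ and $u_2=\tfrac12\begin{pmatrix}0&-1\\ 1&0\end{pmatrix}$. Fields are formal Laurent series in $\rho$ whose coefficients are functions on $SU(2)$. Spinor indices are moved with $\epsilon_{AB}$, $\epsilon_{01}=1$; $x_{AB}=\sqrt2\,\epsilon_{(A}{}^0\epsilon_{B)}{}^1$, $y_{AB}=-\tfrac1{\sqrt2}\epsilon_A{}^1\epsilon_B{}^1$, $z_{AB}=\tfrac1{\sqrt2}\epsilon_A{}^0\epsilon_B{}^0$, $h_{ABCD}=-\epsilon_{A(C}\epsilon_{D)B}$, and $\epsilon^i_{ABCD}$ is the totally symmetric spinor with $\epsilon^i_{ABCD}=\binom4i^{-1}$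 if $A+B+C+D=i$ and $0$ otherwise. *Frame.* Let $h$ be the axially symmetric conformal 3-metric given by the frame $c_{AB}=x_{AB}\partial_\rho+(\tfrac1\rho z_{AB}+Y^+y_{AB}+Z^+z_{AB})X_++(\tfrac1\rho y_{AB}+Y^-y_{AB}+Z^-z_{AB})X_-$ with $$Y^+=\sum_{p\ge2}\sum_{q=2}^pY^+_{p;2q,q}T_{2q}{}^q{}_{q+2}\rho^p,\quad Y^-=\sum_{p\ge2}\sum_{q=0}^pY^-_{p;2q,q}T_{2q}{}^q{}_q\rho^p,$$ $$Z^+=\sum_{p\ge2}\sum_{q=0}^pZ^+_{p;2q,q}T_{2q}{}^q{}_q\rho^p,\quad Z^-=\sum_{p\ge2}\sum_{q=2}^pZ^-_{p;2q,q}T_{2q}{}^q{}_{q-2}\rho^p,$$ with complex coefficients such that $Z^-_{p;2q,q}=\overline{Y^+_{p;2q,q}}$ and $Y^-_{p;2q,q}=\overline{Z^+_{p;2q,q}}$, and suppose that the frame is parallel along the radial geodesics, that is, that its Levi-Civita connection coefficients satisfy $\gamma_{01CD}=0$. Let $D$ be the Levi-Civita connection of $h$. *Seed.* For real $A,Q,J$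 and complex $L_{0,n;2q,q}$ let $\psi'_{ABCD}=\sum_{j=0}^4\psi'_j\epsilon^j_{ABCD}$ with $\psi'_j=\psi^A_j+\psi^Q_j+\psi^J_j+\psi^\lambda_j$, where $\psi^A_2=-\frac A{\rho^3}T_0{}^0{}_0$; $\psi^Q_1=-\frac{3\sqrt2}{\rho^2}QT_2{}^1{}_0$, $\psi^Q_2=-\frac9{\rho^2}QT_2{}^1{}_1$, $\psi^Q_3=-\frac{3\sqrt2}{\rho^2}QT_2{}^1{}_2$; $\psi^J_1=\frac{6\sqrt2}{\rho^3}iJT_2{}^1{}_0$, $\psi^J_3=-\frac{6\sqrt2}{\rho^3}iJT_2{}^1{}_2$, the other components of $\psi^A,\psi^Q,\psi^J$ being zero; and $\psi^\lambda_j=\sum_{n\ge2}\sum_{q=2}^nL_{j,n-4;2q,q}T_{2q}{}^q{}_{q-2+j}\rho^{n-4}$ with $L_{4,n;2q,q}=\overline{L_{0,n;2q,q}}$ and $$L_{1,n;2q,q}=\tfrac{(L_4-L_0)(q+1)q+4L_0(n+3)^2}{(n+3)(2(n+4)(n+2)-(q+2)(q-1))}\sqrt{(q+2)(q-1)},\quad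 L_{3,n;2q,q}=\tfrac{(L_0-L_4)(q+1)q+4L_4(n+3)^2}{(n+3)(2(n+4)(n+2)-(q+2)(q-1))}\sqrt{(q+2)(q-1)},$$ $$L_{2,n;2q,q}=\tfrac{3(L_0+L_4)}{2(n+3)^2-q(q+1)}\sqrt{(q+2)(q+1)q(q-1)}\qquad(L_0=L_{0,n;2q,q},\ L_4=L_{4,n;2q,q}).$$ *Solutions.* With $(\mathscr Lv)_{ABCD}=D_{AB}v_{CD}+D_{CD}v_{AB}-\frac23h_{ABCD}D^{EF}v_{EF}$, the momentum constraint $D^{AB}\big(\psi'_{ABCD}+(\mathscr Lv)_{ABCD}\big)=0$ is said to have a solution expandable in powers of $\rho$ up to $O(\rho^4)$ if there is $v_{AB}=v_xx_{AB}+v_yy_{AB}+v_zz_{AB}$ with $$v_x=\sum_{p=1}^4\sum_{q=0}^pv_{x,p;2q,q}T_{2q}{}^q{}_q\rho^p,\quad v_y=\sum_{p=1}^4\sum_{q=1}^pv_{y,p;2q,q}T_{2q}{}^q{}_{q+1}\rho^p,\quad v_z=\sum_{p=1}^4\sum_{q=1}^pv_{z,p;2q,q}T_{2q}{}^q{}_{q-1}\rho^p,$$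 $v_{x,p;2q,q}\in\mathbb R$, $v_{y,p;2q,q}=-\overline{v_{z,p;2q,q}}$, for which the constraint holds at all orders $\rho^k$, $k\le2$ (the orders which terms of $v$ of order $\rho^5$ and higher do not enter). **Theorem.** Let the frame, $Q$ and the $L_{0,n;2q,q}$ be given. If the momentum constraint has a solution expandable in powers of $\rho$ up to $O(\rho^4)$ for general $(A,J)$, in the sense that the $(A,J)\in\mathbb R^2$ for which there is such a solution do not all lie on one straight line, then $$Z^-_{p;2q,q}=(-1)^{p+q+1}\,Y^+_{p;2q,q},\qquad p=2,\dots,5,\quad q=2,\dots,p.$$ -/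

import Mathlib

noncomputable section

namespace MomentumExpansion

open Complex

/-! ### Functions on `SU(2)` -/

/-- The group `SU(2, ℂ)`. -/
abbrev SU2 : Type := Matrix.specialUnitaryGroup (Fin 2) ℂ

theorem cos_sin_half (s : ℝ) :
    (Real.cos (s / 2) : ℂ) * (Real.cos (s / 2) : ℂ)
      + (Real.sin (s / 2) : ℂ) * (Real.sin (s / 2) : ℂ) = 1 := by
  have h := Real.cos_sq_add_sin_sq (s / 2)
  rw [← ofReal_mul, ← ofReal_mul, ← ofReal_add, ← pow_two, ← pow_two, h, ofReal_one]

/-- The one-parameter subgroup `s ↦ exp (s u₁)`, where `u₁ = (1/2) (0, i; i, 0)`. -/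
def rotOne (s : ℝ) : SU2 :=
  ⟨!![(Real.cos (s / 2) : ℂ), I * (Real.sin (s / 2) : ℂ);
      I * (Real.sin (s / 2) : ℂ), (Real.cos (s / 2) : ℂ)], by
    have h := cos_sin_half s
    rw [Matrix.mem_specialUnitaryGroup_iff, Matrix.mem_unitaryGroup_iff]
    constructor
    · ext i j
      fin_cases i <;> fin_cases j <;>
        simp [Matrix.mul_apply, Fin.sum_univ_two, Matrix.star_apply, -ofReal_cos, -ofReal_sin] <;>
        first
          | ring1
          | linear_combination h - (Real.sin (s / 2) : ℂ) * (Real.sin (s / 2) : ℂ) * I_mul_I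
    · rw [Matrix.det_fin_two_of]
      linear_combination h - (Real.sin (s / 2) : ℂ) * (Real.sin (s / 2) : ℂ) * I_mul_I⟩

/-- The one-parameter subgroup `s ↦ exp (s u₂)`, where `u₂ = (1/2) (0, -1; 1, 0)`. -/
def rotTwo (s : ℝ) : SU2 :=
  ⟨!![(Real.cos (s / 2) : ℂ), -(Real.sin (s / 2) : ℂ);
      (Real.sin (s / 2) : ℂ), (Real.cos (s / 2) : ℂ)], by
    have h := cos_sin_half s
    rw [Matrix.mem_specialUnitaryGroup_iff, Matrix.mem_unitaryGroup_iff]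
    constructor
    · ext i j
      fin_cases i <;> fin_cases j <;>
        simp [Matrix.mul_apply, Fin.sum_univ_two, Matrix.star_apply, -ofReal_cos, -ofReal_sin] <;>
        first
          | ring1
          | linear_combination h
    · rw [Matrix.det_fin_two_of]
      linear_combination h⟩

/-- The left invariant vector field on `SU(2)` generated by `u₁`. -/
def leftOne (f : SU2 → ℂ) (t : SU2) : ℂ := deriv (fun s : ℝ => f (t * rotOne s)) 0

/-- The left invariant vector field on `SU(2)` generated by `u₂`. -/
def leftTwo (f : SU2 → ℂ) (t : SU2) : ℂ := deriv (fun s : ℝ => f (t * rotTwo s)) 0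

/-- The complex left invariant vector field `X₊ = -(Z_{u₂} + i Z_{u₁})`. -/
def fieldPlus : ZeroHom (SU2 → ℂ) (SU2 → ℂ) where
  toFun f t := -(leftTwo f t + I * leftOne f t)
  map_zero' := by
    funext t
    simp [leftOne, leftTwo]

/-- The complex left invariant vector field `X₋ = -(Z_{u₂} - i Z_{u₁})`. -/
def fieldMinus : ZeroHom (SU2 → ℂ) (SU2 → ℂ) where
  toFun f t := -(leftTwo f t - I * leftOne f t)
  map_zero' := by
    funext t
    simp [leftOne, leftTwo]

/-- The matrix elements of the irreducible representations of `SU(2)`,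
`T m j k t = (m choose j)^{1/2} (m choose k)^{1/2} t^{(b₁}_{(a₁} ⋯ t^{bₘ)_j}_{aₘ)_k}`,
where `(…)_j` means that the indices are symmetrised and that `j` of them are then set equal
to `1` and the others to `0`. In the symmetrised product, `i` counts the factors `t¹₁`. -/
def T (m j k : ℕ) (t : SU2) : ℂ :=
  (Real.sqrt (m.choose j) : ℂ) * (Real.sqrt (m.choose k) : ℂ) *
    ((m.choose j : ℂ)⁻¹ * ∑ i ∈ Finset.range (min j k + 1),
      ((k.choose i * (m - k).choose (j - i) : ℕ) : ℂ) *
        (t.1 1 1 ^ i * t.1 0 1 ^ (k - i) * t.1 1 0 ^ (j - i) * t.1 0 0 ^ (m - k - (j - i))))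

/-! ### Formal Laurent series in `ρ` whose coefficients are functions on `SU(2)` -/

/-- Formal Laurent series in `ρ` with coefficients functions on `SU(2)`. -/
abbrev RhoSeries : Type := LaurentSeries (SU2 → ℂ)

/-- The power `ρⁿ`. -/
def rho (n : ℤ) : RhoSeries := HahnSeries.single n 1

/-- The function `f` on `SU(2)`, as a series that does not depend on `ρ`. -/
def const (f : SU2 → ℂ) : RhoSeries := HahnSeries.single 0 f

/-- The complex number `c`, as a constant series. -/
def cst (c : ℂ) : RhoSeries := const fun _ => c

/-- The series `∑_p (f p) ρ^p`. -/
def sumRho (f : ℕ → SU2 → ℂ) : RhoSeries := ((PowerSeries.mk f : PowerSeries (SU2 → ℂ)) : RhoSeries)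

/-- The vector field `∂_ρ`. -/
def dRho (f : RhoSeries) : RhoSeries := LaurentSeries.derivative ℂ f

/-- The vector field `X₊`. -/
def dPlus (f : RhoSeries) : RhoSeries := f.map fieldPlus

/-- The vector field `X₋`. -/
def dMinus (f : RhoSeries) : RhoSeries := f.map fieldMinus

/-! ### Spinors -/

/-- Spinor fields with two indices. -/
abbrev Spinor2 : Type := Fin 2 → Fin 2 → RhoSeries

/-- Spinor fields with four indices. -/
abbrev Spinor4 : Type := Fin 2 → Fin 2 → Fin 2 → Fin 2 → RhoSeries

/-- The spinor `ε_{AB}`, with `ε₀₁ = 1`; the components of `ε^{AB}` are the same. -/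
def eps : Fin 2 → Fin 2 → ℂ := ![![0, 1], ![-1, 0]]

/-- `x_{AB} = √2 ε_{(A}^0 ε_{B)}^1`. -/
def xs : Fin 2 → Fin 2 → ℂ :=
  ![![0, 1 / (Real.sqrt 2 : ℂ)], ![1 / (Real.sqrt 2 : ℂ), 0]]

/-- `y_{AB} = -(1/√2) ε_A^1 ε_B^1`. -/
def ys : Fin 2 → Fin 2 → ℂ := ![![0, 0], ![0, -(1 / (Real.sqrt 2 : ℂ))]]

/-- `z_{AB} = (1/√2) ε_A^0 ε_B^0`. -/
def zs : Fin 2 → Fin 2 → ℂ := ![![1 / (Real.sqrt 2 : ℂ), 0], ![0, 0]]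

/-- The spinor `h_{ABCD} = -ε_{A(C} ε_{D)B}` of the (negative definite) metric. -/
def hs (A B C D : Fin 2) : ℂ := -(1 / 2) * (eps A C * eps D B + eps A D * eps C B)

/-- The totally symmetric spinors `ε^i_{ABCD} = ε_{(A}^{(E} ε_B^F ε_C^G ε_{D)}^{H)_i}`. -/
def epsSym (i : ℕ) (A B C D : Fin 2) : ℂ :=
  if A.val + B.val + C.val + D.val = i then ((Nat.choose 4 i : ℕ) : ℂ)⁻¹ else 0

/-- The totally symmetric spinor `ψ₀ ε⁰ + ψ₁ ε¹ + ψ₂ ε² + ψ₃ ε³ + ψ₄ ε⁴`. -/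
def symSpinor (psi : ℕ → RhoSeries) : Spinor4 := fun A B C D =>
  ∑ i ∈ Finset.range 5, cst (epsSym i A B C D) * psi i

/-! ### The frame and its Levi-Civita connection -/

/-- The coefficients `Y^±_{p;2q,q}` and `Z^±_{p;2q,q}` of an axially symmetric frame. -/
structure FrameData where
  Yp : ℕ → ℕ → ℂ
  Ym : ℕ → ℕ → ℂ
  Zp : ℕ → ℕ → ℂ
  Zm : ℕ → ℕ → ℂ

namespace FrameData

/-- The reality conditions `Z⁻ = conj Y⁺` and `Y⁻ = conj Z⁺` on the coefficients. -/
def IsReal (F : FrameData) : Prop :=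
  ∀ p q : ℕ, F.Zm p q = (starRingEnd ℂ) (F.Yp p q) ∧ F.Ym p q = (starRingEnd ℂ) (F.Zp p q)

/-- `Y⁺ = ∑_{p ≥ 2} ∑_{q = 2}^p Y⁺_{p;2q,q} T_{2q}^q_{q+2} ρ^p`. -/
def yPlus (F : FrameData) : RhoSeries := sumRho fun p =>
  if 2 ≤ p then fun t => ∑ q ∈ Finset.Icc 2 p, F.Yp p q * T (2 * q) q (q + 2) t else 0

/-- `Y⁻ = ∑_{p ≥ 2} ∑_{q = 0}^p Y⁻_{p;2q,q} T_{2q}^q_q ρ^p`. -/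
def yMinus (F : FrameData) : RhoSeries := sumRho fun p =>
  if 2 ≤ p then fun t => ∑ q ∈ Finset.Icc 0 p, F.Ym p q * T (2 * q) q q t else 0

/-- `Z⁺ = ∑_{p ≥ 2} ∑_{q = 0}^p Z⁺_{p;2q,q} T_{2q}^q_q ρ^p`. -/
def zPlus (F : FrameData) : RhoSeries := sumRho fun p =>
  if 2 ≤ p then fun t => ∑ q ∈ Finset.Icc 0 p, F.Zp p q * T (2 * q) q q t else 0

/-- `Z⁻ = ∑_{p ≥ 2} ∑_{q = 2}^p Z⁻_{p;2q,q} T_{2q}^q_{q-2} ρ^p`. -/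
def zMinus (F : FrameData) : RhoSeries := sumRho fun p =>
  if 2 ≤ p then fun t => ∑ q ∈ Finset.Icc 2 p, F.Zm p q * T (2 * q) q (q - 2) t else 0

/-- The coefficient `c^1_{AB} = x_{AB}` of `∂_ρ` in the frame. -/
def cRho (_F : FrameData) : Spinor2 := fun A B => cst (xs A B) * rho 0

/-- The coefficient `c^+_{AB} = (1/ρ) z_{AB} + Y⁺ y_{AB} + Z⁺ z_{AB}` of `X₊` in the frame. -/
def cPlus (F : FrameData) : Spinor2 := fun A B =>
  cst (zs A B) * rho (-1) + cst (ys A B) * F.yPlus + cst (zs A B) * F.zPlus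

/-- The coefficient `c^-_{AB} = (1/ρ) y_{AB} + Y⁻ y_{AB} + Z⁻ z_{AB}` of `X₋` in the frame. -/
def cMinus (F : FrameData) : Spinor2 := fun A B =>
  cst (ys A B) * rho (-1) + cst (ys A B) * F.yMinus + cst (zs A B) * F.zMinus

/-- The frame vector fields `c_{AB} = c^1_{AB} ∂_ρ + c^+_{AB} X₊ + c^-_{AB} X₋`. -/
def frame (F : FrameData) (A B : Fin 2) (f : RhoSeries) : RhoSeries :=
  F.cRho A B * dRho f + F.cPlus A B * dPlus f + F.cMinus A B * dMinus f

end FrameData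

/-- Raising an index: `γ_{AB}{}^E{}_C = ε^{EG} γ_{ABGC}`. -/
def gammaMixed (g : Spinor4) (A B E C : Fin 2) : RhoSeries := ∑ G, cst (eps E G) * g A B G C

/-- The right hand side `2 (γ_{AB}{}^E{}_{(C} ε_{D)}{}^F - γ_{CD}{}^E{}_{(A} ε_{B)}{}^F) c_{EF}` of
the commutator equations, for one of the coefficients of the frame (note that `ε_A{}^B` is the
Kronecker delta). -/
def torsionRHS (g : Spinor4) (c : Spinor2) (A B C D : Fin 2) : RhoSeries :=
  ∑ E, ((gammaMixed g A B E C * c E D + gammaMixed g A B E D * c E C)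
    - (gammaMixed g C D E A * c E B + gammaMixed g C D E B * c E A))

/-- `γ_{ABCD}` are the coefficients of the Levi-Civita connection of the metric for which the frame
is orthonormal: they are symmetric in `A, B` and in `C, D` (metricity) and satisfy the commutator
equations `[c_{AB}, c_{CD}] = 2 (γ_{AB}{}^E{}_{(C} ε_{D)}{}^F - γ_{CD}{}^E{}_{(A} ε_{B)}{}^F) c_{EF}
+ (c^-_{AB} c^+_{CD} - c^-_{CD} c^+_{AB}) X`, which are written out here as the equality of the
coefficients of `∂_ρ`, `X₊` and `X₋`; because of `[X₊, X₋] = -X`, the coefficients of `X` agree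
identically. Moreover `γ_{01CD} = 0`: the frame is parallel along the radial geodesics. -/
structure IsLeviCivita (F : FrameData) (g : Spinor4) : Prop where
  symm_left : ∀ A B C D, g A B C D = g B A C D
  symm_right : ∀ A B C D, g A B C D = g A B D C
  torsion_rho : ∀ A B C D,
    F.frame A B (F.cRho C D) - F.frame C D (F.cRho A B) = torsionRHS g F.cRho A B C D
  torsion_plus : ∀ A B C D,
    F.frame A B (F.cPlus C D) - F.frame C D (F.cPlus A B) = torsionRHS g F.cPlus A B C D
  torsion_minus : ∀ A B C D,
    F.frame A B (F.cMinus C D) - F.frame C D (F.cMinus A B) = torsionRHS g F.cMinus A B C D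
  radial : ∀ C D, g 0 1 C D = 0

/-- The covariant derivative `D_{AB} v_{CD}`. -/
def covD2 (F : FrameData) (g : Spinor4) (v : Spinor2) : Spinor4 := fun A B C D =>
  F.frame A B (v C D) - ∑ E, (gammaMixed g A B E C * v E D + gammaMixed g A B E D * v C E)

/-- The covariant derivative `D_{GH} ψ_{ABCD}`. -/
def covD4 (F : FrameData) (g : Spinor4) (psi : Spinor4) (G H A B C D : Fin 2) : RhoSeries :=
  F.frame G H (psi A B C D) - ∑ E, (gammaMixed g G H E A * psi E B C D
    + gammaMixed g G H E B * psi A E C D + gammaMixed g G H E C * psi A B E D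
    + gammaMixed g G H E D * psi A B C E)

/-- The divergence `D^{AB} v_{AB} = ε^{AE} ε^{BG} D_{EG} v_{AB}`. -/
def div2 (F : FrameData) (g : Spinor4) (v : Spinor2) : RhoSeries :=
  ∑ A, ∑ B, ∑ E, ∑ G, cst (eps A E * eps B G) * covD2 F g v E G A B

/-- The divergence `D^{AB} ψ_{ABCD} = ε^{AE} ε^{BG} D_{EG} ψ_{ABCD}`. -/
def div4 (F : FrameData) (g : Spinor4) (psi : Spinor4) : Spinor2 := fun C D =>
  ∑ A, ∑ B, ∑ E, ∑ G, cst (eps A E * eps B G) * covD4 F g psi E G A B C D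

/-- The conformal Killing operator
`(𝓛 v)_{ABCD} = D_{AB} v_{CD} + D_{CD} v_{AB} - (2/3) h_{ABCD} D^{EF} v_{EF}`. -/
def conformalKilling (F : FrameData) (g : Spinor4) (v : Spinor2) : Spinor4 := fun A B C D =>
  covD2 F g v A B C D + covD2 F g v C D A B - cst (2 / 3 * hs A B C D) * div2 F g v

/-! ### The seed -/

/-- The components `ψ^A_j`. -/
def seedA (a : ℝ) (j : ℕ) : RhoSeries :=
  if j = 2 then rho (-3) * const fun t => -(a : ℂ) * T 0 0 0 t else 0

/-- The components `ψ^Q_j` for `Q₁ = Q₂ = 0` and `Q₃ = b`. -/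
def seedQ (b : ℝ) (j : ℕ) : RhoSeries :=
  if j = 1 then rho (-2) * const fun t => -(3 * (Real.sqrt 2 : ℂ) * b) * T 2 1 0 t
  else if j = 2 then rho (-2) * const fun t => -(9 * (b : ℂ)) * T 2 1 1 t
  else if j = 3 then rho (-2) * const fun t => -(3 * (Real.sqrt 2 : ℂ) * b) * T 2 1 2 t
  else 0

/-- The components `ψ^J_j` for `J₁ = J₂ = 0` and `J₃ = c`. -/
def seedJ (c : ℝ) (j : ℕ) : RhoSeries :=
  if j = 1 then rho (-3) * const fun t => 6 * (Real.sqrt 2 : ℂ) * I * c * T 2 1 0 t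
  else if j = 3 then rho (-3) * const fun t => -(6 * (Real.sqrt 2 : ℂ) * I * c) * T 2 1 2 t
  else 0

/-- The coefficients `L_{j,n;2q,q}` of the seed `ψ^λ`, where `l n q = L_{0,n;2q,q}` is given and
`L_{4,n;2q,q} = conj L_{0,n;2q,q}`. -/
def seedL (l : ℤ → ℕ → ℂ) (j : ℕ) (n : ℤ) (q : ℕ) : ℂ :=
  let l0 : ℂ := l n q
  let l4 : ℂ := (starRingEnd ℂ) (l n q)
  if j = 0 then l0
  else if j = 1 then
    ((l4 - l0) * (q + 1) * q + 4 * l0 * (n + 3) ^ 2) /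
      ((n + 3) * (2 * (n + 4) * (n + 2) - (q + 2) * (q - 1))) *
        (Real.sqrt (((q : ℝ) + 2) * ((q : ℝ) - 1)) : ℂ)
  else if j = 2 then
    3 * (l0 + l4) / (2 * (n + 3) ^ 2 - q * (q + 1)) *
      (Real.sqrt (((q : ℝ) + 2) * ((q : ℝ) + 1) * q * ((q : ℝ) - 1)) : ℂ)
  else if j = 3 then
    ((l0 - l4) * (q + 1) * q + 4 * l4 * (n + 3) ^ 2) /
      ((n + 3) * (2 * (n + 4) * (n + 2) - (q + 2) * (q - 1))) *
        (Real.sqrt (((q : ℝ) + 2) * ((q : ℝ) - 1)) : ℂ)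
  else l4

/-- The components
`ψ^λ_j = (1/ρ⁴) ∑_{n ≥ 2} ∑_{q = 2}^n L_{j,n-4;2q,q} T_{2q}^q_{q-2+j} ρ^n`. -/
def seedLambda (l : ℤ → ℕ → ℂ) (j : ℕ) : RhoSeries :=
  rho (-4) * sumRho fun n => fun t =>
    ∑ q ∈ Finset.Icc 2 n, seedL l j ((n : ℤ) - 4) q * T (2 * q) q (q - 2 + j) t

/-- The seed `ψ' = ψ^A + ψ^Q + ψ^J + ψ^λ`. -/
def seed (a b c : ℝ) (l : ℤ → ℕ → ℂ) : Spinor4 :=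
  symSpinor fun j => seedA a j + seedQ b j + seedJ c j + seedLambda l j

/-! ### The Ansatz for `v` and the momentum constraint -/

/-- The coefficients `v_{x,p;2q,q}`, `v_{y,p;2q,q}` and `v_{z,p;2q,q}` of an axially symmetric
1-form. -/
structure FormData where
  vx : ℕ → ℕ → ℂ
  vy : ℕ → ℕ → ℂ
  vz : ℕ → ℕ → ℂ

namespace FormData

/-- The reality conditions on the coefficients. -/
def IsReal (v : FormData) : Prop :=
  ∀ p q : ℕ, (starRingEnd ℂ) (v.vx p q) = v.vx p q ∧ v.vy p q = -(starRingEnd ℂ) (v.vz p q)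

/-- The expansion up to order `ρ^N` of `v_{AB} = v_x x_{AB} + v_y y_{AB} + v_z z_{AB}`, where
`v_x = ∑_p ∑_{q=0}^p v_{x,p;2q,q} T_{2q}^q_q ρ^p`,
`v_y = ∑_p ∑_{q=1}^p v_{y,p;2q,q} T_{2q}^q_{q+1} ρ^p`,
`v_z = ∑_p ∑_{q=1}^p v_{z,p;2q,q} T_{2q}^q_{q-1} ρ^p`, with `p ≥ 1`. -/
def spinor (v : FormData) (N : ℕ) : Spinor2 := fun A B =>
  ∑ p ∈ Finset.Icc 1 N, rho (p : ℤ) *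
    (cst (xs A B) * const (fun t => ∑ q ∈ Finset.Icc 0 p, v.vx p q * T (2 * q) q q t)
      + cst (ys A B) * const (fun t => ∑ q ∈ Finset.Icc 1 p, v.vy p q * T (2 * q) q (q + 1) t)
      + cst (zs A B) * const (fun t => ∑ q ∈ Finset.Icc 1 p, v.vz p q * T (2 * q) q (q - 1) t))

end FormData

/-- The momentum constraint `D^{AB} (ψ'_{ABCD} + (𝓛 v)_{ABCD}) = 0` has a solution of the York form
which is expandable in powers of `ρ` up to order `ρ^N`: there are real coefficients of `v` up to
order `ρ^N` for which the constraint holds at all the orders that the terms of `v` of order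
greater than `N` do not enter, which are the orders `ρ^k` with `k ≤ N - 2`. -/
def SolvableUpTo (N : ℕ) (F : FrameData) (g : Spinor4) (psi : Spinor4) : Prop :=
  ∃ v : FormData, v.IsReal ∧ ∀ (C D : Fin 2) (k : ℤ), k ≤ (N : ℤ) - 2 →
    (div4 F g (psi + conformalKilling F g (v.spinor N)) C D).coeff k = 0

end MomentumExpansion

end

/-!
The conformal Killing operator composed with the divergence is not onto, and the part of the momentum
constraint that comes from the seeds of mass `A` and angular momentum `J` has to lie in its image,
order by order in `ρ`. The symmetry of the frame is what these solvability conditions say.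

The functions with vanishing left weight are polynomials in `u = T₂¹₁`, times powers of
`P = T₂¹₂ / √2` or `M = T₂¹₀ / √2` according to their spin weight, with `4 P M = u² - 1`
(`PF_mul_MF`, `T_add`, `T_sub`), and `X₊`, `X₋` act on them as first order differential operators in
`u` (`hasFields_pu`, `hasFields_PF_mul`, `hasFields_MF_mul`). Solving the commutator equations order
by order determines the connection from the frame (`IsConnection.coeff_kappa`, …,
`IsConnection.coeff_a`); up to `ρ⁵` it is linear in the frame, apart from a quadratic term in `κ`
and up to terms that contain the coefficients of order `ρ²` of `Y⁺` and `Z⁻`.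

The difference of two solutions satisfies a homogeneous equation that no longer contains `Q` and the
`L` (`SolvableUpTo.compensated`). At the order `ρ^{n-3}` it consists of the source
`divRayPoly`, linear in the differences of `A` and `J` and in the frame coefficients of order `ρⁿ`,
and of the flat operator `flatPoly` on the term of order `ρ^{n-1}` of the 1-form, which consists of
polynomials of bounded degree (`ConstraintAt`). Only at the order `ρ²` does the curvature couple the
term of order `ρ` of the 1-form to the equation, and if `Y⁺` and `Z⁻` are `O(ρ³)` this correction
has too low a degree to matter (`corrPoly_natDegree`). Since `flatPoly` does not reach the top
coefficients, and since in two combinations of the coefficients two orders lower its contributions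
cancel, one obtains relations `a α + e β = 0`, where `α` and `β` are given by the frame and `a` and
`e` are proportional to the differences of `A` and `J` (`ConstraintAt.coeff_top`,
`ConstraintAt.coeff_sub_top`). As the admissible `(A, J)` do not lie on one line, `α = β = 0`
(`eq_zero_of_forall_compensated`). With `y` and `w` the polynomials of `Y⁺` and `Z⁻` at the order
`ρⁿ`, this kills the coefficients of `w + y` of degree `n - 2`, `n - 4` and those of `w - y` of
degree `n - 3`, `n - 5` (`Spanning.top`, `Spanning.top_succ`, `Spanning.four`, `Spanning.five`),
and for `n = 2` also the constant `w - y`. The polynomials belonging to the functions `T` are even or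
odd (`coeff_weightPoly_two`), so that these coefficients can be read off one value of `q` at a time.
-/

noncomputable section

namespace MomentumExpansion

section

open Complex

/-! ### The vector fields `X₊` and `X₋` on polynomial functions -/

/-- `f` is differentiable along the left invariant vector fields, with `X₊ f = fp` and
`X₋ f = fm`. The two derivatives are those along `u₂` and `u₁`, expressed through `X₊` and `X₋`. -/
def HasFields (f fp fm : SU2 → ℂ) : Prop := ∀ t,
  HasDerivAt (fun s : ℝ => f (t * rotTwo s)) (-(fp t + fm t) / 2) 0 ∧
  HasDerivAt (fun s : ℝ => f (t * rotOne s)) (I / 2 * (fp t - fm t)) 0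

theorem rotOne_zero : rotOne 0 = 1 := by
  apply Subtype.ext
  ext i j
  fin_cases i <;> fin_cases j <;> simp [rotOne]

theorem rotTwo_zero : rotTwo 0 = 1 := by
  apply Subtype.ext
  ext i j
  fin_cases i <;> fin_cases j <;> simp [rotTwo]

namespace HasFields

variable {f fp fm g gp gm : SU2 → ℂ}

theorem fieldPlus_eq (h : HasFields f fp fm) : fieldPlus f = fp := by
  funext t
  have h1 := (h t).1.deriv
  have h2 := (h t).2.deriv
  show -(deriv (fun s : ℝ => f (t * rotTwo s)) 0 + I * deriv (fun s : ℝ => f (t * rotOne s)) 0) = _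
  rw [h1, h2]
  linear_combination -(1 / 2) * (fp t - fm t) * I_mul_I

theorem fieldMinus_eq (h : HasFields f fp fm) : fieldMinus f = fm := by
  funext t
  have h1 := (h t).1.deriv
  have h2 := (h t).2.deriv
  show -(deriv (fun s : ℝ => f (t * rotTwo s)) 0 - I * deriv (fun s : ℝ => f (t * rotOne s)) 0) = _
  rw [h1, h2]
  linear_combination (1 / 2) * (fp t - fm t) * I_mul_I

theorem add (hf : HasFields f fp fm) (hg : HasFields g gp gm) :
    HasFields (f + g) (fp + gp) (fm + gm) := fun t =>
  ⟨((hf t).1.add (hg t).1).congr_deriv (by simp only [Pi.add_apply]; ring),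
    ((hf t).2.add (hg t).2).congr_deriv (by simp only [Pi.add_apply]; ring)⟩

theorem mul (hf : HasFields f fp fm) (hg : HasFields g gp gm) :
    HasFields (f * g) (fp * g + f * gp) (fm * g + f * gm) := fun t =>
  ⟨((hf t).1.mul (hg t).1).congr_deriv (by
      simp only [Pi.add_apply, Pi.mul_apply, rotTwo_zero, mul_one]; ring),
    ((hf t).2.mul (hg t).2).congr_deriv (by
      simp only [Pi.add_apply, Pi.mul_apply, rotOne_zero, mul_one]; ring)⟩

theorem algebraMap (c : ℂ) : HasFields (algebraMap ℂ (SU2 → ℂ) c) 0 0 := fun t =>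
  ⟨(hasDerivAt_const (0 : ℝ) c).congr_deriv (by simp),
    (hasDerivAt_const (0 : ℝ) c).congr_deriv (by simp)⟩

theorem congr (h : HasFields f fp fm) (hp : fp = gp) (hm : fm = gm) : HasFields f gp gm :=
  hp ▸ hm ▸ h

end HasFields

/-- The matrix elements of the defining representation. -/
def entry (i j : Fin 2) (t : SU2) : ℂ := t.1 i j

theorem hasDerivAt_cos_half : HasDerivAt (fun s : ℝ => ((Real.cos (s / 2) : ℝ) : ℂ)) 0 0 := by
  have h : HasDerivAt (fun s : ℝ => Real.cos (s / 2)) (-Real.sin (0 / 2) * (1 / 2)) 0 :=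
    HasDerivAt.comp (h₂ := Real.cos) (0 : ℝ) (Real.hasDerivAt_cos (0 / 2))
      ((hasDerivAt_id' (0 : ℝ)).div_const 2)
  exact h.ofReal_comp.congr_deriv (by simp)

theorem hasDerivAt_sin_half :
    HasDerivAt (fun s : ℝ => ((Real.sin (s / 2) : ℝ) : ℂ)) (1 / 2) 0 := by
  have h : HasDerivAt (fun s : ℝ => Real.sin (s / 2)) (Real.cos (0 / 2) * (1 / 2)) 0 :=
    HasDerivAt.comp (h₂ := Real.sin) (0 : ℝ) (Real.hasDerivAt_sin (0 / 2))
      ((hasDerivAt_id' (0 : ℝ)).div_const 2)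
  exact h.ofReal_comp.congr_deriv (by simp)

theorem hasFields_entry_zero (i : Fin 2) : HasFields (entry i 0) 0 (-entry i 1) := by
  intro t
  constructor
  · have h := (hasDerivAt_cos_half.const_mul (t.1 i 0)).add (hasDerivAt_sin_half.const_mul (t.1 i 1))
    refine (h.congr_deriv ?_).congr_of_eventuallyEq (Filter.Eventually.of_forall fun s => ?_)
    · simp [entry]; ring
    · simp [entry, rotTwo, Matrix.mul_apply, Fin.sum_univ_two]
  · have h := (hasDerivAt_cos_half.const_mul (t.1 i 0)).add
      (hasDerivAt_sin_half.const_mul (t.1 i 1 * I))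
    refine (h.congr_deriv ?_).congr_of_eventuallyEq (Filter.Eventually.of_forall fun s => ?_)
    · simp [entry]; ring
    · simp [entry, rotOne, Matrix.mul_apply, Fin.sum_univ_two]; ring

theorem hasFields_entry_one (i : Fin 2) : HasFields (entry i 1) (entry i 0) 0 := by
  intro t
  constructor
  · have h := (hasDerivAt_cos_half.const_mul (t.1 i 1)).add
      (hasDerivAt_sin_half.const_mul (-t.1 i 0))
    refine (h.congr_deriv ?_).congr_of_eventuallyEq (Filter.Eventually.of_forall fun s => ?_)
    · simp [entry]; ring
    · simp [entry, rotTwo, Matrix.mul_apply, Fin.sum_univ_two]; ring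
  · have h := (hasDerivAt_cos_half.const_mul (t.1 i 1)).add
      (hasDerivAt_sin_half.const_mul (t.1 i 0 * I))
    refine (h.congr_deriv ?_).congr_of_eventuallyEq (Filter.Eventually.of_forall fun s => ?_)
    · simp [entry]; ring
    · simp [entry, rotOne, Matrix.mul_apply, Fin.sum_univ_two]; ring

/-- The polynomial functions on `SU(2)`. -/
def polyFun : Subalgebra ℂ (SU2 → ℂ) :=
  Algebra.adjoin ℂ (Set.range fun p : Fin 2 × Fin 2 => entry p.1 p.2)

theorem entry_mem (i j : Fin 2) : entry i j ∈ polyFun :=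
  Algebra.subset_adjoin ⟨(i, j), rfl⟩

/-- On polynomial functions `X₊` and `X₋` are genuine derivatives, and again polynomial. -/
theorem exists_hasFields {f : SU2 → ℂ} (hf : f ∈ polyFun) :
    ∃ fp ∈ polyFun, ∃ fm ∈ polyFun, HasFields f fp fm := by
  induction hf using Algebra.adjoin_induction with
  | mem x hx =>
    obtain ⟨⟨i, j⟩, rfl⟩ := hx
    fin_cases j
    · exact ⟨0, zero_mem _, _, neg_mem (entry_mem i 1), hasFields_entry_zero i⟩
    · exact ⟨_, entry_mem i 0, 0, zero_mem _, hasFields_entry_one i⟩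
  | algebraMap c => exact ⟨0, zero_mem _, 0, zero_mem _, HasFields.algebraMap c⟩
  | add x y _ _ hx hy =>
    obtain ⟨xp, hxp, xm, hxm, hx⟩ := hx
    obtain ⟨yp, hyp, ym, hym, hy⟩ := hy
    exact ⟨_, add_mem hxp hyp, _, add_mem hxm hym, hx.add hy⟩
  | mul x y hx' hy' hx hy =>
    obtain ⟨xp, hxp, xm, hxm, hx⟩ := hx
    obtain ⟨yp, hyp, ym, hym, hy⟩ := hy
    exact ⟨_, add_mem (mul_mem hxp hy') (mul_mem hx' hyp), _,
      add_mem (mul_mem hxm hy') (mul_mem hx' hym), hx.mul hy⟩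

theorem fieldPlus_mem {f : SU2 → ℂ} (hf : f ∈ polyFun) : fieldPlus f ∈ polyFun := by
  obtain ⟨fp, hfp, fm, -, h⟩ := exists_hasFields hf
  rwa [h.fieldPlus_eq]

theorem fieldMinus_mem {f : SU2 → ℂ} (hf : f ∈ polyFun) : fieldMinus f ∈ polyFun := by
  obtain ⟨fp, -, fm, hfm, h⟩ := exists_hasFields hf
  rwa [h.fieldMinus_eq]

theorem fieldPlus_add {f g : SU2 → ℂ} (hf : f ∈ polyFun) (hg : g ∈ polyFun) :
    fieldPlus (f + g) = fieldPlus f + fieldPlus g := by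
  obtain ⟨fp, -, fm, -, h⟩ := exists_hasFields hf
  obtain ⟨gp, -, gm, -, h'⟩ := exists_hasFields hg
  rw [(h.add h').fieldPlus_eq, h.fieldPlus_eq, h'.fieldPlus_eq]

theorem fieldMinus_add {f g : SU2 → ℂ} (hf : f ∈ polyFun) (hg : g ∈ polyFun) :
    fieldMinus (f + g) = fieldMinus f + fieldMinus g := by
  obtain ⟨fp, -, fm, -, h⟩ := exists_hasFields hf
  obtain ⟨gp, -, gm, -, h'⟩ := exists_hasFields hg
  rw [(h.add h').fieldMinus_eq, h.fieldMinus_eq, h'.fieldMinus_eq]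

theorem leftOne_const_mul (c : ℂ) (f : SU2 → ℂ) (t : SU2) :
    leftOne (fun t => c * f t) t = c * leftOne f t := deriv_const_mul_field c

theorem leftTwo_const_mul (c : ℂ) (f : SU2 → ℂ) (t : SU2) :
    leftTwo (fun t => c * f t) t = c * leftTwo f t := deriv_const_mul_field c

theorem fieldPlus_const_mul (c : ℂ) (f : SU2 → ℂ) :
    fieldPlus ((fun _ => c) * f) = (fun _ => c) * fieldPlus f := by
  funext t
  show -(leftTwo (fun t => c * f t) t + I * leftOne (fun t => c * f t) t)
    = c * -(leftTwo f t + I * leftOne f t)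
  rw [leftOne_const_mul, leftTwo_const_mul]
  ring

theorem fieldMinus_const_mul (c : ℂ) (f : SU2 → ℂ) :
    fieldMinus ((fun _ => c) * f) = (fun _ => c) * fieldMinus f := by
  funext t
  show -(leftTwo (fun t => c * f t) t - I * leftOne (fun t => c * f t) t)
    = c * -(leftTwo f t - I * leftOne f t)
  rw [leftOne_const_mul, leftTwo_const_mul]
  ring

/-! ### Axially symmetric functions of given spin weight -/

/-- The axially symmetric function `u = T₂¹₁` of spin weight zero (the cosine of the polar
angle). -/
def uF : SU2 → ℂ := entry 0 0 * entry 1 1 + entry 0 1 * entry 1 0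

/-- The axially symmetric function `P = T₂¹₂ / √2`, which raises the spin weight by one. -/
def PF : SU2 → ℂ := entry 0 1 * entry 1 1

/-- The axially symmetric function `M = T₂¹₀ / √2`, which lowers the spin weight by one. -/
def MF : SU2 → ℂ := entry 0 0 * entry 1 0

theorem entry_det : entry 0 0 * entry 1 1 - entry 0 1 * entry 1 0 = 1 := by
  funext t
  have h := (Matrix.mem_specialUnitaryGroup_iff.1 t.2).2
  rw [Matrix.det_fin_two] at h
  exact h

theorem PF_mul_MF : 4 * (PF * MF) = uF ^ 2 - 1 := by
  simp only [PF, MF, uF]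
  linear_combination (-1 - entry 0 0 * entry 1 1 + entry 0 1 * entry 1 0) * entry_det

open Polynomial in
/-- The function `p(u)` for a polynomial `p`. -/
def pu : ℂ[X] →ₐ[ℂ] (SU2 → ℂ) := Polynomial.aeval uF

theorem PF_mem : PF ∈ polyFun := mul_mem (entry_mem _ _) (entry_mem _ _)

theorem MF_mem : MF ∈ polyFun := mul_mem (entry_mem _ _) (entry_mem _ _)

theorem pu_X : pu Polynomial.X = uF := Polynomial.aeval_X _

theorem pu_C (c : ℂ) : pu (Polynomial.C c) = fun _ => c := Polynomial.aeval_C _ c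

theorem hasFields_uF : HasFields uF (2 * MF) (-2 * PF) :=
  (((hasFields_entry_zero 0).mul (hasFields_entry_one 1)).add
    ((hasFields_entry_one 0).mul (hasFields_entry_zero 1))).congr
      (by simp only [MF]; ring) (by simp only [PF]; ring)

theorem hasFields_PF : HasFields PF uF 0 :=
  ((hasFields_entry_one 0).mul (hasFields_entry_one 1)).congr (by simp only [uF]) (by ring)

theorem hasFields_MF : HasFields MF 0 (-uF) :=
  ((hasFields_entry_zero 0).mul (hasFields_entry_zero 1)).congr (by ring) (by simp only [uF]; ring)

open Polynomial

theorem hasFields_pu (p : ℂ[X]) :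
    HasFields (pu p) (2 * MF * pu (derivative p)) (-2 * PF * pu (derivative p)) := by
  induction p using Polynomial.induction_on with
  | C c =>
    rw [derivative_C, map_zero, mul_zero, mul_zero, pu_C]
    exact HasFields.algebraMap c
  | add p q hp hq =>
    rw [map_add]
    exact (hp.add hq).congr (by rw [map_add, map_add]; ring)
      (by rw [map_add, map_add]; ring)
  | monomial n c h =>
    rw [pow_succ, ← mul_assoc, map_mul, pu_X]
    exact (h.mul hasFields_uF).congr
      (by
        rw [derivative_mul (g := X), derivative_X, mul_one, map_add, map_mul (y := X), pu_X]; ring)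
      (by
        rw [derivative_mul (g := X), derivative_X, mul_one, map_add, map_mul (y := X), pu_X]; ring)

theorem PF_mul_MF' : PF * MF = pu (C (1 / 4) * (X ^ 2 - 1)) := by
  have h : (4 : SU2 → ℂ) * pu (C (1 / 4)) = 1 := by
    funext t; simp [pu_C]
  rw [map_mul, map_sub, map_pow, pu_X, map_one, ← PF_mul_MF]
  linear_combination -(PF * MF) * h

theorem pu_half_PF_mul_MF : 2 * (PF * MF) = pu (C (1 / 2) * (X ^ 2 - 1)) := by
  have h : (2 : SU2 → ℂ) * pu (C (1 / 2)) = 1 := by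
    funext t; simp [pu_C]
  rw [map_mul, map_sub, map_pow, pu_X, map_one, ← PF_mul_MF]
  linear_combination -2 * (PF * MF) * h

/-- Lowering the spin weight of `P p(u)`, or raising that of `M p(u)`. -/
def lower (p : ℂ[X]) : ℂ[X] := X * p + C (1 / 2) * (X ^ 2 - 1) * derivative p

/-- Lowering the spin weight of `P² p(u)`, or raising that of `M² p(u)`, divided by two. -/
def lower₂ (p : ℂ[X]) : ℂ[X] := X * p + C (1 / 4) * (X ^ 2 - 1) * derivative p

theorem hasFields_PF_mul (p : ℂ[X]) :
    HasFields (PF * pu p) (pu (lower p)) (-2 * PF ^ 2 * pu (derivative p)) :=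
  (hasFields_PF.mul (hasFields_pu p)).congr
    (by rw [lower, map_add, map_mul, map_mul _ (C (1 / 2) * _), pu_X, ← pu_half_PF_mul_MF]; ring)
    (by ring)

theorem hasFields_MF_mul (p : ℂ[X]) :
    HasFields (MF * pu p) (2 * MF ^ 2 * pu (derivative p)) (-pu (lower p)) :=
  (hasFields_MF.mul (hasFields_pu p)).congr (by ring)
    (by rw [lower, map_add, map_mul, map_mul _ (C (1 / 2) * _), pu_X, ← pu_half_PF_mul_MF]; ring)

theorem hasFields_PF_sq_mul (p : ℂ[X]) :
    HasFields (PF ^ 2 * pu p) (2 * PF * pu (lower₂ p)) (-2 * PF ^ 3 * pu (derivative p)) := by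
  rw [pow_two]
  exact ((hasFields_PF.mul hasFields_PF).mul (hasFields_pu p)).congr
    (by rw [lower₂, map_add, map_mul, map_mul _ (C (1 / 4) * _), pu_X, ← PF_mul_MF']; ring)
    (by ring)

theorem hasFields_MF_sq_mul (p : ℂ[X]) :
    HasFields (MF ^ 2 * pu p) (2 * MF ^ 3 * pu (derivative p)) (-2 * MF * pu (lower₂ p)) := by
  rw [pow_two]
  exact ((hasFields_MF.mul hasFields_MF).mul (hasFields_pu p)).congr (by ring)
    (by rw [lower₂, map_add, map_mul, map_mul _ (C (1 / 4) * _), pu_X, ← PF_mul_MF']; ring)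

theorem uF_rotTwo (s : ℝ) : uF (rotTwo s) = (Real.cos s : ℂ) := by
  have h : Real.cos s = Real.cos (s / 2) * Real.cos (s / 2) - Real.sin (s / 2) * Real.sin (s / 2) := by
    rw [← Real.cos_add, add_halves]
  rw [h]
  simp [uF, entry, rotTwo]
  ring

theorem two_mul_MF_rotTwo (s : ℝ) : 2 * MF (rotTwo s) = (Real.sin s : ℂ) := by
  have h : Real.sin s = 2 * (Real.sin (s / 2) * Real.cos (s / 2)) := by
    rw [← mul_assoc, ← Real.sin_two_mul, mul_div_cancel₀ _ two_ne_zero]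
  rw [h]
  simp [MF, entry, rotTwo]
  ring

theorem two_mul_PF_rotTwo (s : ℝ) : 2 * PF (rotTwo s) = -(Real.sin s : ℂ) := by
  have h : Real.sin s = 2 * (Real.sin (s / 2) * Real.cos (s / 2)) := by
    rw [← mul_assoc, ← Real.sin_two_mul, mul_div_cancel₀ _ two_ne_zero]
  rw [h]
  simp [PF, entry, rotTwo]

/-- A polynomial that vanishes at `cos s` for all `s ∈ (0, π)` is zero. -/
theorem eq_zero_of_eval_cos (p : ℂ[X])
    (h : ∀ s ∈ Set.Ioo 0 Real.pi, p.eval (Real.cos s : ℂ) = 0) : p = 0 := by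
  refine p.eq_zero_of_infinite_isRoot (Set.Infinite.mono ?_
    ((Set.Ioo_infinite Real.pi_pos).image (f := fun s : ℝ => (Real.cos s : ℂ)) ?_))
  · rintro _ ⟨s, hs, rfl⟩
    exact h s hs
  · intro x hx y hy hxy
    exact Real.injOn_cos ⟨hx.1.le, hx.2.le⟩ ⟨hy.1.le, hy.2.le⟩ (ofReal_injective hxy)

theorem pu_apply (p : ℂ[X]) (t : SU2) : pu p t = p.eval (uF t) := by
  rw [pu, ← Polynomial.coe_aeval_eq_eval]
  exact (Polynomial.aeval_algHom_apply (Pi.evalAlgHom ℂ (fun _ : SU2 => ℂ) t) uF p).symm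

theorem MF_mul_pu_eq_zero {p : ℂ[X]} (h : MF * pu p = 0) : p = 0 := by
  refine eq_zero_of_eval_cos p fun s hs => ?_
  have h1 := congrFun h (rotTwo s)
  rw [Pi.mul_apply, pu_apply, uF_rotTwo] at h1
  refine (mul_eq_zero.1 h1).resolve_left fun h0 => ?_
  have h2 := two_mul_MF_rotTwo s
  rw [h0, mul_zero] at h2
  exact (Real.sin_pos_of_mem_Ioo hs).ne' (ofReal_eq_zero.1 h2.symm)

theorem PF_mul_pu_eq_zero {p : ℂ[X]} (h : PF * pu p = 0) : p = 0 := by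
  refine eq_zero_of_eval_cos p fun s hs => ?_
  have h1 := congrFun h (rotTwo s)
  rw [Pi.mul_apply, pu_apply, uF_rotTwo] at h1
  refine (mul_eq_zero.1 h1).resolve_left fun h0 => ?_
  have h2 := two_mul_PF_rotTwo s
  rw [h0, mul_zero] at h2
  exact (Real.sin_pos_of_mem_Ioo hs).ne' (ofReal_eq_zero.1 (neg_eq_zero.1 h2.symm))

theorem pu_eq_zero {p : ℂ[X]} (h : pu p = 0) : p = 0 :=
  MF_mul_pu_eq_zero (by rw [h, mul_zero])

/-! ### The functions `T` with vanishing left weight -/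

/-- The polynomial `p` with `T (2 q) q (q + j) = P ^ j p(u)` and `T (2 q) q (q - j) = M ^ j p(u)`,
a multiple of the `j`-th derivative of the Legendre polynomial of degree `q`. -/
def weightPoly (q j : ℕ) : ℂ[X] :=
  C ((Real.sqrt ((2 * q).choose q) : ℂ) * (Real.sqrt ((2 * q).choose (q + j)) : ℂ) *
      ((2 * q).choose q : ℂ)⁻¹) *
    ∑ i ∈ Finset.range (q - j + 1), C (((q - j).choose i * (q + j).choose (q - i) : ℕ) : ℂ) *
      ((C (1 / 2) * (X + 1)) ^ i * (C (1 / 2) * (X - 1)) ^ (q - j - i))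

theorem natDegree_weightPoly_le (q j : ℕ) : (weightPoly q j).natDegree ≤ q - j := by
  refine (natDegree_C_mul_le _ _).trans (natDegree_sum_le_of_forall_le _ _ fun i hi => ?_)
  have hi' : i ≤ q - j := Nat.lt_succ_iff.1 (Finset.mem_range.1 hi)
  refine (natDegree_C_mul_le _ _).trans ?_
  have h1 : (C (1 / 2) * (X + 1) : ℂ[X]).natDegree ≤ 1 := by compute_degree
  have h2 : (C (1 / 2) * (X - 1) : ℂ[X]).natDegree ≤ 1 := by compute_degree
  exact (natDegree_mul_le_of_le (natDegree_pow_le_of_le i h1)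
    (natDegree_pow_le_of_le (q - j - i) h2)).trans (by omega)

theorem pu_half_add : pu (C (1 / 2) * (X + 1)) = entry 0 0 * entry 1 1 := by
  funext t
  have h := congrFun entry_det t
  simp only [Pi.sub_apply, Pi.mul_apply, Pi.one_apply] at h
  simp only [pu_apply, uF, eval_mul, eval_C, eval_add, eval_X, eval_one, Pi.add_apply, Pi.mul_apply]
  linear_combination -(1 / 2) * h

theorem pu_half_sub : pu (C (1 / 2) * (X - 1)) = entry 0 1 * entry 1 0 := by
  funext t
  have h := congrFun entry_det t
  simp only [Pi.sub_apply, Pi.mul_apply, Pi.one_apply] at h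
  simp only [pu_apply, uF, eval_mul, eval_C, eval_sub, eval_X, eval_one, Pi.add_apply, Pi.mul_apply]
  linear_combination (1 / 2) * h

theorem pu_weightPoly (q j : ℕ) (t : SU2) : pu (weightPoly q j) t =
    (Real.sqrt ((2 * q).choose q) : ℂ) * (Real.sqrt ((2 * q).choose (q + j)) : ℂ) *
      (((2 * q).choose q : ℂ)⁻¹ *
    ∑ i ∈ Finset.range (q - j + 1), (((q - j).choose i * (q + j).choose (q - i) : ℕ) : ℂ) *
      ((entry 0 0 t * entry 1 1 t) ^ i * (entry 0 1 t * entry 1 0 t) ^ (q - j - i))) := by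
  have h (c : ℂ) (i k : ℕ) : pu (C c * ((C (1 / 2) * (X + 1)) ^ i * (C (1 / 2) * (X - 1)) ^ k)) t =
      c * ((entry 0 0 t * entry 1 1 t) ^ i * (entry 0 1 t * entry 1 0 t) ^ k) := by
    rw [map_mul, map_mul, map_pow, map_pow, pu_half_add, pu_half_sub, pu_C]
    rfl
  rw [weightPoly, map_mul, map_sum, pu_C, Pi.mul_apply, Finset.sum_apply, mul_assoc]
  simp only [h]

theorem T_add (q j : ℕ) (hj : j ≤ q) : T (2 * q) q (q + j) = PF ^ j * pu (weightPoly q j) := by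
  funext t
  rw [Pi.mul_apply, pu_weightPoly, T, min_eq_left (Nat.le_add_right q j)]
  have hq : q + 1 = j + (q - j + 1) := by omega
  rw [hq, Finset.sum_range_add, Finset.sum_eq_zero, zero_add, mul_left_comm ((PF ^ j) t),
    mul_left_comm ((PF ^ j) t)]
  · refine congrArg _ (congrArg _ ?_)
    rw [Finset.mul_sum]
    refine Finset.sum_congr rfl fun i hi => ?_
    have hi' : i ≤ q - j := Nat.lt_succ_iff.1 (Finset.mem_range.1 hi)
    have e1 : 2 * q - (q + j) = q - j := by omega
    have e2 : q - (j + i) = q - j - i := by omega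
    have e3 : q + j - (j + i) = q - j - i + j := by omega
    have e4 : q - j - (q - j - i) = i := by omega
    have e5 : (q + j).choose (q - i) = (q + j).choose (j + i) := by
      rw [← Nat.choose_symm (n := q + j) (k := j + i) (by omega)]
      congr 1; omega
    rw [e1, e2, e3, e4, e5, Nat.choose_symm hi']
    simp only [Pi.pow_apply, PF, Pi.mul_apply, entry]
    push_cast
    ring
  · intro i hi
    have hi' := Finset.mem_range.1 hi
    rw [Nat.choose_eq_zero_of_lt (n := 2 * q - (q + j)) (k := q - i) (by omega)]
    simp

theorem T_sub (q j : ℕ) (hj : j ≤ q) : T (2 * q) q (q - j) = MF ^ j * pu (weightPoly q j) := by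
  funext t
  have e0 : (2 * q).choose (q - j) = (2 * q).choose (q + j) := by
    rw [← Nat.choose_symm (n := 2 * q) (k := q + j) (by omega)]
    congr 1; omega
  rw [Pi.mul_apply, pu_weightPoly, T, min_eq_right (Nat.sub_le q j), e0,
    mul_left_comm ((MF ^ j) t), mul_left_comm ((MF ^ j) t)]
  refine congrArg _ (congrArg _ ?_)
  rw [Finset.mul_sum]
  refine Finset.sum_congr rfl fun i hi => ?_
  have hi' : i ≤ q - j := Nat.lt_succ_iff.1 (Finset.mem_range.1 hi)
  have e1 : 2 * q - (q - j) = q + j := by omega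
  have e3 : q + j - (q - i) = j + i := by omega
  have e4 : q - i = j + (q - j - i) := by omega
  rw [e1, e3, e4]
  simp only [Pi.pow_apply, MF, Pi.mul_apply, entry]
  push_cast
  ring

theorem T_mem (m j k : ℕ) : T m j k ∈ polyFun := by
  have h : T m j k = (fun _ => (Real.sqrt (m.choose j) : ℂ) * (Real.sqrt (m.choose k) : ℂ) *
      (m.choose j : ℂ)⁻¹) * ∑ i ∈ Finset.range (min j k + 1),
      (fun _ => ((k.choose i * (m - k).choose (j - i) : ℕ) : ℂ)) *
        (entry 1 1 ^ i * entry 0 1 ^ (k - i) * entry 1 0 ^ (j - i)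
          * entry 0 0 ^ (m - k - (j - i))) := by
    funext t
    simp only [T, Pi.mul_apply, Finset.sum_apply, Pi.pow_apply, entry]
    ring
  rw [h]
  refine mul_mem (polyFun.algebraMap_mem _) (sum_mem fun i _ => mul_mem (polyFun.algebraMap_mem _) ?_)
  exact mul_mem (mul_mem (mul_mem (pow_mem (entry_mem _ _) _) (pow_mem (entry_mem _ _) _))
    (pow_mem (entry_mem _ _) _)) (pow_mem (entry_mem _ _) _)

end

section

open Complex

/-! ### Laurent series: orders and coefficients -/

/-- The series of order at least `ρⁿ`. -/
def ordGE (n : ℤ) : AddSubgroup RhoSeries where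
  carrier := {f | ∀ k < n, f.coeff k = 0}
  zero_mem' _ _ := rfl
  add_mem' hf hg k hk := by rw [HahnSeries.coeff_add, hf k hk, hg k hk, add_zero]
  neg_mem' hf k hk := by rw [HahnSeries.coeff_neg, hf k hk, neg_zero]

variable {f g x y : RhoSeries} {m n : ℤ}

theorem ordGE_mono (h : m ≤ n) (hf : f ∈ ordGE n) : f ∈ ordGE m :=
  fun k hk => hf k (hk.trans_le h)

theorem exists_mem_ordGE (f : RhoSeries) : ∃ n, f ∈ ordGE n :=
  ⟨f.order, fun _ hk => HahnSeries.coeff_eq_zero_of_lt_order hk⟩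

theorem mul_mem_ordGE (hf : f ∈ ordGE m) (hg : g ∈ ordGE n) : f * g ∈ ordGE (m + n) := by
  intro k hk
  rw [HahnSeries.coeff_mul]
  refine Finset.sum_eq_zero fun ij hij => ?_
  rw [Finset.mem_antidiagonal] at hij
  obtain ⟨h1, h2, h3⟩ := hij
  have h4 : m ≤ ij.1 := not_lt.1 fun h => h1 (hf _ h)
  have h5 : n ≤ ij.2 := not_lt.1 fun h => h2 (hg _ h)
  omega

theorem coeff_mul_of_ordGE (hf : f ∈ ordGE m) (hg : g ∈ ordGE n) :
    (f * g).coeff (m + n) = f.coeff m * g.coeff n := by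
  have h : f - HahnSeries.single m (f.coeff m) ∈ ordGE (m + 1) := by
    intro k hk
    rcases (Int.lt_add_one_iff.1 hk).lt_or_eq with h | rfl
    · rw [HahnSeries.coeff_sub, hf k h, HahnSeries.coeff_single_of_ne h.ne, sub_zero]
    · rw [HahnSeries.coeff_sub, HahnSeries.coeff_single_same, sub_self]
  have h2 := mul_mem_ordGE h hg (m + n) (by omega)
  rw [sub_mul, HahnSeries.coeff_sub, sub_eq_zero, HahnSeries.coeff_single_mul] at h2
  rw [h2, add_sub_cancel_left]

theorem coeff_mul_of_ordGE' (hf : f ∈ ordGE m) (hg : g ∈ ordGE n) (k : ℤ) (hk : k = m + n) :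
    (f * g).coeff k = f.coeff m * g.coeff n := hk ▸ coeff_mul_of_ordGE hf hg

theorem coeff_rho_mul (k n : ℤ) (f : RhoSeries) : (rho k * f).coeff n = f.coeff (n - k) := by
  rw [rho, HahnSeries.coeff_single_mul, one_mul]

theorem coeff_const_mul (c : SU2 → ℂ) (n : ℤ) (f : RhoSeries) :
    (const c * f).coeff n = c * f.coeff n := by
  rw [const, HahnSeries.coeff_single_zero_mul]

theorem coeff_cst_mul (c : ℂ) (n : ℤ) (f : RhoSeries) :
    (cst c * f).coeff n = (fun _ => c) * f.coeff n := coeff_const_mul _ _ _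

theorem coeff_dRho (n : ℤ) (f : RhoSeries) :
    (dRho f).coeff n = ((n + 1 : ℤ) : SU2 → ℂ) * f.coeff (n + 1) := by
  show Ring.choose (n + (1 : ℕ)) 1 • f.coeff (n + (1 : ℕ)) = _
  rw [Ring.choose_one_right, zsmul_eq_mul, Nat.cast_one]

theorem coeff_dPlus (n : ℤ) (f : RhoSeries) : (dPlus f).coeff n = fieldPlus (f.coeff n) := rfl

theorem coeff_dMinus (n : ℤ) (f : RhoSeries) : (dMinus f).coeff n = fieldMinus (f.coeff n) := rfl

theorem rho_mem_ordGE (n : ℤ) : rho n ∈ ordGE n :=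
  fun _ hk => HahnSeries.coeff_single_of_ne hk.ne

theorem const_mem_ordGE (c : SU2 → ℂ) : const c ∈ ordGE 0 :=
  fun _ hk => HahnSeries.coeff_single_of_ne hk.ne

theorem cst_mem_ordGE (c : ℂ) : cst c ∈ ordGE 0 := const_mem_ordGE _

theorem cst_mul_mem_ordGE (c : ℂ) (hf : f ∈ ordGE n) : cst c * f ∈ ordGE n := by
  simpa using mul_mem_ordGE (cst_mem_ordGE c) hf

theorem one_mem_ordGE : (1 : RhoSeries) ∈ ordGE 0 := const_mem_ordGE 1

theorem dRho_mem_ordGE (hf : f ∈ ordGE n) : dRho f ∈ ordGE (n - 1) := by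
  intro k hk
  rw [coeff_dRho, hf (k + 1) (by omega), mul_zero]

theorem dPlus_mem_ordGE (hf : f ∈ ordGE n) : dPlus f ∈ ordGE n := by
  intro k hk
  rw [coeff_dPlus, hf k hk, map_zero]

theorem dMinus_mem_ordGE (hf : f ∈ ordGE n) : dMinus f ∈ ordGE n := by
  intro k hk
  rw [coeff_dMinus, hf k hk, map_zero]

/-- Multiplication by a series `1 + O(ρ)` does not raise the order. -/
theorem mem_ordGE_of_mul (hg : g ∈ ordGE 1) (h : x * (1 + g) ∈ ordGE n) : x ∈ ordGE n := by
  obtain ⟨N, hN⟩ := exists_mem_ordGE x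
  by_cases hNn : n ≤ N
  · exact ordGE_mono hNn hN
  refine Int.leInduction (m := N) (motive := fun k _ => k ≤ n → x ∈ ordGE k) (fun _ => hN)
    (fun k _ ih hk => ?_) n (by omega) le_rfl
  have hx := ih (by omega)
  have h1 : x = x * (1 + g) - x * g := by ring
  rw [h1]
  exact sub_mem (ordGE_mono hk h) (mul_mem_ordGE hx hg)

/-! ### Series with polynomial coefficients -/

/-- The series whose coefficients are polynomial functions on `SU(2)`. On these `X₊` and `X₋` act
linearly. -/
def polySeries : Subring RhoSeries where
  carrier := {f | ∀ n, f.coeff n ∈ polyFun}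
  zero_mem' _ := zero_mem _
  one_mem' n := by
    rw [HahnSeries.coeff_one]
    split_ifs
    exacts [one_mem _, zero_mem _]
  add_mem' hf hg n := add_mem (hf n) (hg n)
  neg_mem' hf n := neg_mem (hf n)
  mul_mem' {f g} hf hg n := by
    rw [HahnSeries.coeff_mul]
    exact sum_mem fun ij _ => mul_mem (hf _) (hg _)

theorem const_mem_polySeries {c : SU2 → ℂ} (hc : c ∈ polyFun) : const c ∈ polySeries := by
  intro n
  rcases eq_or_ne n 0 with rfl | h
  · rwa [const, HahnSeries.coeff_single_same]
  · rw [const, HahnSeries.coeff_single_of_ne h]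
    exact zero_mem _

theorem cst_mem_polySeries (c : ℂ) : cst c ∈ polySeries :=
  const_mem_polySeries (polyFun.algebraMap_mem c)

theorem rho_mem_polySeries (k : ℤ) : rho k ∈ polySeries := by
  intro n
  rcases eq_or_ne n k with rfl | h
  · rw [rho, HahnSeries.coeff_single_same]
    exact one_mem _
  · rw [rho, HahnSeries.coeff_single_of_ne h]
    exact zero_mem _

theorem sumRho_mem_polySeries {c : ℕ → SU2 → ℂ} (hc : ∀ n, c n ∈ polyFun) :
    sumRho c ∈ polySeries := by
  intro n
  rw [sumRho, PowerSeries.coeff_coe]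
  split_ifs
  · exact zero_mem _
  · rw [PowerSeries.coeff_mk]
    exact hc _

theorem dRho_mem_polySeries (hf : f ∈ polySeries) : dRho f ∈ polySeries := by
  intro n
  rw [coeff_dRho]
  exact mul_mem (intCast_mem _ _) (hf _)

theorem dPlus_mem_polySeries (hf : f ∈ polySeries) : dPlus f ∈ polySeries :=
  fun n => fieldPlus_mem (hf n)

theorem dMinus_mem_polySeries (hf : f ∈ polySeries) : dMinus f ∈ polySeries :=
  fun n => fieldMinus_mem (hf n)

theorem dPlus_add (hf : f ∈ polySeries) (hg : g ∈ polySeries) :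
    dPlus (f + g) = dPlus f + dPlus g := by
  ext1
  funext n
  exact fieldPlus_add (hf n) (hg n)

theorem dMinus_add (hf : f ∈ polySeries) (hg : g ∈ polySeries) :
    dMinus (f + g) = dMinus f + dMinus g := by
  ext1
  funext n
  exact fieldMinus_add (hf n) (hg n)

theorem dRho_add (f g : RhoSeries) : dRho (f + g) = dRho f + dRho g := map_add _ f g

theorem dPlus_cst_mul (c : ℂ) (f : RhoSeries) : dPlus (cst c * f) = cst c * dPlus f := by
  ext1
  funext n
  rw [coeff_dPlus, coeff_cst_mul, coeff_cst_mul, coeff_dPlus, fieldPlus_const_mul]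

theorem dMinus_cst_mul (c : ℂ) (f : RhoSeries) : dMinus (cst c * f) = cst c * dMinus f := by
  ext1
  funext n
  rw [coeff_dMinus, coeff_cst_mul, coeff_cst_mul, coeff_dMinus, fieldMinus_const_mul]

theorem dRho_cst_mul (c : ℂ) (f : RhoSeries) : dRho (cst c * f) = cst c * dRho f := by
  ext1
  funext n
  rw [coeff_dRho, coeff_cst_mul, coeff_cst_mul, coeff_dRho, mul_left_comm]

/-- Constant series, as a ring homomorphism. -/
def cstHom : ℂ →+* RhoSeries := HahnSeries.C.comp (algebraMap ℂ (SU2 → ℂ))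

theorem cst_mul (c d : ℂ) : cst (c * d) = cst c * cst d := cstHom.map_mul c d

theorem cst_neg (c : ℂ) : cst (-c) = -cst c := cstHom.map_neg c

theorem cst_ofNat (n : ℕ) [n.AtLeastTwo] : cst (OfNat.ofNat n) = OfNat.ofNat n :=
  map_ofNat cstHom n

theorem cst_one : cst 1 = 1 := rfl

theorem cst_zero : cst 0 = 0 := HahnSeries.single_eq_zero

theorem pow_mem_ordGE (hf : f ∈ ordGE 1) (k : ℕ) : f ^ k ∈ ordGE k := by
  induction k with
  | zero => exact one_mem_ordGE
  | succ k ih =>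
    rw [pow_succ, Nat.cast_succ]
    exact mul_mem_ordGE ih hf

/-- Division by a series `1 + O(ρ)` with polynomial coefficients preserves polynomiality. -/
theorem mem_polySeries_of_mul (hg : g ∈ ordGE 1) (hg' : g ∈ polySeries)
    (h : x * (1 + g) ∈ polySeries) : x ∈ polySeries := by
  intro n
  obtain ⟨N, hN⟩ := exists_mem_ordGE x
  obtain ⟨k, hk⟩ : ∃ k : ℕ, n < N + k := ⟨(n - N + 1).toNat, by omega⟩
  have h1 : x = x * (1 + g) * ∑ i ∈ Finset.range k, (-g) ^ i + x * (-g) ^ k := by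
    have h2 := mul_neg_geom_sum (-g) k
    rw [sub_neg_eq_add] at h2
    rw [mul_assoc, h2]
    ring
  have h3 : (x * (-g) ^ k).coeff n = 0 :=
    mul_mem_ordGE hN (pow_mem_ordGE (neg_mem hg) k) n hk
  rw [h1, HahnSeries.coeff_add, h3, add_zero]
  exact mul_mem h (sum_mem fun i _ => pow_mem (neg_mem hg') i) n

end

section

open Complex

/-! ### The connection coefficients -/

/-- The constant `1 / √2` as a series. -/
def invSqrtTwo : RhoSeries := cst (1 / (Real.sqrt 2 : ℂ))

/-- The constant `√2` as a series. -/
def sqrtTwo : RhoSeries := cst (Real.sqrt 2 : ℂ)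

theorem sqrtTwo_mul_invSqrtTwo : sqrtTwo * invSqrtTwo = 1 := by
  have h : (Real.sqrt 2 : ℂ) ≠ 0 := ofReal_ne_zero.2 (Real.sqrt_ne_zero'.2 two_pos)
  rw [sqrtTwo, invSqrtTwo, ← cst_mul, mul_one_div_cancel h, cst_one]

namespace FrameData

/-- The coefficient `α = 1/ρ + Z⁺` of `X₊` in `√2 c₀₀`. -/
def alpha (F : FrameData) : RhoSeries := rho (-1) + F.zPlus

/-- The coefficient `δ = 1/ρ + Y⁻` of `X₋` in `-√2 c₁₁`. -/
def delta (F : FrameData) : RhoSeries := rho (-1) + F.yMinus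

/-- The vector field `√2 c₀₀ = α X₊ + Z⁻ X₋`. -/
def e0 (F : FrameData) (f : RhoSeries) : RhoSeries := F.alpha * dPlus f + F.zMinus * dMinus f

/-- The vector field `-√2 c₁₁ = Y⁺ X₊ + δ X₋`. -/
def e1 (F : FrameData) (f : RhoSeries) : RhoSeries := F.yPlus * dPlus f + F.delta * dMinus f

variable (F : FrameData)

theorem cRho_diag (A : Fin 2) : F.cRho A A = 0 := by
  fin_cases A <;> simp [cRho, xs, cst_zero]

theorem cRho_zero_one : F.cRho 0 1 = invSqrtTwo := mul_one _

theorem cRho_one_zero : F.cRho 1 0 = invSqrtTwo := mul_one _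

theorem cPlus_zero_zero : F.cPlus 0 0 = invSqrtTwo * F.alpha := by
  simp [cPlus, ys, zs, cst_zero, alpha, invSqrtTwo, mul_add]

theorem cPlus_one_one : F.cPlus 1 1 = -(invSqrtTwo * F.yPlus) := by
  simp [cPlus, ys, zs, cst_zero, cst_neg, invSqrtTwo]
  ring

theorem cPlus_zero_one : F.cPlus 0 1 = 0 := by simp [cPlus, ys, zs, cst_zero]

theorem cPlus_one_zero : F.cPlus 1 0 = 0 := by simp [cPlus, ys, zs, cst_zero]

theorem cMinus_zero_zero : F.cMinus 0 0 = invSqrtTwo * F.zMinus := by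
  simp [cMinus, ys, zs, cst_zero, invSqrtTwo]

theorem cMinus_one_one : F.cMinus 1 1 = -(invSqrtTwo * F.delta) := by
  simp [cMinus, ys, zs, cst_zero, cst_neg, invSqrtTwo, delta, mul_add]
  ring

theorem cMinus_zero_one : F.cMinus 0 1 = 0 := by simp [cMinus, ys, zs, cst_zero]

theorem cMinus_one_zero : F.cMinus 1 0 = 0 := by simp [cMinus, ys, zs, cst_zero]

theorem frame_zero_zero (f : RhoSeries) : F.frame 0 0 f = invSqrtTwo * F.e0 f := by
  rw [frame, cRho_diag, cPlus_zero_zero, cMinus_zero_zero, e0]; ring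

theorem frame_one_one (f : RhoSeries) : F.frame 1 1 f = -(invSqrtTwo * F.e1 f) := by
  rw [frame, cRho_diag, cPlus_one_one, cMinus_one_one, e1]; ring

theorem frame_zero_one (f : RhoSeries) : F.frame 0 1 f = invSqrtTwo * dRho f := by
  rw [frame, cRho_zero_one, cPlus_zero_one, cMinus_zero_one]; ring

theorem frame_one_zero (f : RhoSeries) : F.frame 1 0 f = invSqrtTwo * dRho f := by
  rw [frame, cRho_one_zero, cPlus_one_zero, cMinus_one_zero]; ring

theorem dRho_inv_mul (f : RhoSeries) : dRho (invSqrtTwo * f) = invSqrtTwo * dRho f :=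
  dRho_cst_mul _ f

theorem e0_inv_mul (f : RhoSeries) : F.e0 (invSqrtTwo * f) = invSqrtTwo * F.e0 f := by
  rw [e0, e0, invSqrtTwo, dPlus_cst_mul, dMinus_cst_mul]; ring

theorem e1_inv_mul (f : RhoSeries) : F.e1 (invSqrtTwo * f) = invSqrtTwo * F.e1 f := by
  rw [e1, e1, invSqrtTwo, dPlus_cst_mul, dMinus_cst_mul]; ring

theorem dRho_neg (f : RhoSeries) : dRho (-f) = -dRho f := map_neg _ f

theorem e0_neg (f : RhoSeries) : F.e0 (-f) = -F.e0 f := by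
  have h : -f = cst (-1) * f := by rw [cst_neg, cst_one]; ring
  rw [h, e0, e0, dPlus_cst_mul, dMinus_cst_mul, cst_neg, cst_one]; ring

theorem e1_neg (f : RhoSeries) : F.e1 (-f) = -F.e1 f := by
  have h : -f = cst (-1) * f := by rw [cst_neg, cst_one]; ring
  rw [h, e1, e1, dPlus_cst_mul, dMinus_cst_mul, cst_neg, cst_one]; ring

theorem dPlus_zero : dPlus 0 = 0 := HahnSeries.map_zero fieldPlus

theorem dMinus_zero : dMinus 0 = 0 := HahnSeries.map_zero fieldMinus

theorem e0_zero : F.e0 0 = 0 := by rw [e0, dPlus_zero, dMinus_zero]; ring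

theorem e1_zero : F.e1 0 = 0 := by rw [e1, dPlus_zero, dMinus_zero]; ring

end FrameData

/-- The rescaled coefficients `κ`, `m`, `l`, `a`, `b` of a connection with `γ_{01CD} = 0`. In terms
of the frame `√2 c₀₀`, `-√2 c₁₁`, `∂_ρ`, the matrix `(κ - 1/ρ, m; l, κ - 1/ρ)` describes the second
fundamental form of the spheres of constant `ρ`, while `a` and `b` are the coefficients of their
intrinsic connection. -/
structure ConnCoeffs where
  kappa : RhoSeries
  m : RhoSeries
  l : RhoSeries
  a : RhoSeries
  b : RhoSeries

namespace ConnCoeffs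

/-- The rescaled coefficients of a connection. -/
def ofSpinor (g : Spinor4) : ConnCoeffs where
  kappa := rho (-1) + sqrtTwo * g 1 1 0 0
  m := -(sqrtTwo * g 0 0 0 0)
  l := sqrtTwo * g 1 1 1 1
  a := sqrtTwo * g 0 0 0 1
  b := sqrtTwo * g 1 1 0 1

/-- Half the trace of the second fundamental form of the spheres of constant `ρ`. -/
def k (c : ConnCoeffs) : RhoSeries := c.kappa - rho (-1)

end ConnCoeffs

/-- The commutator equations of the rescaled frame. -/
structure IsConnection (F : FrameData) (c : ConnCoeffs) : Prop where
  plus_zero : c.k * F.alpha + c.m * F.yPlus = dRho F.alpha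
  minus_zero : c.k * F.zMinus + c.m * F.delta = dRho F.zMinus
  plus_one : c.l * F.alpha + c.k * F.yPlus = dRho F.yPlus
  minus_one : c.l * F.zMinus + c.k * F.delta = dRho F.delta
  comm_plus : 2 * c.b * F.alpha - 2 * c.a * F.yPlus = F.e0 F.yPlus - F.e1 F.alpha
  comm_minus : 2 * c.b * F.zMinus - 2 * c.a * F.delta = F.e0 F.delta - F.e1 F.zMinus

namespace IsLeviCivita

open FrameData

variable {F : FrameData} {g : Spinor4}

theorem gammaMixed_zero (g : Spinor4) (A B C : Fin 2) : gammaMixed g A B 0 C = g A B 1 C := by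
  simp [gammaMixed, eps, cst_zero, cst_one]

theorem gammaMixed_one (g : Spinor4) (A B C : Fin 2) : gammaMixed g A B 1 C = -g A B 0 C := by
  simp [gammaMixed, eps, cst_zero, cst_one, cst_neg]
  ring

theorem trace (hg : IsLeviCivita F g) : g 0 0 1 1 = -g 1 1 0 0 := by
  have h := hg.torsion_rho 0 0 1 1
  have hs := sqrtTwo_mul_invSqrtTwo
  have h2 : sqrtTwo * sqrtTwo = 2 := by
    rw [sqrtTwo, ← cst_mul, ← ofReal_mul, Real.mul_self_sqrt zero_le_two, ofReal_ofNat, cst_ofNat]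
  simp only [torsionRHS, gammaMixed_zero, gammaMixed_one, Fin.sum_univ_two, cRho_diag, cRho_zero_one,
    cRho_one_zero, frame_zero_zero, frame_one_one, e0_zero, e1_zero] at h
  linear_combination (-(g 0 0 1 1) - g 1 1 0 0) * (hs * (sqrtTwo * invSqrtTwo + 1)
     - invSqrtTwo ^ 2 * h2) - invSqrtTwo * h

theorem isConnection (hg : IsLeviCivita F g) : IsConnection F (ConnCoeffs.ofSpinor g) := by
  have hs := sqrtTwo_mul_invSqrtTwo
  have ht := hg.trace
  have s0 := hg.symm_right 0 0 1 0
  have s1 := hg.symm_right 1 1 1 0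
  have p1 := hg.torsion_plus 0 0 0 1
  have p2 := hg.torsion_plus 1 1 0 1
  have p3 := hg.torsion_plus 0 0 1 1
  have m1 := hg.torsion_minus 0 0 0 1
  have m2 := hg.torsion_minus 1 1 0 1
  have m3 := hg.torsion_minus 0 0 1 1
  simp only [torsionRHS, gammaMixed_zero, gammaMixed_one, Fin.sum_univ_two, cPlus_zero_zero,
    cPlus_zero_one, cPlus_one_zero, cPlus_one_one, cMinus_zero_zero, cMinus_zero_one,
    cMinus_one_zero, cMinus_one_one, frame_zero_zero, frame_one_one, frame_zero_one,
    dRho_inv_mul, e0_inv_mul, e1_inv_mul, dRho_neg, e0_neg, e0_zero, e1_zero,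
    hg.radial, s0, s1, ht] at p1 p2 p3 m1 m2 m3
  constructor <;> simp only [ConnCoeffs.k, ConnCoeffs.ofSpinor]
  · linear_combination sqrtTwo ^ 2 * p1 - ((sqrtTwo * g 1 1 0 0) * F.alpha -
      sqrtTwo * g 0 0 0 0 * F.yPlus) * hs + dRho F.alpha * (sqrtTwo * invSqrtTwo + 1) * hs
  · linear_combination sqrtTwo ^ 2 * m1 - ((sqrtTwo * g 1 1 0 0) * F.zMinus -
      sqrtTwo * g 0 0 0 0 * F.delta) * hs + dRho F.zMinus * (sqrtTwo * invSqrtTwo + 1) * hs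
  · linear_combination -(sqrtTwo ^ 2) * p2 - (sqrtTwo * g 1 1 1 1 * F.alpha +
      sqrtTwo * g 1 1 0 0 * F.yPlus) * hs + dRho F.yPlus * (sqrtTwo * invSqrtTwo + 1) * hs
  · linear_combination -(sqrtTwo ^ 2) * m2 - (sqrtTwo * g 1 1 1 1 * F.zMinus +
      sqrtTwo * g 1 1 0 0 * F.delta) * hs + dRho F.delta * (sqrtTwo * invSqrtTwo + 1) * hs
  · linear_combination sqrtTwo ^ 2 * p3 - (2 * (sqrtTwo * g 1 1 0 1) * F.alpha -
      2 * (sqrtTwo * g 0 0 0 1) * F.yPlus) * hs + (F.e0 F.yPlus -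
      F.e1 F.alpha) * (sqrtTwo * invSqrtTwo + 1) * hs
  · linear_combination sqrtTwo ^ 2 * m3 - (2 * (sqrtTwo * g 1 1 0 1) * F.zMinus -
      2 * (sqrtTwo * g 0 0 0 1) * F.delta) * hs + (F.e0 F.delta -
      F.e1 F.zMinus) * (sqrtTwo * invSqrtTwo + 1) * hs

end IsLeviCivita

end

section

open Complex

/-! ### The constraint in terms of the rescaled frame -/

namespace ConnCoeffs

variable (F : FrameData) (c : ConnCoeffs)

/-- The divergence of the 1-form with components `U`, `X`, `W`. -/
def divForm (U X W : RhoSeries) : RhoSeries :=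
  F.e0 W - F.e1 U + 4 * c.k * X + 2 * c.a * W - 2 * c.b * U - 2 * dRho X

/-- The components of twice the conformal Killing operator on the 1-form
`v₀₀ = U/√2`, `v₀₁ = X/√2`, `v₁₁ = W/√2`, numbered by the number of indices equal to `1`. -/
def killing (U X W : RhoSeries) : ℕ → RhoSeries
  | 0 => 2 * F.e0 U - 4 * c.a * U - 4 * c.m * X
  | 1 => F.e0 X - c.m * W + c.k * U + dRho U
  | 2 => 2 * dRho X + cst (1 / 3) * divForm F c U X W
  | 3 => -F.e1 X + c.k * W - c.l * U + dRho W
  | _ => -2 * F.e1 W - 4 * c.l * X + 4 * c.b * W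

/-- The components of `√2` times the divergence of the totally symmetric spinor whose components
are `S 0`, …, `S 4`. -/
def divSym (S : ℕ → RhoSeries) : ℕ → RhoSeries
  | 0 => -2 * dRho (S 1) + 6 * c.k * S 1 + F.e0 (S 2) - 2 * c.m * S 3 - F.e1 (S 0) - 4 * c.b * S 0
  | 1 => -2 * dRho (S 2) + 6 * c.k * S 2 + F.e0 (S 3) + 2 * c.a * S 3 - c.m * S 4 - F.e1 (S 1)
      - 2 * c.b * S 1 - c.l * S 0
  | _ => -2 * dRho (S 3) + 6 * c.k * S 3 + F.e0 (S 4) + 4 * c.a * S 4 - F.e1 (S 2) - 2 * c.l * S 1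

end ConnCoeffs

open FrameData ConnCoeffs IsLeviCivita

variable {F : FrameData} {g : Spinor4}

theorem apply_eq (x : RhoSeries) : x = invSqrtTwo * (sqrtTwo * x) := by
  linear_combination (-x) * sqrtTwo_mul_invSqrtTwo

theorem invSqrtTwo_sq : invSqrtTwo * invSqrtTwo = cst (1 / 2) := by
  rw [invSqrtTwo, ← cst_mul, div_mul_div_comm, ← ofReal_mul, Real.mul_self_sqrt zero_le_two, one_mul,
    ofReal_ofNat]

theorem cst_two_mul_half : 2 * cst (1 / 2) = 1 := by
  rw [← cst_ofNat, ← cst_mul, mul_one_div_cancel two_ne_zero, cst_one]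

set_option linter.unusedSimpArgs false in
theorem div4_eq (hg : IsLeviCivita F g) (psi : Spinor4) (S : ℕ → RhoSeries)
    (h : ∀ A B C D, psi A B C D = S (A.val + B.val + C.val + D.val)) (C D : Fin 2) :
    div4 F g psi C D = invSqrtTwo * divSym F (ofSpinor g) S (C.val + D.val) := by
  have s0 := hg.symm_right 0 0 1 0
  have s1 := hg.symm_right 1 1 1 0
  have ht := hg.trace
  have hr10 (C D) : g 1 0 C D = 0 := by rw [hg.symm_left, hg.radial]
  generalize hc : ofSpinor g = c
  have e1 : g 1 1 0 0 = invSqrtTwo * c.k := by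
    rw [← hc, k, ofSpinor, add_sub_cancel_left, ← apply_eq]
  have e2 : g 0 0 0 0 = -(invSqrtTwo * c.m) := by
    have hm : c.m = -(sqrtTwo * g 0 0 0 0) := hc ▸ rfl
    rw [hm]
    linear_combination apply_eq (g 0 0 0 0)
  have e3 : g 1 1 1 1 = invSqrtTwo * c.l := by rw [← hc, ofSpinor, ← apply_eq]
  have e4 : g 0 0 0 1 = invSqrtTwo * c.a := by rw [← hc, ofSpinor, ← apply_eq]
  have e5 : g 1 1 0 1 = invSqrtTwo * c.b := by rw [← hc, ofSpinor, ← apply_eq]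
  fin_cases C <;> fin_cases D <;>
  · simp only [div4, covD4, Fin.sum_univ_two, gammaMixed_zero, gammaMixed_one, frame_zero_zero,
      frame_one_one, frame_zero_one, frame_one_zero, h, hg.radial, hr10, s0, s1, ht, eps, divSym,
      e1, e2, e3, e4, e5, Fin.zero_eta, Fin.mk_one, Matrix.cons_val_zero, Matrix.cons_val_one,
      Fin.val_zero, Fin.val_one, add_zero, zero_add, mul_zero, zero_mul, mul_one, cst_zero, cst_one,
      mul_neg, neg_neg, cst_neg, Nat.reduceAdd, Matrix.cons_val_fin_one]
    ring

theorem cst_hs (A B C D : Fin 2) : cst (2 / 3 * MomentumExpansion.hs A B C D) =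
    if A = B ∧ C = D ∧ A ≠ C then 2 * cst (1 / 3) else if A ≠ B ∧ C ≠ D then -cst (1 / 3) else 0 := by
  have h1 : cst (2 / 3) = 2 * cst (1 / 3) := by rw [← cst_ofNat, ← cst_mul, mul_one_div]
  fin_cases A <;> fin_cases B <;> fin_cases C <;> fin_cases D <;>
  · norm_num [MomentumExpansion.hs, eps, cst_zero]
    try simp [h1, cst_neg]

set_option linter.unusedSimpArgs false in
theorem conformalKilling_eq (hg : IsLeviCivita F g) (v : Spinor2) (U X W : RhoSeries)
    (h00 : v 0 0 = invSqrtTwo * U) (h01 : v 0 1 = invSqrtTwo * X) (h10 : v 1 0 = invSqrtTwo * X)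
    (h11 : v 1 1 = invSqrtTwo * W) (A B C D : Fin 2) :
    conformalKilling F g v A B C D =
      cst (1 / 2) * killing F (ofSpinor g) U X W (A.val + B.val + C.val + D.val) := by
  have s0 := hg.symm_right 0 0 1 0
  have s1 := hg.symm_right 1 1 1 0
  have ht := hg.trace
  have hr10 (C D) : g 1 0 C D = 0 := by rw [hg.symm_left, hg.radial]
  generalize hc : ofSpinor g = c
  have e1 : g 1 1 0 0 = invSqrtTwo * c.k := by
    rw [← hc, k, ofSpinor, add_sub_cancel_left, ← apply_eq]
  have e2 : g 0 0 0 0 = -(invSqrtTwo * c.m) := by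
    have hm : c.m = -(sqrtTwo * g 0 0 0 0) := hc ▸ rfl
    rw [hm]
    linear_combination apply_eq (g 0 0 0 0)
  have e3 : g 1 1 1 1 = invSqrtTwo * c.l := by rw [← hc, ofSpinor, ← apply_eq]
  have e4 : g 0 0 0 1 = invSqrtTwo * c.a := by rw [← hc, ofSpinor, ← apply_eq]
  have e5 : g 1 1 0 1 = invSqrtTwo * c.b := by rw [← hc, ofSpinor, ← apply_eq]
  have hs := invSqrtTwo_sq
  have h31 : 3 * cst (1 / 3) = 1 := by
    rw [← cst_ofNat, ← cst_mul, mul_one_div_cancel three_ne_zero, cst_one]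
  have hd : div2 F g v = cst (1 / 2) * divForm F c U X W := by
    simp only [div2, covD2, Fin.sum_univ_two, gammaMixed_zero, gammaMixed_one, frame_zero_zero,
      frame_one_one, frame_zero_one, frame_one_zero, h00, h01, h10, h11, hg.radial, hr10, s0, s1, ht,
      eps, divForm, e1, e2, e3, e4, e5, Fin.zero_eta, Fin.mk_one, Matrix.cons_val_zero,
      Matrix.cons_val_one, add_zero, zero_add, mul_zero, zero_mul, mul_one, cst_zero, cst_one,
      mul_neg, neg_neg, cst_neg, Matrix.cons_val_fin_one, e0_inv_mul, e1_inv_mul, dRho_inv_mul]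
    rw [← hs]
    ring
  rw [conformalKilling, hd, cst_hs, ← hs]
  fin_cases A <;> fin_cases B <;> fin_cases C <;> fin_cases D <;>
  · simp only [covD2, Fin.sum_univ_two, gammaMixed_zero, gammaMixed_one, frame_zero_zero,
      frame_one_one, frame_zero_one, frame_one_zero, h00, h01, h10, h11, hg.radial, hr10, s0, s1, ht,
      e1, e2, e3, e4, e5, Fin.zero_eta, Fin.mk_one, Matrix.cons_val_zero,
      Matrix.cons_val_one, Fin.val_zero, Fin.val_one, add_zero, zero_add, mul_zero, zero_mul, mul_one,
      cst_zero, cst_one, mul_neg, neg_neg, cst_neg, Nat.reduceAdd, Matrix.cons_val_fin_one, killing,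
      e0_inv_mul, e1_inv_mul, dRho_inv_mul]
    simp (decide := true) only [if_true, if_false]
    first
      | ring1
      | rw [divForm]
        linear_combination -(invSqrtTwo * invSqrtTwo) *
          (F.e0 W - F.e1 U + 4 * c.k * X + 2 * c.a * W - 2 * c.b * U - 2 * dRho X) * h31

end

section

open Complex

/-! ### The coefficients of the connection -/

theorem rho_mul_rho (m n : ℤ) : rho m * rho n = rho (m + n) := by
  rw [rho, rho, rho, HahnSeries.single_mul_single, one_mul]

theorem rho_one_mul_rho_neg_one : rho 1 * rho (-1) = 1 := rho_mul_rho 1 (-1)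

theorem dRho_rho_neg_one : dRho (rho (-1)) = -(rho (-1) * rho (-1)) := by
  rw [rho_mul_rho]
  ext1
  funext n
  rw [coeff_dRho, HahnSeries.coeff_neg, rho, rho, HahnSeries.coeff_single, HahnSeries.coeff_single]
  by_cases h : n = -2
  · subst h; simp
  · have h' : n + 1 ≠ -1 := by omega
    simp [h, h']

theorem dPlus_rho (n : ℤ) : dPlus (rho n) = 0 := by
  ext1
  funext k
  rw [coeff_dPlus, rho, HahnSeries.coeff_single]
  split_ifs
  · exact (HasFields.algebraMap 1).fieldPlus_eq
  · exact map_zero _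

theorem dMinus_rho (n : ℤ) : dMinus (rho n) = 0 := by
  ext1
  funext k
  rw [coeff_dMinus, rho, HahnSeries.coeff_single]
  split_ifs
  · exact (HasFields.algebraMap 1).fieldMinus_eq
  · exact map_zero _

theorem coeff_sumRho (c : ℕ → SU2 → ℂ) (n : ℕ) : (sumRho c).coeff n = c n := by
  rw [sumRho, HahnSeries.ofPowerSeries_apply_coeff, PowerSeries.coeff_mk]

theorem sumRho_mem_ordGE {c : ℕ → SU2 → ℂ} {N : ℕ} (hc : ∀ n < N, c n = 0) :
    sumRho c ∈ ordGE N := by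
  intro k hk
  by_cases h : k < 0
  · rw [sumRho, PowerSeries.coeff_coe, if_pos h]
  · lift k to ℕ using not_lt.1 h
    rw [coeff_sumRho, hc k (by omega)]

theorem sum_T_mem (s : Finset ℕ) (c : ℕ → ℂ) (k : ℕ → ℕ) :
    (fun t => ∑ q ∈ s, c q * T (2 * q) q (k q) t) ∈ polyFun := by
  have h : (fun t => ∑ q ∈ s, c q * T (2 * q) q (k q) t) =
      ∑ q ∈ s, (fun _ => c q) * T (2 * q) q (k q) := by
    funext t
    simp [Finset.sum_apply]
  rw [h]
  exact sum_mem fun q _ => mul_mem (polyFun.algebraMap_mem _) (T_mem _ _ _)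

theorem ite_fun_mem (p : Prop) [Decidable p] {f : SU2 → ℂ} (hf : f ∈ polyFun) :
    (if p then f else 0) ∈ polyFun := by
  split_ifs
  exacts [hf, zero_mem _]

namespace FrameData

variable (F : FrameData)

theorem yPlus_mem : F.yPlus ∈ polySeries :=
  sumRho_mem_polySeries fun _ => ite_fun_mem _ (sum_T_mem _ _ _)

theorem yMinus_mem : F.yMinus ∈ polySeries :=
  sumRho_mem_polySeries fun _ => ite_fun_mem _ (sum_T_mem _ _ _)

theorem zPlus_mem : F.zPlus ∈ polySeries :=
  sumRho_mem_polySeries fun _ => ite_fun_mem _ (sum_T_mem _ _ _)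

theorem zMinus_mem : F.zMinus ∈ polySeries :=
  sumRho_mem_polySeries fun _ => ite_fun_mem _ (sum_T_mem _ _ _)

theorem yPlus_ord : F.yPlus ∈ ordGE 2 := sumRho_mem_ordGE fun _ hn => if_neg (not_le.2 hn)

theorem yMinus_ord : F.yMinus ∈ ordGE 2 := sumRho_mem_ordGE fun _ hn => if_neg (not_le.2 hn)

theorem zPlus_ord : F.zPlus ∈ ordGE 2 := sumRho_mem_ordGE fun _ hn => if_neg (not_le.2 hn)

theorem zMinus_ord : F.zMinus ∈ ordGE 2 := sumRho_mem_ordGE fun _ hn => if_neg (not_le.2 hn)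

theorem dRho_alpha : dRho F.alpha = -(rho (-1) * rho (-1)) + dRho F.zPlus := by
  rw [alpha, dRho_add, dRho_rho_neg_one]

theorem dRho_delta : dRho F.delta = -(rho (-1) * rho (-1)) + dRho F.yMinus := by
  rw [delta, dRho_add, dRho_rho_neg_one]

theorem e0_delta : F.e0 F.delta = F.e0 F.yMinus := by
  rw [e0, e0, delta, dPlus_add (rho_mem_polySeries _) F.yMinus_mem,
    dMinus_add (rho_mem_polySeries _) F.yMinus_mem, dPlus_rho, dMinus_rho, zero_add, zero_add]

theorem e1_alpha : F.e1 F.alpha = F.e1 F.zPlus := by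
  rw [e1, e1, alpha, dPlus_add (rho_mem_polySeries _) F.zPlus_mem,
    dMinus_add (rho_mem_polySeries _) F.zPlus_mem, dPlus_rho, dMinus_rho, zero_add, zero_add]

variable {F} {f g : RhoSeries} {n : ℤ}

theorem e0_add (hf : f ∈ polySeries) (hg : g ∈ polySeries) : F.e0 (f + g) = F.e0 f + F.e0 g := by
  rw [e0, e0, e0, dPlus_add hf hg, dMinus_add hf hg]; ring

theorem e1_add (hf : f ∈ polySeries) (hg : g ∈ polySeries) : F.e1 (f + g) = F.e1 f + F.e1 g := by
  rw [e1, e1, e1, dPlus_add hf hg, dMinus_add hf hg]; ring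

/-- The part of `e0` that vanishes for the flat metric. -/
def e0Pert (F : FrameData) (f : RhoSeries) : RhoSeries :=
  F.zPlus * dPlus f + F.zMinus * dMinus f

/-- The part of `e1` that vanishes for the flat metric. -/
def e1Pert (F : FrameData) (f : RhoSeries) : RhoSeries :=
  F.yPlus * dPlus f + F.yMinus * dMinus f

theorem e0_eq (f : RhoSeries) : F.e0 f = rho (-1) * dPlus f + F.e0Pert f := by
  rw [e0, e0Pert, alpha]; ring

theorem e1_eq (f : RhoSeries) : F.e1 f = rho (-1) * dMinus f + F.e1Pert f := by
  rw [e1, e1Pert, delta]; ring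

theorem e0Pert_ord (hf : f ∈ ordGE n) : F.e0Pert f ∈ ordGE (2 + n) :=
  add_mem (mul_mem_ordGE F.zPlus_ord (dPlus_mem_ordGE hf))
    (mul_mem_ordGE F.zMinus_ord (dMinus_mem_ordGE hf))

theorem e1Pert_ord (hf : f ∈ ordGE n) : F.e1Pert f ∈ ordGE (2 + n) :=
  add_mem (mul_mem_ordGE F.yPlus_ord (dPlus_mem_ordGE hf))
    (mul_mem_ordGE F.yMinus_ord (dMinus_mem_ordGE hf))

theorem coeff_e0Pert (hf : f ∈ ordGE n) (k : ℤ) (hk : k = 2 + n) : (F.e0Pert f).coeff k =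
    F.zPlus.coeff 2 * fieldPlus (f.coeff n) + F.zMinus.coeff 2 * fieldMinus (f.coeff n) := by
  rw [e0Pert, HahnSeries.coeff_add, coeff_mul_of_ordGE' F.zPlus_ord (dPlus_mem_ordGE hf) k hk,
    coeff_mul_of_ordGE' F.zMinus_ord (dMinus_mem_ordGE hf) k hk, coeff_dPlus, coeff_dMinus]

theorem coeff_e1Pert (hf : f ∈ ordGE n) (k : ℤ) (hk : k = 2 + n) : (F.e1Pert f).coeff k =
    F.yPlus.coeff 2 * fieldPlus (f.coeff n) + F.yMinus.coeff 2 * fieldMinus (f.coeff n) := by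
  rw [e1Pert, HahnSeries.coeff_add, coeff_mul_of_ordGE' F.yPlus_ord (dPlus_mem_ordGE hf) k hk,
    coeff_mul_of_ordGE' F.yMinus_ord (dMinus_mem_ordGE hf) k hk, coeff_dPlus, coeff_dMinus]

end FrameData

theorem rho_one_mul_ord {f : RhoSeries} {n : ℤ} (hf : f ∈ ordGE (n - 1)) : rho 1 * f ∈ ordGE n := by
  simpa using mul_mem_ordGE (rho_mem_ordGE 1) hf

theorem coeff_rho_mul_mul {x y : RhoSeries} (hx : x ∈ ordGE 2) (hy : y ∈ ordGE 2) {n : ℤ}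
    (hn : n ≤ 5) : (rho 1 * (x * y)).coeff n = if n = 5 then x.coeff 2 * y.coeff 2 else 0 := by
  rw [coeff_rho_mul]
  split_ifs with h
  · exact coeff_mul_of_ordGE' hx hy _ (by omega)
  · exact mul_mem_ordGE hx hy _ (by omega)

namespace IsConnection

open FrameData

variable {F : FrameData} {c : ConnCoeffs}

theorem kappa_eq (h : IsConnection F c) : c.kappa + rho 1 * (c.kappa * F.zPlus) +
    rho 1 * (c.m * F.yPlus) = F.zPlus + rho 1 * dRho F.zPlus := by
  have h1 := h.plus_zero
  rw [dRho_alpha, ConnCoeffs.k, alpha] at h1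
  linear_combination rho 1 * h1 + (F.zPlus - c.kappa) * rho_one_mul_rho_neg_one

theorem kappa_eq' (h : IsConnection F c) : c.kappa + rho 1 * (c.kappa * F.yMinus) +
    rho 1 * (c.l * F.zMinus) = F.yMinus + rho 1 * dRho F.yMinus := by
  have h1 := h.minus_one
  rw [dRho_delta, ConnCoeffs.k, delta] at h1
  linear_combination rho 1 * h1 + (F.yMinus - c.kappa) * rho_one_mul_rho_neg_one

theorem m_eq (h : IsConnection F c) : c.m + rho 1 * (c.kappa * F.zMinus) +
    rho 1 * (c.m * F.yMinus) = F.zMinus + rho 1 * dRho F.zMinus := by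
  have h1 := h.minus_zero
  rw [ConnCoeffs.k, delta] at h1
  linear_combination rho 1 * h1 + (F.zMinus - c.m) * rho_one_mul_rho_neg_one

theorem l_eq (h : IsConnection F c) : c.l + rho 1 * (c.kappa * F.yPlus) +
    rho 1 * (c.l * F.zPlus) = F.yPlus + rho 1 * dRho F.yPlus := by
  have h1 := h.plus_one
  rw [ConnCoeffs.k, alpha] at h1
  linear_combination rho 1 * h1 + (F.yPlus - c.l) * rho_one_mul_rho_neg_one

theorem b_eq (h : IsConnection F c) : 2 * c.b + 2 * (rho 1 * (c.b * F.zPlus)) -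
    2 * (rho 1 * (c.a * F.yPlus)) = dPlus F.yPlus - dMinus F.zPlus +
      rho 1 * (F.e0Pert F.yPlus) - rho 1 * (F.e1Pert F.zPlus) := by
  have h1 := h.comm_plus
  rw [e1_alpha, e0_eq, e1_eq, alpha] at h1
  linear_combination rho 1 * h1 +
    (dPlus F.yPlus - dMinus F.zPlus - 2 * c.b) * rho_one_mul_rho_neg_one

theorem a_eq (h : IsConnection F c) : 2 * c.a + 2 * (rho 1 * (c.a * F.yMinus)) -
    2 * (rho 1 * (c.b * F.zMinus)) = dMinus F.zMinus - dPlus F.yMinus +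
      rho 1 * (F.e1Pert F.zMinus) - rho 1 * (F.e0Pert F.yMinus) := by
  have h1 := h.comm_minus
  rw [e0_delta, e0_eq, e1_eq, delta] at h1
  linear_combination -rho 1 * h1 +
    (dMinus F.zMinus - dPlus F.yMinus - 2 * c.a) * rho_one_mul_rho_neg_one

end IsConnection

end

section

open Complex

theorem solve_pair {x y h₁ h₂ h₃ h₄ r₁ r₂ : RhoSeries} (e₁ : x * (1 + h₁) + y * h₂ = r₁)
    (e₂ : x * h₃ + y * (1 + h₄) = r₂) :
    x * (1 + (h₁ + h₄ + h₁ * h₄ - h₂ * h₃)) = r₁ * (1 + h₄) - r₂ * h₂ := by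
  linear_combination (1 + h₄) * e₁ - h₂ * e₂

theorem solve_pair_ord {x y h₁ h₂ h₃ h₄ r₁ r₂ : RhoSeries} {n : ℤ}
    (e₁ : x * (1 + h₁) + y * h₂ = r₁) (e₂ : x * h₃ + y * (1 + h₄) = r₂)
    (i₁ : h₁ ∈ ordGE 1) (i₂ : h₂ ∈ ordGE 1) (i₃ : h₃ ∈ ordGE 1) (i₄ : h₄ ∈ ordGE 1)
    (j₁ : r₁ ∈ ordGE n) (j₂ : r₂ ∈ ordGE n) : x ∈ ordGE n := by
  have hm {f g : RhoSeries} (hf : f ∈ ordGE 1) (hg : g ∈ ordGE 1) : f * g ∈ ordGE 1 :=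
    ordGE_mono (by norm_num) (mul_mem_ordGE hf hg)
  refine mem_ordGE_of_mul (g := h₁ + h₄ + h₁ * h₄ - h₂ * h₃)
    (sub_mem (add_mem (add_mem i₁ i₄) (hm i₁ i₄)) (hm i₂ i₃)) ?_
  rw [solve_pair e₁ e₂, mul_add, mul_one]
  exact sub_mem (add_mem j₁ (ordGE_mono (by omega) (mul_mem_ordGE j₁ i₄)))
    (ordGE_mono (by omega) (mul_mem_ordGE j₂ i₂))

theorem solve_pair_mem {x y h₁ h₂ h₃ h₄ r₁ r₂ : RhoSeries}
    (e₁ : x * (1 + h₁) + y * h₂ = r₁) (e₂ : x * h₃ + y * (1 + h₄) = r₂)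
    (i₁ : h₁ ∈ ordGE 1) (i₂ : h₂ ∈ ordGE 1) (i₃ : h₃ ∈ ordGE 1) (i₄ : h₄ ∈ ordGE 1)
    (k₁ : h₁ ∈ polySeries) (k₂ : h₂ ∈ polySeries) (k₃ : h₃ ∈ polySeries) (k₄ : h₄ ∈ polySeries)
    (j₁ : r₁ ∈ polySeries) (j₂ : r₂ ∈ polySeries) : x ∈ polySeries := by
  have hm {f g : RhoSeries} (hf : f ∈ ordGE 1) (hg : g ∈ ordGE 1) : f * g ∈ ordGE 1 :=
    ordGE_mono (by norm_num) (mul_mem_ordGE hf hg)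
  refine mem_polySeries_of_mul (g := h₁ + h₄ + h₁ * h₄ - h₂ * h₃)
    (sub_mem (add_mem (add_mem i₁ i₄) (hm i₁ i₄)) (hm i₂ i₃))
    (sub_mem (add_mem (add_mem k₁ k₄) (mul_mem k₁ k₄)) (mul_mem k₂ k₃)) ?_
  rw [solve_pair e₁ e₂]
  exact sub_mem (mul_mem j₁ (add_mem (one_mem _) k₄)) (mul_mem j₂ k₂)

theorem rho_one_mul_mem {f : RhoSeries} (hf : f ∈ polySeries) : rho 1 * f ∈ polySeries :=
  mul_mem (rho_mem_polySeries 1) hf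

theorem rho_one_mul_ord_one {f : RhoSeries} (hf : f ∈ ordGE 2) : rho 1 * f ∈ ordGE 1 :=
  rho_one_mul_ord (ordGE_mono (by norm_num) hf)

theorem add_rho_mul_dRho_ord {f : RhoSeries} (hf : f ∈ ordGE 2) :
    f + rho 1 * dRho f ∈ ordGE 2 :=
  add_mem hf (rho_one_mul_ord (dRho_mem_ordGE hf))

theorem add_rho_mul_dRho_mem {f : RhoSeries} (hf : f ∈ polySeries) :
    f + rho 1 * dRho f ∈ polySeries :=
  add_mem hf (rho_one_mul_mem (dRho_mem_polySeries hf))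

theorem coeff_rho_mul_dRho (f : RhoSeries) (n : ℤ) :
    (rho 1 * dRho f).coeff n = (n : SU2 → ℂ) * f.coeff n := by
  rw [coeff_rho_mul, coeff_dRho, sub_add_cancel]

theorem mem_of_two_mul_mem {f : RhoSeries} (h : 2 * f ∈ polySeries) : f ∈ polySeries := by
  have h1 : f = cst (1 / 2) * (2 * f) := by linear_combination (-f) * cst_two_mul_half
  rw [h1]
  exact mul_mem (cst_mem_polySeries _) h

theorem ord_of_two_mul_ord {f : RhoSeries} {n : ℤ} (h : 2 * f ∈ ordGE n) : f ∈ ordGE n := by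
  have h1 : f = cst (1 / 2) * (2 * f) := by linear_combination (-f) * cst_two_mul_half
  rw [h1]
  exact cst_mul_mem_ordGE _ h

theorem coeff_two_mul (f : RhoSeries) (n : ℤ) : (2 * f).coeff n = 2 * f.coeff n := by
  rw [← cst_ofNat 2, coeff_cst_mul]
  rfl

theorem coeff_four_mul (f : RhoSeries) (n : ℤ) : (4 * f).coeff n = 4 * f.coeff n := by
  rw [← cst_ofNat 4, coeff_cst_mul]
  rfl

theorem coeff_six_mul (f : RhoSeries) (n : ℤ) : (6 * f).coeff n = 6 * f.coeff n := by
  rw [← cst_ofNat 6, coeff_cst_mul]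
  rfl

namespace FrameData

variable {F : FrameData} {f : RhoSeries}

theorem e0Pert_mem (hf : f ∈ polySeries) : F.e0Pert f ∈ polySeries :=
  add_mem (mul_mem F.zPlus_mem (dPlus_mem_polySeries hf))
    (mul_mem F.zMinus_mem (dMinus_mem_polySeries hf))

theorem e1Pert_mem (hf : f ∈ polySeries) : F.e1Pert f ∈ polySeries :=
  add_mem (mul_mem F.yPlus_mem (dPlus_mem_polySeries hf))
    (mul_mem F.yMinus_mem (dMinus_mem_polySeries hf))

end FrameData

namespace IsConnection

open FrameData

variable {F : FrameData} {c : ConnCoeffs}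

theorem kappa_ord (h : IsConnection F c) : c.kappa ∈ ordGE 2 :=
  solve_pair_ord (x := c.kappa) (y := c.m) (h₁ := rho 1 * F.zPlus) (h₂ := rho 1 * F.yPlus)
    (h₃ := rho 1 * F.zMinus) (h₄ := rho 1 * F.yMinus)
    (by rw [← h.kappa_eq]; ring) (by rw [← h.m_eq]; ring)
    (rho_one_mul_ord_one F.zPlus_ord) (rho_one_mul_ord_one F.yPlus_ord)
    (rho_one_mul_ord_one F.zMinus_ord) (rho_one_mul_ord_one F.yMinus_ord)
    (add_rho_mul_dRho_ord F.zPlus_ord) (add_rho_mul_dRho_ord F.zMinus_ord)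

theorem kappa_mem (h : IsConnection F c) : c.kappa ∈ polySeries :=
  solve_pair_mem (x := c.kappa) (y := c.m) (h₁ := rho 1 * F.zPlus) (h₂ := rho 1 * F.yPlus)
    (h₃ := rho 1 * F.zMinus) (h₄ := rho 1 * F.yMinus)
    (by rw [← h.kappa_eq]; ring) (by rw [← h.m_eq]; ring)
    (rho_one_mul_ord_one F.zPlus_ord) (rho_one_mul_ord_one F.yPlus_ord)
    (rho_one_mul_ord_one F.zMinus_ord) (rho_one_mul_ord_one F.yMinus_ord)
    (rho_one_mul_mem F.zPlus_mem) (rho_one_mul_mem F.yPlus_mem)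
    (rho_one_mul_mem F.zMinus_mem) (rho_one_mul_mem F.yMinus_mem)
    (add_rho_mul_dRho_mem F.zPlus_mem) (add_rho_mul_dRho_mem F.zMinus_mem)

theorem m_ord (h : IsConnection F c) : c.m ∈ ordGE 2 := by
  refine mem_ordGE_of_mul (g := rho 1 * F.yMinus) (rho_one_mul_ord_one F.yMinus_ord) ?_
  have h1 : c.m * (1 + rho 1 * F.yMinus) = F.zMinus + rho 1 * dRho F.zMinus
      - c.kappa * (rho 1 * F.zMinus) := by rw [← h.m_eq]; ring
  rw [h1]
  exact sub_mem (add_rho_mul_dRho_ord F.zMinus_ord)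
    (ordGE_mono (by norm_num) (mul_mem_ordGE h.kappa_ord (rho_one_mul_ord_one F.zMinus_ord)))

theorem m_mem (h : IsConnection F c) : c.m ∈ polySeries := by
  refine mem_polySeries_of_mul (g := rho 1 * F.yMinus) (rho_one_mul_ord_one F.yMinus_ord)
    (rho_one_mul_mem F.yMinus_mem) ?_
  have h1 : c.m * (1 + rho 1 * F.yMinus) = F.zMinus + rho 1 * dRho F.zMinus
      - c.kappa * (rho 1 * F.zMinus) := by rw [← h.m_eq]; ring
  rw [h1]
  exact sub_mem (add_rho_mul_dRho_mem F.zMinus_mem)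
    (mul_mem h.kappa_mem (rho_one_mul_mem F.zMinus_mem))

theorem l_ord (h : IsConnection F c) : c.l ∈ ordGE 2 := by
  refine mem_ordGE_of_mul (g := rho 1 * F.zPlus) (rho_one_mul_ord_one F.zPlus_ord) ?_
  have h1 : c.l * (1 + rho 1 * F.zPlus) = F.yPlus + rho 1 * dRho F.yPlus
      - c.kappa * (rho 1 * F.yPlus) := by rw [← h.l_eq]; ring
  rw [h1]
  exact sub_mem (add_rho_mul_dRho_ord F.yPlus_ord)
    (ordGE_mono (by norm_num) (mul_mem_ordGE h.kappa_ord (rho_one_mul_ord_one F.yPlus_ord)))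

theorem l_mem (h : IsConnection F c) : c.l ∈ polySeries := by
  refine mem_polySeries_of_mul (g := rho 1 * F.zPlus) (rho_one_mul_ord_one F.zPlus_ord)
    (rho_one_mul_mem F.zPlus_mem) ?_
  have h1 : c.l * (1 + rho 1 * F.zPlus) = F.yPlus + rho 1 * dRho F.yPlus
      - c.kappa * (rho 1 * F.yPlus) := by rw [← h.l_eq]; ring
  rw [h1]
  exact sub_mem (add_rho_mul_dRho_mem F.yPlus_mem)
    (mul_mem h.kappa_mem (rho_one_mul_mem F.yPlus_mem))

/-- The right hand side of `IsConnection.b_eq`. -/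
def srcB (F : FrameData) : RhoSeries := dPlus F.yPlus - dMinus F.zPlus +
      rho 1 * (F.e0Pert F.yPlus) - rho 1 * (F.e1Pert F.zPlus)

/-- The right hand side of `IsConnection.a_eq`. -/
def srcA (F : FrameData) : RhoSeries := dMinus F.zMinus - dPlus F.yMinus +
      rho 1 * (F.e1Pert F.zMinus) - rho 1 * (F.e0Pert F.yMinus)

theorem srcB_ord : srcB F ∈ ordGE 2 :=
  sub_mem (add_mem (sub_mem (dPlus_mem_ordGE F.yPlus_ord) (dMinus_mem_ordGE F.zPlus_ord))
    (rho_one_mul_ord (ordGE_mono (by norm_num) (e0Pert_ord F.yPlus_ord))))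
    (rho_one_mul_ord (ordGE_mono (by norm_num) (e1Pert_ord F.zPlus_ord)))

theorem srcA_ord : srcA F ∈ ordGE 2 :=
  sub_mem (add_mem (sub_mem (dMinus_mem_ordGE F.zMinus_ord) (dPlus_mem_ordGE F.yMinus_ord))
    (rho_one_mul_ord (ordGE_mono (by norm_num) (e1Pert_ord F.zMinus_ord))))
    (rho_one_mul_ord (ordGE_mono (by norm_num) (e0Pert_ord F.yMinus_ord)))

theorem srcB_mem : srcB F ∈ polySeries :=
  sub_mem (add_mem (sub_mem (dPlus_mem_polySeries F.yPlus_mem) (dMinus_mem_polySeries F.zPlus_mem))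
    (rho_one_mul_mem (e0Pert_mem F.yPlus_mem))) (rho_one_mul_mem (e1Pert_mem F.zPlus_mem))

theorem srcA_mem : srcA F ∈ polySeries :=
  sub_mem (add_mem (sub_mem (dMinus_mem_polySeries F.zMinus_mem)
    (dPlus_mem_polySeries F.yMinus_mem))
    (rho_one_mul_mem (e1Pert_mem F.zMinus_mem))) (rho_one_mul_mem (e0Pert_mem F.yMinus_mem))

theorem pair_b (h : IsConnection F c) : 2 * c.b * (1 + rho 1 * F.zPlus) +
    2 * c.a * (-(rho 1 * F.yPlus)) = srcB F := by
  rw [srcB, ← h.b_eq]; ring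

theorem pair_a (h : IsConnection F c) : 2 * c.b * (-(rho 1 * F.zMinus)) +
    2 * c.a * (1 + rho 1 * F.yMinus) = srcA F := by
  rw [srcA, ← h.a_eq]; ring

theorem b_ord (h : IsConnection F c) : c.b ∈ ordGE 2 :=
  ord_of_two_mul_ord (solve_pair_ord h.pair_b h.pair_a (rho_one_mul_ord_one F.zPlus_ord)
    (neg_mem (rho_one_mul_ord_one F.yPlus_ord)) (neg_mem (rho_one_mul_ord_one F.zMinus_ord))
    (rho_one_mul_ord_one F.yMinus_ord) srcB_ord srcA_ord)

theorem b_mem (h : IsConnection F c) : c.b ∈ polySeries :=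
  mem_of_two_mul_mem (solve_pair_mem h.pair_b h.pair_a (rho_one_mul_ord_one F.zPlus_ord)
    (neg_mem (rho_one_mul_ord_one F.yPlus_ord)) (neg_mem (rho_one_mul_ord_one F.zMinus_ord))
    (rho_one_mul_ord_one F.yMinus_ord) (rho_one_mul_mem F.zPlus_mem)
    (neg_mem (rho_one_mul_mem F.yPlus_mem)) (neg_mem (rho_one_mul_mem F.zMinus_mem))
    (rho_one_mul_mem F.yMinus_mem) srcB_mem srcA_mem)

theorem a_ord (h : IsConnection F c) : c.a ∈ ordGE 2 :=
  ord_of_two_mul_ord (solve_pair_ord (y := 2 * c.b) ((add_comm _ _).trans h.pair_a)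
    ((add_comm _ _).trans h.pair_b) (rho_one_mul_ord_one F.yMinus_ord)
    (neg_mem (rho_one_mul_ord_one F.zMinus_ord)) (neg_mem (rho_one_mul_ord_one F.yPlus_ord))
    (rho_one_mul_ord_one F.zPlus_ord) srcA_ord srcB_ord)

theorem a_mem (h : IsConnection F c) : c.a ∈ polySeries :=
  mem_of_two_mul_mem (solve_pair_mem (y := 2 * c.b) ((add_comm _ _).trans h.pair_a)
    ((add_comm _ _).trans h.pair_b) (rho_one_mul_ord_one F.yMinus_ord)
    (neg_mem (rho_one_mul_ord_one F.zMinus_ord)) (neg_mem (rho_one_mul_ord_one F.yPlus_ord))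
    (rho_one_mul_ord_one F.zPlus_ord) (rho_one_mul_mem F.yMinus_mem)
    (neg_mem (rho_one_mul_mem F.zMinus_mem)) (neg_mem (rho_one_mul_mem F.yPlus_mem))
    (rho_one_mul_mem F.zPlus_mem) srcA_mem srcB_mem)

/-! Up to the order `ρ⁴`, and up to the order `ρ⁵` if `Y⁺` and `Z⁻` vanish at the order `ρ²`, the
connection coefficients other than `κ` depend linearly on the frame coefficients. -/

/-- The orders at which the connection depends linearly on the off-diagonal part of the frame. -/
def LinearOrder (F : FrameData) (n : ℤ) : Prop :=
  n ≤ 5 ∧ (n = 5 → F.yPlus.coeff 2 = 0 ∧ F.zMinus.coeff 2 = 0)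

theorem coeff_two_kappa (h : IsConnection F c) : c.kappa.coeff 2 = 3 * F.zPlus.coeff 2 := by
  have h1 := congrArg (fun f => f.coeff 2) h.kappa_eq
  simp only [coeff_rho_mul_dRho, HahnSeries.coeff_add] at h1
  rw [coeff_rho_mul_mul h.kappa_ord F.zPlus_ord (by norm_num),
    coeff_rho_mul_mul h.m_ord F.yPlus_ord (by norm_num)] at h1
  norm_num at h1
  linear_combination h1

theorem coeff_kappa (h : IsConnection F c) {n : ℤ} (hn : LinearOrder F n) :
    c.kappa.coeff n = ((n : SU2 → ℂ) + 1) * F.zPlus.coeff n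
      - if n = 5 then 3 * F.zPlus.coeff 2 ^ 2 else 0 := by
  have h1 := congrArg (fun f => f.coeff n) h.kappa_eq
  simp only [coeff_rho_mul_dRho, HahnSeries.coeff_add] at h1
  rw [coeff_rho_mul_mul h.kappa_ord F.zPlus_ord hn.1,
    coeff_rho_mul_mul h.m_ord F.yPlus_ord hn.1, h.coeff_two_kappa] at h1
  split_ifs at h1 ⊢ with h5
  · rw [(hn.2 h5).1] at h1
    linear_combination h1
  · linear_combination h1

theorem coeff_yMinus (h : IsConnection F c) {n : ℤ} (hn : LinearOrder F n) :
    F.yMinus.coeff n = F.zPlus.coeff n := by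
  by_cases hn0 : n < 0
  · rw [F.yMinus_ord n (by omega), F.zPlus_ord n (by omega)]
  have key {n : ℤ} (hn : LinearOrder F n) (hn0 : ¬ n < 0)
      (h2 : n = 5 → F.yMinus.coeff 2 = F.zPlus.coeff 2) : F.yMinus.coeff n = F.zPlus.coeff n := by
    have h1 := congrArg (fun f => f.coeff n) h.kappa_eq'
    simp only [coeff_rho_mul_dRho, HahnSeries.coeff_add] at h1
    rw [coeff_rho_mul_mul h.kappa_ord F.yMinus_ord hn.1,
      coeff_rho_mul_mul h.l_ord F.zMinus_ord hn.1, h.coeff_two_kappa, h.coeff_kappa hn] at h1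
    have h3 : ((n : SU2 → ℂ) + 1) * (F.yMinus.coeff n - F.zPlus.coeff n) = 0 := by
      split_ifs at h1 with h5
      · rw [(hn.2 h5).2, h2 h5] at h1
        linear_combination -h1
      · linear_combination -h1
    funext t
    have h4 := congrFun h3 t
    have h5 : (n : ℂ) + 1 ≠ 0 := by exact_mod_cast (show n + 1 ≠ 0 by omega)
    exact sub_eq_zero.1 ((mul_eq_zero.1 h4).resolve_left h5)
  exact key hn hn0 fun _ => key ⟨by norm_num, by norm_num⟩ (by norm_num) (by norm_num)

theorem coeff_m (h : IsConnection F c) {n : ℤ} (hn : LinearOrder F n) :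
    c.m.coeff n = ((n : SU2 → ℂ) + 1) * F.zMinus.coeff n := by
  have key {n : ℤ} (hn : LinearOrder F n) (h2 : n = 5 → c.m.coeff 2 = 0) :
      c.m.coeff n = ((n : SU2 → ℂ) + 1) * F.zMinus.coeff n := by
    have h1 := congrArg (fun f => f.coeff n) h.m_eq
    simp only [coeff_rho_mul_dRho, HahnSeries.coeff_add] at h1
    rw [coeff_rho_mul_mul h.kappa_ord F.zMinus_ord hn.1,
      coeff_rho_mul_mul h.m_ord F.yMinus_ord hn.1] at h1
    split_ifs at h1 with h5
    · rw [(hn.2 h5).2, h2 h5] at h1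
      linear_combination h1
    · linear_combination h1
  refine key hn fun h5 => ?_
  rw [key ⟨by norm_num, by norm_num⟩ (by norm_num), (hn.2 h5).2, mul_zero]

theorem coeff_l (h : IsConnection F c) {n : ℤ} (hn : LinearOrder F n) :
    c.l.coeff n = ((n : SU2 → ℂ) + 1) * F.yPlus.coeff n := by
  have key {n : ℤ} (hn : LinearOrder F n) (h2 : n = 5 → c.l.coeff 2 = 0) :
      c.l.coeff n = ((n : SU2 → ℂ) + 1) * F.yPlus.coeff n := by
    have h1 := congrArg (fun f => f.coeff n) h.l_eq
    simp only [coeff_rho_mul_dRho, HahnSeries.coeff_add] at h1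
    rw [coeff_rho_mul_mul h.kappa_ord F.yPlus_ord hn.1,
      coeff_rho_mul_mul h.l_ord F.zPlus_ord hn.1] at h1
    split_ifs at h1 with h5
    · rw [(hn.2 h5).1, h2 h5] at h1
      linear_combination h1
    · linear_combination h1
  refine key hn fun h5 => ?_
  rw [key ⟨by norm_num, by norm_num⟩ (by norm_num), (hn.2 h5).1, mul_zero]

theorem coeff_rho_mul_e0Pert {f : RhoSeries} (hf : f ∈ ordGE 2) {n : ℤ} (hn : n ≤ 5) :
    (rho 1 * F.e0Pert f).coeff n = if n = 5 then F.zPlus.coeff 2 * fieldPlus (f.coeff 2) +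
      F.zMinus.coeff 2 * fieldMinus (f.coeff 2) else 0 := by
  rw [coeff_rho_mul]
  split_ifs with h
  · exact coeff_e0Pert hf _ (by omega)
  · exact e0Pert_ord hf _ (by omega)

theorem coeff_rho_mul_e1Pert {f : RhoSeries} (hf : f ∈ ordGE 2) {n : ℤ} (hn : n ≤ 5) :
    (rho 1 * F.e1Pert f).coeff n = if n = 5 then F.yPlus.coeff 2 * fieldPlus (f.coeff 2) +
      F.yMinus.coeff 2 * fieldMinus (f.coeff 2) else 0 := by
  rw [coeff_rho_mul]
  split_ifs with h
  · exact coeff_e1Pert hf _ (by omega)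
  · exact e1Pert_ord hf _ (by omega)

theorem coeff_b (h : IsConnection F c) {n : ℤ} (hn : LinearOrder F n) :
    2 * c.b.coeff n = fieldPlus (F.yPlus.coeff n) - fieldMinus (F.zPlus.coeff n) := by
  have key {n : ℤ} (hn : LinearOrder F n)
      (h2 : n = 5 → 2 * c.b.coeff 2 = - fieldMinus (F.zPlus.coeff 2)) :
      2 * c.b.coeff n = fieldPlus (F.yPlus.coeff n) - fieldMinus (F.zPlus.coeff n) := by
    have h1 := congrArg (fun f => f.coeff n) h.b_eq
    simp only [HahnSeries.coeff_add, HahnSeries.coeff_sub, coeff_two_mul, coeff_dPlus,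
      coeff_dMinus] at h1
    rw [coeff_rho_mul_mul h.b_ord F.zPlus_ord hn.1, coeff_rho_mul_mul h.a_ord F.yPlus_ord hn.1,
      coeff_rho_mul_e0Pert F.yPlus_ord hn.1, coeff_rho_mul_e1Pert F.zPlus_ord hn.1] at h1
    split_ifs at h1 with h5
    · have h3 := h2 h5
      rw [(hn.2 h5).1, (hn.2 h5).2, map_zero, h.coeff_yMinus ⟨by norm_num, by norm_num⟩] at h1
      linear_combination h1 - F.zPlus.coeff 2 * h3
    · linear_combination h1
  refine key hn fun h5 => ?_
  rw [key ⟨by norm_num, by norm_num⟩ (by norm_num), (hn.2 h5).1, map_zero, zero_sub]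

theorem coeff_a (h : IsConnection F c) {n : ℤ} (hn : LinearOrder F n) :
    2 * c.a.coeff n = fieldMinus (F.zMinus.coeff n) - fieldPlus (F.zPlus.coeff n) := by
  have key {n : ℤ} (hn : LinearOrder F n)
      (h2 : n = 5 → 2 * c.a.coeff 2 = - fieldPlus (F.zPlus.coeff 2)) :
      2 * c.a.coeff n = fieldMinus (F.zMinus.coeff n) - fieldPlus (F.zPlus.coeff n) := by
    have h1 := congrArg (fun f => f.coeff n) h.a_eq
    simp only [HahnSeries.coeff_add, HahnSeries.coeff_sub, coeff_two_mul, coeff_dPlus,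
      coeff_dMinus] at h1
    rw [coeff_rho_mul_mul h.a_ord F.yMinus_ord hn.1, coeff_rho_mul_mul h.b_ord F.zMinus_ord hn.1,
      coeff_rho_mul_e0Pert F.yMinus_ord hn.1, coeff_rho_mul_e1Pert F.zMinus_ord hn.1,
      h.coeff_yMinus hn] at h1
    split_ifs at h1 with h5
    · have h3 := h2 h5
      rw [(hn.2 h5).1, (hn.2 h5).2, map_zero, map_zero, h.coeff_yMinus ⟨by norm_num, by norm_num⟩] at h1
      linear_combination h1 - F.zPlus.coeff 2 * h3
    · linear_combination h1
  refine key hn fun h5 => ?_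
  rw [key ⟨by norm_num, by norm_num⟩ (by norm_num), (hn.2 h5).2, map_zero, zero_sub]

end IsConnection

end

section

open Complex FrameData

/-! ### Flat part and perturbation of the operators -/

variable {F : FrameData} {c : ConnCoeffs}

theorem FrameData.e0_sub {f g : RhoSeries} (hf : f ∈ polySeries) (hg : g ∈ polySeries) :
    F.e0 (f - g) = F.e0 f - F.e0 g := by
  rw [sub_eq_add_neg, e0_add hf (neg_mem hg), e0_neg, sub_eq_add_neg]

theorem FrameData.e1_sub {f g : RhoSeries} (hf : f ∈ polySeries) (hg : g ∈ polySeries) :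
    F.e1 (f - g) = F.e1 f - F.e1 g := by
  rw [sub_eq_add_neg, e1_add hf (neg_mem hg), e1_neg, sub_eq_add_neg]

theorem FrameData.e0_cst_mul (z : ℂ) (f : RhoSeries) : F.e0 (cst z * f) = cst z * F.e0 f := by
  rw [e0, e0, dPlus_cst_mul, dMinus_cst_mul]; ring

theorem FrameData.e1_cst_mul (z : ℂ) (f : RhoSeries) : F.e1 (cst z * f) = cst z * F.e1 f := by
  rw [e1, e1, dPlus_cst_mul, dMinus_cst_mul]; ring

theorem dRho_sub (f g : RhoSeries) : dRho (f - g) = dRho f - dRho g := map_sub _ f g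

namespace ConnCoeffs

theorem killing_sub {U X W U' X' W' : RhoSeries} (hU : U ∈ polySeries) (hX : X ∈ polySeries)
    (hW : W ∈ polySeries) (hU' : U' ∈ polySeries) (hX' : X' ∈ polySeries) (hW' : W' ∈ polySeries)
    (i : ℕ) : killing F c (U - U') (X - X') (W - W') i =
      killing F c U X W i - killing F c U' X' W' i := by
  match i with
  | 0 | 1 | 2 | 3 | _ + 4 =>
    simp only [killing, divForm, e0_sub hU hU', e0_sub hX hX', e0_sub hW hW', e1_sub hU hU',
      e1_sub hX hX', e1_sub hW hW', dRho_sub]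
    ring

theorem divSym_sub {S S' : ℕ → RhoSeries} (hS : ∀ i, S i ∈ polySeries)
    (hS' : ∀ i, S' i ∈ polySeries) (i : ℕ) :
    divSym F c (fun j => S j - S' j) i = divSym F c S i - divSym F c S' i := by
  match i with
  | 0 | 1 | _ + 2 =>
    simp only [divSym, e0_sub (hS _) (hS' _), e1_sub (hS _) (hS' _), dRho_sub]
    ring

theorem divSym_add {S S' : ℕ → RhoSeries} (hS : ∀ i, S i ∈ polySeries)
    (hS' : ∀ i, S' i ∈ polySeries) (i : ℕ) :
    divSym F c (fun j => S j + S' j) i = divSym F c S i + divSym F c S' i := by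
  match i with
  | 0 | 1 | _ + 2 =>
    simp only [divSym, e0_add (hS _) (hS' _), e1_add (hS _) (hS' _), dRho_add]
    ring

theorem divSym_cst_mul (z : ℂ) (S : ℕ → RhoSeries) (i : ℕ) :
    divSym F c (fun j => cst z * S j) i = cst z * divSym F c S i := by
  match i with
  | 0 | 1 | _ + 2 =>
    simp only [divSym, e0_cst_mul, e1_cst_mul, dRho_cst_mul]
    ring

/-- The divergence of a 1-form for the flat metric. -/
def divFormFlat (U X W : RhoSeries) : RhoSeries :=
  rho (-1) * (dPlus W - dMinus U - 4 * X) - 2 * dRho X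

/-- The conformal Killing operator of the flat metric. -/
def killingFlat (U X W : RhoSeries) : ℕ → RhoSeries
  | 0 => 2 * (rho (-1) * dPlus U)
  | 1 => rho (-1) * (dPlus X - U) + dRho U
  | 2 => 2 * dRho X + cst (1 / 3) * divFormFlat U X W
  | 3 => -(rho (-1) * (dMinus X + W)) + dRho W
  | _ => -(2 * (rho (-1) * dMinus W))

/-- The difference between the divergence of a 1-form and its flat counterpart. -/
def divFormPert (F : FrameData) (c : ConnCoeffs) (U X W : RhoSeries) : RhoSeries :=
  F.e0Pert W - F.e1Pert U + 4 * (c.kappa * X) + 2 * (c.a * W) - 2 * (c.b * U)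

/-- The difference between the conformal Killing operator and its flat counterpart. -/
def killingPert (F : FrameData) (c : ConnCoeffs) (U X W : RhoSeries) : ℕ → RhoSeries
  | 0 => 2 * F.e0Pert U - 4 * (c.a * U) - 4 * (c.m * X)
  | 1 => F.e0Pert X - c.m * W + c.kappa * U
  | 2 => cst (1 / 3) * divFormPert F c U X W
  | 3 => -F.e1Pert X + c.kappa * W - c.l * U
  | _ => -(2 * F.e1Pert W) - 4 * (c.l * X) + 4 * (c.b * W)

theorem killing_eq (U X W : RhoSeries) (i : ℕ) :
    killing F c U X W i = killingFlat U X W i + killingPert F c U X W i := by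
  match i with
  | 0 | 1 | 2 | 3 | _ + 4 =>
    simp only [killing, killingFlat, killingPert, divForm, divFormFlat, divFormPert, e0_eq, e1_eq, k]
    ring

/-- The divergence of a symmetric spinor for the flat metric. -/
def divSymFlat (S : ℕ → RhoSeries) : ℕ → RhoSeries
  | 0 => -(2 * dRho (S 1)) - 6 * (rho (-1) * S 1) + rho (-1) * (dPlus (S 2) - dMinus (S 0))
  | 1 => -(2 * dRho (S 2)) - 6 * (rho (-1) * S 2) + rho (-1) * (dPlus (S 3) - dMinus (S 1))
  | _ => -(2 * dRho (S 3)) - 6 * (rho (-1) * S 3) + rho (-1) * (dPlus (S 4) - dMinus (S 2))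

/-- The difference between the divergence of a symmetric spinor and its flat counterpart. -/
def divSymPert (F : FrameData) (c : ConnCoeffs) (S : ℕ → RhoSeries) : ℕ → RhoSeries
  | 0 => 6 * (c.kappa * S 1) + F.e0Pert (S 2) - 2 * (c.m * S 3) - F.e1Pert (S 0) - 4 * (c.b * S 0)
  | 1 => 6 * (c.kappa * S 2) + F.e0Pert (S 3) + 2 * (c.a * S 3) - c.m * S 4 - F.e1Pert (S 1)
      - 2 * (c.b * S 1) - c.l * S 0
  | _ => 6 * (c.kappa * S 3) + F.e0Pert (S 4) + 4 * (c.a * S 4) - F.e1Pert (S 2) - 2 * (c.l * S 1)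

theorem divSym_eq (S : ℕ → RhoSeries) (i : ℕ) :
    divSym F c S i = divSymFlat S i + divSymPert F c S i := by
  match i with
  | 0 | 1 | _ + 2 =>
    simp only [divSym, divSymFlat, divSymPert, e0_eq, e1_eq, k]
    ring

end ConnCoeffs

open ConnCoeffs

theorem two_mul_ord {f : RhoSeries} {n : ℤ} (hf : f ∈ ordGE n) : 2 * f ∈ ordGE n := by
  rw [two_mul]; exact add_mem hf hf

theorem four_mul_ord {f : RhoSeries} {n : ℤ} (hf : f ∈ ordGE n) : 4 * f ∈ ordGE n := by
  rw [← cst_ofNat]; exact cst_mul_mem_ordGE _ hf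

theorem six_mul_ord {f : RhoSeries} {n : ℤ} (hf : f ∈ ordGE n) : 6 * f ∈ ordGE n := by
  rw [← cst_ofNat]; exact cst_mul_mem_ordGE _ hf

theorem rho_neg_one_mul_ord {f : RhoSeries} {n : ℤ} (hf : f ∈ ordGE n) :
    rho (-1) * f ∈ ordGE (n - 1) := by
  simpa [sub_eq_neg_add] using mul_mem_ordGE (rho_mem_ordGE (-1)) hf

theorem killingFlat_ord {U X W : RhoSeries} (hU : U ∈ ordGE 1) (hX : X ∈ ordGE 1)
    (hW : W ∈ ordGE 1) (i : ℕ) : killingFlat U X W i ∈ ordGE 0 := by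
  have r {f : RhoSeries} (hf : f ∈ ordGE 1) : rho (-1) * f ∈ ordGE 0 := rho_neg_one_mul_ord hf
  have d {f : RhoSeries} (hf : f ∈ ordGE 1) : dRho f ∈ ordGE 0 := dRho_mem_ordGE hf
  match i with
  | 0 => exact two_mul_ord (r (dPlus_mem_ordGE hU))
  | 1 => exact add_mem (r (sub_mem (dPlus_mem_ordGE hX) hU)) (d hU)
  | 2 =>
    exact add_mem (two_mul_ord (d hX)) (cst_mul_mem_ordGE _ (sub_mem (r (sub_mem (sub_mem
      (dPlus_mem_ordGE hW) (dMinus_mem_ordGE hU)) (four_mul_ord hX))) (two_mul_ord (d hX))))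
  | 3 => exact add_mem (neg_mem (r (add_mem (dMinus_mem_ordGE hX) hW))) (d hW)
  | _ + 4 =>
    exact neg_mem (two_mul_ord (r (dMinus_mem_ordGE hW)))

theorem killingPert_ord (h : IsConnection F c) {U X W : RhoSeries} {n : ℤ} (hU : U ∈ ordGE n)
    (hX : X ∈ ordGE n) (hW : W ∈ ordGE n) (i : ℕ) : killingPert F c U X W i ∈ ordGE (2 + n) := by
  match i with
  | 0 =>
    exact sub_mem (sub_mem (two_mul_ord (e0Pert_ord hU))
      (four_mul_ord (mul_mem_ordGE h.a_ord hU))) (four_mul_ord (mul_mem_ordGE h.m_ord hX))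
  | 1 =>
    exact add_mem (sub_mem (e0Pert_ord hX) (mul_mem_ordGE h.m_ord hW)) (mul_mem_ordGE h.kappa_ord hU)
  | 2 =>
    exact cst_mul_mem_ordGE _ (sub_mem (add_mem (add_mem (sub_mem (e0Pert_ord hW) (e1Pert_ord hU))
      (four_mul_ord (mul_mem_ordGE h.kappa_ord hX))) (two_mul_ord (mul_mem_ordGE h.a_ord hW)))
      (two_mul_ord (mul_mem_ordGE h.b_ord hU)))
  | 3 =>
    exact sub_mem (add_mem (neg_mem (e1Pert_ord hX)) (mul_mem_ordGE h.kappa_ord hW))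
      (mul_mem_ordGE h.l_ord hU)
  | _ + 4 =>
    exact add_mem (sub_mem (neg_mem (two_mul_ord (e1Pert_ord hW)))
      (four_mul_ord (mul_mem_ordGE h.l_ord hX))) (four_mul_ord (mul_mem_ordGE h.b_ord hW))

theorem divSymPert_ord (h : IsConnection F c) {S : ℕ → RhoSeries} {n : ℤ}
    (hS : ∀ i, S i ∈ ordGE n) (i : ℕ) : divSymPert F c S i ∈ ordGE (2 + n) := by
  match i with
  | 0 =>
    exact sub_mem (sub_mem (sub_mem (add_mem (six_mul_ord (mul_mem_ordGE h.kappa_ord (hS _)))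
      (e0Pert_ord (hS _))) (two_mul_ord (mul_mem_ordGE h.m_ord (hS _)))) (e1Pert_ord (hS _)))
      (four_mul_ord (mul_mem_ordGE h.b_ord (hS _)))
  | 1 =>
    exact sub_mem (sub_mem (sub_mem (sub_mem (add_mem (add_mem
      (six_mul_ord (mul_mem_ordGE h.kappa_ord (hS _))) (e0Pert_ord (hS _)))
      (two_mul_ord (mul_mem_ordGE h.a_ord (hS _)))) (mul_mem_ordGE h.m_ord (hS _)))
      (e1Pert_ord (hS _))) (two_mul_ord (mul_mem_ordGE h.b_ord (hS _))))
      (mul_mem_ordGE h.l_ord (hS _))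
  | _ + 2 =>
    exact sub_mem (sub_mem (add_mem (add_mem (six_mul_ord (mul_mem_ordGE h.kappa_ord (hS _)))
      (e0Pert_ord (hS _))) (four_mul_ord (mul_mem_ordGE h.a_ord (hS _)))) (e1Pert_ord (hS _)))
      (two_mul_ord (mul_mem_ordGE h.l_ord (hS _)))

theorem ofNat_mem_polySeries (n : ℕ) [n.AtLeastTwo] : (OfNat.ofNat n : RhoSeries) ∈ polySeries := by
  rw [← cst_ofNat]; exact cst_mem_polySeries _

theorem killingFlat_mem {U X W : RhoSeries} (hU : U ∈ polySeries) (hX : X ∈ polySeries)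
    (hW : W ∈ polySeries) (i : ℕ) : killingFlat U X W i ∈ polySeries := by
  have r {f : RhoSeries} (hf : f ∈ polySeries) : rho (-1) * f ∈ polySeries :=
    mul_mem (rho_mem_polySeries _) hf
  have n2 {f : RhoSeries} (hf : f ∈ polySeries) : 2 * f ∈ polySeries :=
    mul_mem (ofNat_mem_polySeries 2) hf
  match i with
  | 0 => exact n2 (r (dPlus_mem_polySeries hU))
  | 1 => exact add_mem (r (sub_mem (dPlus_mem_polySeries hX) hU)) (dRho_mem_polySeries hU)
  | 2 =>
    exact add_mem (n2 (dRho_mem_polySeries hX)) (mul_mem (cst_mem_polySeries _) (sub_mem (r (sub_mem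
      (sub_mem (dPlus_mem_polySeries hW) (dMinus_mem_polySeries hU))
      (mul_mem (ofNat_mem_polySeries 4) hX))) (n2 (dRho_mem_polySeries hX))))
  | 3 =>
    exact add_mem (neg_mem (r (add_mem (dMinus_mem_polySeries hX) hW))) (dRho_mem_polySeries hW)
  | _ + 4 =>
    exact neg_mem (n2 (r (dMinus_mem_polySeries hW)))

theorem killingPert_mem (h : IsConnection F c) {U X W : RhoSeries} (hU : U ∈ polySeries)
    (hX : X ∈ polySeries) (hW : W ∈ polySeries) (i : ℕ) :
    killingPert F c U X W i ∈ polySeries := by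
  have n2 {f : RhoSeries} (hf : f ∈ polySeries) : 2 * f ∈ polySeries :=
    mul_mem (ofNat_mem_polySeries 2) hf
  have n4 {f : RhoSeries} (hf : f ∈ polySeries) : 4 * f ∈ polySeries :=
    mul_mem (ofNat_mem_polySeries 4) hf
  match i with
  | 0 =>
    exact sub_mem (sub_mem (n2 (e0Pert_mem hU)) (n4 (mul_mem h.a_mem hU))) (n4 (mul_mem h.m_mem hX))
  | 1 => exact add_mem (sub_mem (e0Pert_mem hX) (mul_mem h.m_mem hW)) (mul_mem h.kappa_mem hU)
  | 2 =>
    exact mul_mem (cst_mem_polySeries _) (sub_mem (add_mem (add_mem (sub_mem (e0Pert_mem hW)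
      (e1Pert_mem hU)) (n4 (mul_mem h.kappa_mem hX))) (n2 (mul_mem h.a_mem hW)))
      (n2 (mul_mem h.b_mem hU)))
  | 3 => exact sub_mem (add_mem (neg_mem (e1Pert_mem hX)) (mul_mem h.kappa_mem hW)) (mul_mem h.l_mem hU)
  | _ + 4 =>
    exact add_mem (sub_mem (neg_mem (n2 (e1Pert_mem hW))) (n4 (mul_mem h.l_mem hX)))
      (n4 (mul_mem h.b_mem hW))

theorem killing_mem (h : IsConnection F c) {U X W : RhoSeries} (hU : U ∈ polySeries)
    (hX : X ∈ polySeries) (hW : W ∈ polySeries) (i : ℕ) : killing F c U X W i ∈ polySeries := by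
  rw [killing_eq]
  exact add_mem (killingFlat_mem hU hX hW i) (killingPert_mem h hU hX hW i)

end

section

open Complex FrameData Polynomial ConnCoeffs

/-! ### The operators on polynomial coefficients -/

/-- The coefficients of order `ρⁿ` of the components of a 1-form have the spin weights `-1`, `0`,
`1`, with the polynomials `r`, `x`, `s` in `u`. -/
structure FormCoeff (U V W : RhoSeries) (n : ℤ) (r x s : ℂ[X]) : Prop where
  zero : U.coeff n = MF * pu r
  one : V.coeff n = pu x
  two : W.coeff n = PF * pu s

/-- The coefficients of order `ρⁿ` of the components of a symmetric spinor with four indices have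
the spin weights `-2`, …, `2`, with the polynomials `s 0`, …, `s 4` in `u`. -/
structure SymCoeff (S : ℕ → RhoSeries) (n : ℤ) (s : ℕ → ℂ[X]) : Prop where
  zero : (S 0).coeff n = MF ^ 2 * pu (s 0)
  one : (S 1).coeff n = MF * pu (s 1)
  two : (S 2).coeff n = pu (s 2)
  three : (S 3).coeff n = PF * pu (s 3)
  four : (S 4).coeff n = PF ^ 2 * pu (s 4)

/-- The coefficients of order `ρⁿ` of the components of the frame, in terms of polynomials
in `u`. -/
structure FrameCoeff (F : FrameData) (n : ℤ) (z y w : ℂ[X]) : Prop where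
  zPlus : F.zPlus.coeff n = pu z
  yPlus : F.yPlus.coeff n = PF ^ 2 * pu y
  zMinus : F.zMinus.coeff n = MF ^ 2 * pu w

/-- The polynomials of `killingFlat` on a 1-form of order `ρⁿ`. -/
def killingFlatPoly (n : ℤ) (r x s : ℂ[X]) : ℕ → ℂ[X]
  | 0 => 4 * derivative r
  | 1 => 2 * derivative x + ((n : ℂ[X]) - 1) * r
  | 2 => 2 * (n : ℂ[X]) * x + C (1 / 3) * (lower s + lower r - (4 + 2 * (n : ℂ[X])) * x)
  | 3 => 2 * derivative x + ((n : ℂ[X]) - 1) * s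
  | _ => 4 * derivative s

/-- The polynomials of the term of lowest order of `killingPert`, for a frame whose coefficient of
order `ρ²` is `Z⁺ = z(u)`, `Y⁺ = Z⁻ = 0`. -/
def killingPertPoly (z r x s : ℂ[X]) : ℕ → ℂ[X]
  | 0 => 4 * z * derivative r + 4 * derivative z * r
  | 1 => 2 * z * derivative x + 3 * z * r
  | 2 => C (1 / 3) * (z * lower s + z * lower r + 12 * z * x
      - C (1 / 2) * (X ^ 2 - 1) * derivative z * (r + s))
  | 3 => 2 * z * derivative x + 3 * z * s
  | _ => 4 * z * derivative s + 4 * derivative z * s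

/-- The polynomials of `divSymFlat` on a spinor of order `ρⁿ`. -/
def divFlatPoly (n : ℤ) (s : ℕ → ℂ[X]) : ℕ → ℂ[X]
  | 0 => 2 * derivative (s 2) + 2 * lower₂ (s 0) - (2 * (n : ℂ[X]) + 6) * s 1
  | 1 => lower (s 3) + lower (s 1) - (2 * (n : ℂ[X]) + 6) * s 2
  | _ => 2 * derivative (s 2) + 2 * lower₂ (s 4) - (2 * (n : ℂ[X]) + 6) * s 3

/-- The polynomials of the term of lowest order of `divSymPert`, for a frame whose coefficient of
order `ρ²` is `Z⁺ = z(u)`, `Y⁺ = Z⁻ = 0`. -/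
def divPertPoly (z : ℂ[X]) (s : ℕ → ℂ[X]) : ℕ → ℂ[X]
  | 0 => 18 * z * s 1 + 2 * z * derivative (s 2) + 2 * z * lower₂ (s 0)
      - (X ^ 2 - 1) * derivative z * s 0
  | 1 => 18 * z * s 2 + z * lower (s 3) + z * lower (s 1)
      - C (1 / 2) * (X ^ 2 - 1) * derivative z * (s 1 + s 3)
  | _ => 18 * z * s 3 + 2 * z * derivative (s 2) + 2 * z * lower₂ (s 4)
      - (X ^ 2 - 1) * derivative z * s 4

section fields

variable (p : ℂ[X])

theorem fieldPlus_pu : fieldPlus (pu p) = 2 * MF * pu (derivative p) :=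
  (hasFields_pu p).fieldPlus_eq

theorem fieldMinus_pu : fieldMinus (pu p) = -2 * PF * pu (derivative p) :=
  (hasFields_pu p).fieldMinus_eq

theorem fieldPlus_MF_mul : fieldPlus (MF * pu p) = 2 * MF ^ 2 * pu (derivative p) :=
  (hasFields_MF_mul p).fieldPlus_eq

theorem fieldMinus_MF_mul : fieldMinus (MF * pu p) = -pu (lower p) :=
  (hasFields_MF_mul p).fieldMinus_eq

theorem fieldPlus_PF_mul : fieldPlus (PF * pu p) = pu (lower p) :=
  (hasFields_PF_mul p).fieldPlus_eq

theorem fieldMinus_PF_mul : fieldMinus (PF * pu p) = -2 * PF ^ 2 * pu (derivative p) :=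
  (hasFields_PF_mul p).fieldMinus_eq

theorem fieldMinus_MF_sq_mul : fieldMinus (MF ^ 2 * pu p) = -2 * MF * pu (lower₂ p) :=
  (hasFields_MF_sq_mul p).fieldMinus_eq

theorem fieldPlus_PF_sq_mul : fieldPlus (PF ^ 2 * pu p) = 2 * PF * pu (lower₂ p) :=
  (hasFields_PF_sq_mul p).fieldPlus_eq

theorem PF_mul_MF_mul_four : pu (X ^ 2 - 1) = 4 * (PF * MF) := by
  rw [PF_mul_MF, map_sub, map_pow, pu_X, map_one]

end fields

theorem coeff_rho_neg_one_mul (f : RhoSeries) (n m : ℤ) (h : n + 1 = m) :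
    (rho (-1) * f).coeff n = f.coeff m := by
  rw [coeff_rho_mul, sub_neg_eq_add, h]

theorem coeff_dRho' (f : RhoSeries) (n m : ℤ) (h : n + 1 = m) :
    (dRho f).coeff n = (m : SU2 → ℂ) * f.coeff m := by
  rw [coeff_dRho, h]

theorem FormCoeff.killingFlat {U V W : RhoSeries} {n : ℤ} {r x s : ℂ[X]}
    (h : FormCoeff U V W n r x s) :
    SymCoeff (killingFlat U V W) (n - 1) (killingFlatPoly n r x s) := by
  have hr (f : RhoSeries) := coeff_rho_neg_one_mul f (n - 1) n (by ring)
  have hd (f : RhoSeries) := coeff_dRho' f (n - 1) n (by ring)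
  constructor <;>
  · simp only [MomentumExpansion.ConnCoeffs.killingFlat, killingFlatPoly, divFormFlat,
      coeff_two_mul, coeff_four_mul, coeff_cst_mul, HahnSeries.coeff_add, HahnSeries.coeff_sub,
      HahnSeries.coeff_neg, hr, hd, coeff_dPlus, coeff_dMinus, h.zero, h.one, h.two, fieldPlus_pu,
      fieldMinus_pu, fieldPlus_MF_mul, fieldMinus_MF_mul, fieldPlus_PF_mul, fieldMinus_PF_mul,
      ← pu_C, map_add, map_mul, map_sub, map_ofNat, map_intCast, map_one]
    ring

theorem SymCoeff.divSymFlat {S : ℕ → RhoSeries} {n : ℤ} {s : ℕ → ℂ[X]} (h : SymCoeff S n s) :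
    FormCoeff (divSymFlat S 0) (divSymFlat S 1) (divSymFlat S 2) (n - 1)
      (divFlatPoly n s 0) (divFlatPoly n s 1) (divFlatPoly n s 2) := by
  have hr (f : RhoSeries) := coeff_rho_neg_one_mul f (n - 1) n (by ring)
  have hd (f : RhoSeries) := coeff_dRho' f (n - 1) n (by ring)
  constructor <;>
  · simp only [MomentumExpansion.ConnCoeffs.divSymFlat, divFlatPoly,
      coeff_two_mul, coeff_six_mul, HahnSeries.coeff_add, HahnSeries.coeff_sub,
      HahnSeries.coeff_neg, hr, hd, coeff_dPlus, coeff_dMinus, h.zero, h.one, h.two, h.three, h.four,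
      fieldPlus_pu, fieldMinus_pu, fieldMinus_MF_mul, fieldPlus_PF_mul, fieldMinus_MF_sq_mul,
      fieldPlus_PF_sq_mul, map_add, map_mul, map_sub, map_ofNat, map_intCast]
    ring

namespace IsConnection

variable {F : FrameData} {c : ConnCoeffs}

theorem coeff_two (h : IsConnection F c) {z : ℂ[X]} (hz : FrameCoeff F 2 z 0 0) :
    c.kappa.coeff 2 = 3 * pu z ∧ c.m.coeff 2 = 0 ∧ c.l.coeff 2 = 0 ∧
      2 * c.a.coeff 2 = -2 * MF * pu (derivative z) ∧
      2 * c.b.coeff 2 = 2 * PF * pu (derivative z) ∧ F.yMinus.coeff 2 = pu z := by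
  have hL : LinearOrder F 2 := ⟨by norm_num, by norm_num⟩
  have hy : F.yPlus.coeff 2 = 0 := by rw [hz.yPlus, map_zero, mul_zero]
  have hw : F.zMinus.coeff 2 = 0 := by rw [hz.zMinus, map_zero, mul_zero]
  refine ⟨by rw [h.coeff_two_kappa, hz.zPlus], by rw [h.coeff_m hL, hw, mul_zero],
    by rw [h.coeff_l hL, hy, mul_zero], ?_, ?_, by rw [h.coeff_yMinus hL, hz.zPlus]⟩
  · rw [h.coeff_a hL, hw, hz.zPlus, fieldPlus_pu, map_zero]; ring
  · rw [h.coeff_b hL, hy, hz.zPlus, fieldMinus_pu, map_zero]; ring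

theorem killingPert (h : IsConnection F c) {z : ℂ[X]} (hz : FrameCoeff F 2 z 0 0)
    {U V W : RhoSeries} {n : ℤ} {r x s : ℂ[X]} (hf : FormCoeff U V W n r x s)
    (hU : U ∈ ordGE n) (hV : V ∈ ordGE n) (hW : W ∈ ordGE n) :
    SymCoeff (killingPert F c U V W) (2 + n) (killingPertPoly z r x s) := by
  obtain ⟨hk, hm, hl, ha, hb, hy⟩ := h.coeff_two hz
  have hY : F.yPlus.coeff 2 = 0 := by rw [hz.yPlus, map_zero, mul_zero]
  have hw : F.zMinus.coeff 2 = 0 := by rw [hz.zMinus, map_zero, mul_zero]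
  have h4 : (4 : SU2 → ℂ) * pu (C (1 / 2)) = 2 := by
    funext t; simp [pu_C]; norm_num
  have h3 : (3 : SU2 → ℂ) * pu (C (1 / 3)) = 1 := by
    funext t; simp [pu_C]
  constructor
  · simp only [ConnCoeffs.killingPert, killingPertPoly, coeff_two_mul, coeff_four_mul,
      HahnSeries.coeff_sub, coeff_e0Pert hU _ rfl, coeff_mul_of_ordGE h.a_ord hU,
      coeff_mul_of_ordGE h.m_ord hV, hm, hw, hz.zPlus, hf.zero, fieldPlus_MF_mul, map_add, map_mul,
      map_ofNat]
    linear_combination (-2 * (MF * pu r)) * ha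
  · simp only [ConnCoeffs.killingPert, killingPertPoly, HahnSeries.coeff_add,
      HahnSeries.coeff_sub, coeff_e0Pert hV _ rfl, coeff_mul_of_ordGE h.m_ord hW,
      coeff_mul_of_ordGE h.kappa_ord hU, hm, hw, hk, hz.zPlus, hf.zero, hf.one, fieldPlus_pu,
      map_add, map_mul, map_ofNat]
    ring
  · simp only [ConnCoeffs.killingPert, divFormPert, killingPertPoly, HahnSeries.coeff_add,
      HahnSeries.coeff_sub, coeff_cst_mul, coeff_two_mul, coeff_four_mul, coeff_e0Pert hW _ rfl,
      coeff_e1Pert hU _ rfl, coeff_mul_of_ordGE h.kappa_ord hV, coeff_mul_of_ordGE h.a_ord hW,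
      coeff_mul_of_ordGE h.b_ord hU, hY, hy, hw, hk, hz.zPlus, hf.zero, hf.one, hf.two,
      fieldPlus_PF_mul, fieldMinus_MF_mul, map_add, map_mul, map_sub (f := pu) (_ + _),
      PF_mul_MF_mul_four, map_ofNat, ← pu_C]
    linear_combination (PF * pu s * pu (C (1 / 3))) * ha - (MF * pu r * pu (C (1 / 3))) * hb
      + (PF * MF * pu (derivative z) * pu (C (1 / 3)) * (pu r + pu s)) * h4
  · simp only [ConnCoeffs.killingPert, killingPertPoly, HahnSeries.coeff_add, HahnSeries.coeff_neg,
      HahnSeries.coeff_sub, coeff_e1Pert hV _ rfl, coeff_mul_of_ordGE h.l_ord hU,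
      coeff_mul_of_ordGE h.kappa_ord hW, hl, hY, hy, hk, hf.two, hf.one, fieldMinus_pu,
      map_add, map_mul, map_ofNat]
    ring
  · simp only [ConnCoeffs.killingPert, killingPertPoly, coeff_two_mul, coeff_four_mul,
      HahnSeries.coeff_add, HahnSeries.coeff_neg,
      HahnSeries.coeff_sub, coeff_e1Pert hW _ rfl, coeff_mul_of_ordGE h.b_ord hW,
      coeff_mul_of_ordGE h.l_ord hV, hl, hY, hy, hf.two, fieldMinus_PF_mul, map_add, map_mul,
      map_ofNat]
    linear_combination (2 * (PF * pu s)) * hb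

theorem divSymPert (h : IsConnection F c) {z : ℂ[X]} (hz : FrameCoeff F 2 z 0 0)
    {S : ℕ → RhoSeries} {n : ℤ} {s : ℕ → ℂ[X]} (hf : SymCoeff S n s) (hS : ∀ i, S i ∈ ordGE n) :
    FormCoeff (divSymPert F c S 0) (divSymPert F c S 1) (divSymPert F c S 2) (2 + n)
      (divPertPoly z s 0) (divPertPoly z s 1) (divPertPoly z s 2) := by
  obtain ⟨hk, hm, hl, ha, hb, hy⟩ := h.coeff_two hz
  have hY : F.yPlus.coeff 2 = 0 := by rw [hz.yPlus, map_zero, mul_zero]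
  have hw : F.zMinus.coeff 2 = 0 := by rw [hz.zMinus, map_zero, mul_zero]
  have h4 : (4 : SU2 → ℂ) * pu (C (1 / 2)) = 2 := by
    funext t; simp [pu_C]; norm_num
  constructor
  · simp only [ConnCoeffs.divSymPert, divPertPoly, coeff_two_mul, coeff_four_mul, coeff_six_mul,
      HahnSeries.coeff_add, HahnSeries.coeff_sub, coeff_e0Pert (hS _) _ rfl,
      coeff_e1Pert (hS _) _ rfl, coeff_mul_of_ordGE h.kappa_ord (hS _),
      coeff_mul_of_ordGE h.m_ord (hS _), coeff_mul_of_ordGE h.b_ord (hS _), hk, hm, hw, hY, hy,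
      hz.zPlus, hf.zero, hf.one, hf.two, fieldPlus_pu, fieldMinus_MF_sq_mul, map_add, map_mul,
      map_sub (f := pu) (_ + _), PF_mul_MF_mul_four, map_ofNat]
    linear_combination (-2 * (MF ^ 2 * pu (s 0))) * hb
  · simp only [ConnCoeffs.divSymPert, divPertPoly, coeff_two_mul, coeff_six_mul,
      HahnSeries.coeff_add, HahnSeries.coeff_sub, coeff_e0Pert (hS _) _ rfl,
      coeff_e1Pert (hS _) _ rfl, coeff_mul_of_ordGE h.kappa_ord (hS _),
      coeff_mul_of_ordGE h.m_ord (hS _), coeff_mul_of_ordGE h.b_ord (hS _),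
      coeff_mul_of_ordGE h.a_ord (hS _), coeff_mul_of_ordGE h.l_ord (hS _), hk, hm, hl, hw, hY, hy,
      hz.zPlus, hf.one, hf.two, hf.three, fieldPlus_PF_mul, fieldMinus_MF_mul, map_add, map_mul,
      map_sub (f := pu) (_ + _), PF_mul_MF_mul_four, map_ofNat]
    linear_combination (PF * pu (s 3)) * ha - (MF * pu (s 1)) * hb
      + (PF * MF * pu (derivative z) * (pu (s 1) + pu (s 3))) * h4
  · simp only [ConnCoeffs.divSymPert, divPertPoly, coeff_two_mul, coeff_four_mul, coeff_six_mul,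
      HahnSeries.coeff_add, HahnSeries.coeff_sub, coeff_e0Pert (hS _) _ rfl,
      coeff_e1Pert (hS _) _ rfl, coeff_mul_of_ordGE h.kappa_ord (hS _),
      coeff_mul_of_ordGE h.l_ord (hS _), coeff_mul_of_ordGE h.a_ord (hS _), hk, hl, hw, hY, hy,
      hz.zPlus, hf.two, hf.three, hf.four, fieldMinus_pu, fieldPlus_PF_sq_mul, map_add, map_mul,
      map_sub (f := pu) (_ + _), PF_mul_MF_mul_four, map_ofNat]
    linear_combination (2 * (PF ^ 2 * pu (s 4))) * ha

end IsConnection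

end

section

open Complex FrameData Polynomial ConnCoeffs

/-! ### The seeds of mass and angular momentum -/

/-- The field `f / ρ³`. -/
def invCube (f : SU2 → ℂ) : RhoSeries := rho (-3) * const f

/-- The components, divided by binomial coefficients, of the part of the seed that depends on the
mass `a` and on the angular momentum `e / (3 i)`. -/
def raySeed (a e : ℂ) : ℕ → RhoSeries
  | 1 => invCube ((fun _ : SU2 => e) * MF)
  | 2 => invCube fun _ : SU2 => -a / 6
  | 3 => invCube ((fun _ : SU2 => -e) * PF)
  | _ => 0

theorem dPlus_invCube (f : SU2 → ℂ) : dPlus (invCube f) = invCube (fieldPlus f) := by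
  ext1
  funext n
  rw [coeff_dPlus, invCube, invCube, coeff_rho_mul, coeff_rho_mul, const, const,
    HahnSeries.coeff_single, HahnSeries.coeff_single]
  split_ifs
  · rfl
  · exact map_zero _

theorem dMinus_invCube (f : SU2 → ℂ) : dMinus (invCube f) = invCube (fieldMinus f) := by
  ext1
  funext n
  rw [coeff_dMinus, invCube, invCube, coeff_rho_mul, coeff_rho_mul, const, const,
    HahnSeries.coeff_single, HahnSeries.coeff_single]
  split_ifs
  · rfl
  · exact map_zero _

theorem dRho_invCube (f : SU2 → ℂ) : dRho (invCube f) = -(3 * (rho (-1) * invCube f)) := by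
  ext1
  funext n
  rw [coeff_dRho, HahnSeries.coeff_neg, ← cst_ofNat 3, coeff_cst_mul, invCube, coeff_rho_mul,
    coeff_rho_mul, coeff_rho_mul, const, HahnSeries.coeff_single, HahnSeries.coeff_single]
  by_cases h : n = -4
  · subst h
    funext t
    simp
  · rw [if_neg (by omega), if_neg (by omega), mul_zero, mul_zero, neg_zero]

theorem coeff_mul_invCube (g : RhoSeries) (f : SU2 → ℂ) (n : ℤ) :
    (g * invCube f).coeff (n - 3) = g.coeff n * f := by
  have h : g * invCube f = const f * (rho (-3) * g) := by rw [invCube]; ring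
  rw [h, coeff_const_mul, coeff_rho_mul, sub_neg_eq_add, sub_add_cancel, mul_comm]

theorem invCube_zero : invCube 0 = 0 := by
  rw [invCube, const, HahnSeries.single_eq_zero, mul_zero]

theorem fieldPlus_const (z : ℂ) : fieldPlus (fun _ => z) = 0 := (HasFields.algebraMap z).fieldPlus_eq

theorem fieldMinus_const (z : ℂ) : fieldMinus (fun _ => z) = 0 :=
  (HasFields.algebraMap z).fieldMinus_eq

theorem fieldPlus_MF : fieldPlus MF = 0 := hasFields_MF.fieldPlus_eq

theorem fieldMinus_MF : fieldMinus MF = -uF := hasFields_MF.fieldMinus_eq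

theorem fieldPlus_PF : fieldPlus PF = uF := hasFields_PF.fieldPlus_eq

theorem fieldMinus_PF : fieldMinus PF = 0 := hasFields_PF.fieldMinus_eq

theorem raySeed_mem (a e : ℂ) (i : ℕ) : raySeed a e i ∈ polySeries := by
  have h {f : SU2 → ℂ} (hf : f ∈ polyFun) : invCube f ∈ polySeries :=
    mul_mem (rho_mem_polySeries _) (const_mem_polySeries hf)
  match i with
  | 0 | _ + 4 => exact zero_mem polySeries
  | 1 => exact h (mul_mem (polyFun.algebraMap_mem e) MF_mem)
  | 2 => exact h (polyFun.algebraMap_mem (-a / 6))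
  | 3 => exact h (mul_mem (polyFun.algebraMap_mem (-e)) PF_mem)

/-- The seeds are solutions of the flat momentum constraint. -/
theorem divSymFlat_raySeed (a e : ℂ) (i : ℕ) : divSymFlat (raySeed a e) i = 0 := by
  match i with
  | 0 =>
    simp only [divSymFlat, raySeed, dRho_invCube, dPlus_invCube, dMinus_zero, fieldPlus_const]
    rw [invCube_zero]
    ring
  | 1 =>
    have h : invCube ((fun _ => -e) * uF) = invCube ((fun _ => e) * -uF) := by
      congr 1
      funext t
      simp
    simp only [divSymFlat, raySeed, dRho_invCube, dPlus_invCube, dMinus_invCube,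
      fieldPlus_const_mul, fieldMinus_const_mul, fieldPlus_PF, fieldMinus_MF, h]
    ring
  | _ + 2 =>
    simp only [divSymFlat, raySeed, dRho_invCube, dMinus_invCube, dPlus_zero, fieldMinus_const]
    rw [invCube_zero]
    ring

/-- The polynomials of the divergence of the seeds in terms of those of the frame, where `k` is
the polynomial of the connection coefficient `κ`. -/
def divRayPoly (a e : ℂ) (n : ℤ) (k y w : ℂ[X]) : ℕ → ℂ[X]
  | 0 => C e * (6 * k + C (1 / 2) * ((n : ℂ[X]) + 1) * (X ^ 2 - 1) * w)
  | 1 => -C a * k + C e * (C (1 / 2) * (X ^ 2 - 1) * lower₂ (w - y))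
  | _ => -C e * (6 * k + C (1 / 2) * ((n : ℂ[X]) + 1) * (X ^ 2 - 1) * y)

theorem lower₂_sub (p q : ℂ[X]) : lower₂ (p - q) = lower₂ p - lower₂ q := by
  simp only [lower₂, derivative_sub]; ring

theorem IsConnection.divSym_raySeed {F : FrameData} {c : ConnCoeffs} (h : IsConnection F c) {n : ℤ}
    (hn : LinearOrder F n) {k z y w : ℂ[X]} (hk : c.kappa.coeff n = pu k)
    (hz : FrameCoeff F n z y w) (a e : ℂ) :
    FormCoeff (divSym F c (raySeed a e) 0) (divSym F c (raySeed a e) 1)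
      (divSym F c (raySeed a e) 2) (n - 3) (divRayPoly a e n k y w 0) (divRayPoly a e n k y w 1)
      (divRayPoly a e n k y w 2) := by
  have ha := h.coeff_a hn
  have hb := h.coeff_b hn
  rw [hz.zMinus, hz.zPlus, fieldPlus_pu, fieldMinus_MF_sq_mul] at ha
  rw [hz.yPlus, hz.zPlus, fieldMinus_pu, fieldPlus_PF_sq_mul] at hb
  have hy := h.coeff_yMinus hn
  rw [hz.zPlus] at hy
  have h4 : (4 : SU2 → ℂ) * pu (C (1 / 2)) = 2 := by
    funext t; simp [pu_C]; norm_num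
  have hj : pu (C e) = fun _ => e := pu_C _
  have hj' : (fun _ => -e : SU2 → ℂ) = -pu (C e) := by
    funext t; simp [pu_C]
  have ha6 : (fun _ => -a / 6 : SU2 → ℂ) * 6 = -pu (C a) := by
    funext t; simp [pu_C]
  constructor
  · rw [divSym_eq, divSymFlat_raySeed, zero_add]
    simp only [ConnCoeffs.divSymPert, divRayPoly, raySeed, e0Pert, e1Pert, dPlus_invCube, dMinus_invCube,
      dPlus_zero, dMinus_zero, mul_zero, add_zero, sub_zero, fieldPlus_const, fieldMinus_const,
      HahnSeries.coeff_add, HahnSeries.coeff_sub, coeff_two_mul, coeff_six_mul, coeff_mul_invCube,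
      hk, h.coeff_m hn, hz.zMinus, map_mul, map_add, map_ofNat, map_intCast, map_one, hj',
      PF_mul_MF_mul_four]
    rw [← hj]
    linear_combination (-((n : SU2 → ℂ) + 1) * PF * MF ^ 2 * pu w * pu (C e)) * h4
  · rw [divSym_eq, divSymFlat_raySeed, zero_add]
    simp only [ConnCoeffs.divSymPert, divRayPoly, raySeed, e0Pert, e1Pert, dPlus_invCube, dMinus_invCube,
      mul_zero, sub_zero, fieldPlus_const_mul, fieldMinus_const_mul, fieldPlus_PF, fieldMinus_PF,
      fieldPlus_MF, fieldMinus_MF, lower₂_sub, map_sub (f := pu) (lower₂ _),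
      HahnSeries.coeff_add, HahnSeries.coeff_sub, coeff_two_mul, coeff_six_mul, coeff_mul_invCube,
      hk, hy, hz.zMinus, hz.zPlus, hz.yPlus, map_mul, map_neg, map_add,
      PF_mul_MF_mul_four]
    rw [hj', ← hj]
    linear_combination (pu k) * ha6 - (PF * pu (C e)) * ha
      - (MF * pu (C e)) * hb
      - (PF * MF * (pu (lower₂ w) - pu (lower₂ y)) * pu (C e)) * h4
  · rw [divSym_eq, divSymFlat_raySeed, zero_add]
    simp only [ConnCoeffs.divSymPert, divRayPoly, raySeed, e0Pert, e1Pert, dPlus_invCube, dMinus_invCube,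
      dPlus_zero, dMinus_zero, mul_zero, add_zero, sub_zero, fieldPlus_const, fieldMinus_const,
      HahnSeries.coeff_add, HahnSeries.coeff_sub, coeff_two_mul, coeff_six_mul, coeff_mul_invCube,
      hk, h.coeff_l hn, hz.yPlus, map_mul, map_neg, map_add, map_ofNat, map_intCast, map_one, hj',
      PF_mul_MF_mul_four]
    rw [← hj]
    linear_combination (((n : SU2 → ℂ) + 1) * PF ^ 2 * MF * pu y * pu (C e)) * h4

end

section

open Complex FrameData Polynomial ConnCoeffs

/-! ### The Ansatz for the 1-form -/

theorem sum_T_add (s : Finset ℕ) (j : ℕ) (hs : ∀ q ∈ s, j ≤ q) (c : ℕ → ℂ) :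
    (fun t => ∑ q ∈ s, c q * T (2 * q) q (q + j) t) =
      PF ^ j * pu (∑ q ∈ s, C (c q) * weightPoly q j) := by
  funext t
  rw [map_sum, Finset.mul_sum, Finset.sum_apply]
  refine Finset.sum_congr rfl fun q hq => ?_
  rw [T_add q j (hs q hq), map_mul, pu_C, mul_left_comm]
  rfl

theorem sum_T_sub (s : Finset ℕ) (j : ℕ) (hs : ∀ q ∈ s, j ≤ q) (c : ℕ → ℂ) :
    (fun t => ∑ q ∈ s, c q * T (2 * q) q (q - j) t) =
      MF ^ j * pu (∑ q ∈ s, C (c q) * weightPoly q j) := by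
  funext t
  rw [map_sum, Finset.mul_sum, Finset.sum_apply]
  refine Finset.sum_congr rfl fun q hq => ?_
  rw [T_sub q j (hs q hq), map_mul, pu_C, mul_left_comm]
  rfl

theorem natDegree_sum_weightPoly_le (i p j : ℕ) (c : ℕ → ℂ) :
    (∑ q ∈ Finset.Icc i p, C (c q) * weightPoly q j).natDegree ≤ p - j :=
  natDegree_sum_le_of_forall_le _ _ fun q hq => (natDegree_C_mul_le _ _).trans
    ((natDegree_weightPoly_le q j).trans (Nat.sub_le_sub_right (Finset.mem_Icc.1 hq).2 j))

/-- The series `∑_{1 ≤ p ≤ N} (f p) ρ^p`. -/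
def sumUpTo (N : ℕ) (f : ℕ → SU2 → ℂ) : RhoSeries :=
  ∑ p ∈ Finset.Icc 1 N, rho (p : ℤ) * const (f p)

theorem sumUpTo_ord (N : ℕ) (f : ℕ → SU2 → ℂ) : sumUpTo N f ∈ ordGE 1 :=
  sum_mem fun p hp => ordGE_mono (by simpa using (Finset.mem_Icc.1 hp).1)
    (mul_mem_ordGE (rho_mem_ordGE p) (const_mem_ordGE _))

theorem sumUpTo_mem (N : ℕ) {f : ℕ → SU2 → ℂ} (hf : ∀ p, f p ∈ polyFun) :
    sumUpTo N f ∈ polySeries :=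
  sum_mem fun _ _ => mul_mem (rho_mem_polySeries _) (const_mem_polySeries (hf _))

theorem coeff_sumUpTo {N p : ℕ} (hp : p ∈ Finset.Icc 1 N) (f : ℕ → SU2 → ℂ) :
    (sumUpTo N f).coeff p = f p := by
  rw [sumUpTo, HahnSeries.coeff_sum, Finset.sum_eq_single_of_mem p hp fun q _ hq => ?_]
  · rw [coeff_rho_mul, sub_self, const, HahnSeries.coeff_single_same]
  · rw [coeff_rho_mul, const, HahnSeries.coeff_single_of_ne (by omega)]

namespace FormData

variable (v : FormData) (N : ℕ)

/-- The component `√2 v₀₀`. -/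
def compZero : RhoSeries :=
  sumUpTo N fun p t => ∑ q ∈ Finset.Icc 1 p, v.vz p q * T (2 * q) q (q - 1) t

/-- The component `√2 v₀₁`. -/
def compOne : RhoSeries :=
  sumUpTo N fun p t => ∑ q ∈ Finset.Icc 0 p, v.vx p q * T (2 * q) q q t

/-- The component `√2 v₁₁`. -/
def compTwo : RhoSeries :=
  sumUpTo N fun p t => ∑ q ∈ Finset.Icc 1 p, -v.vy p q * T (2 * q) q (q + 1) t

theorem spinor_zero_zero : v.spinor N 0 0 = invSqrtTwo * v.compZero N := by
  rw [spinor, compZero, sumUpTo, Finset.mul_sum]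
  refine Finset.sum_congr rfl fun p _ => ?_
  simp only [xs, ys, zs, Matrix.cons_val_zero, cst_zero, zero_mul, zero_add, invSqrtTwo]
  ring

theorem spinor_off {A B : Fin 2} (h : A ≠ B) : v.spinor N A B = invSqrtTwo * v.compOne N := by
  rw [spinor, compOne, sumUpTo, Finset.mul_sum]
  refine Finset.sum_congr rfl fun p _ => ?_
  fin_cases A <;> fin_cases B <;> first
    | exact absurd rfl h
    | simp only [xs, ys, zs, Fin.zero_eta, Fin.mk_one, Matrix.cons_val_zero, Matrix.cons_val_one,
        Matrix.cons_val_fin_one, cst_zero, zero_mul, add_zero, invSqrtTwo]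
      ring

theorem spinor_one_one : v.spinor N 1 1 = invSqrtTwo * v.compTwo N := by
  rw [spinor, compTwo, sumUpTo, Finset.mul_sum]
  refine Finset.sum_congr rfl fun p _ => ?_
  have h : const (fun t => ∑ q ∈ Finset.Icc 1 p, -v.vy p q * T (2 * q) q (q + 1) t) =
      -const (fun t => ∑ q ∈ Finset.Icc 1 p, v.vy p q * T (2 * q) q (q + 1) t) := by
    rw [const, const, ← HahnSeries.single_neg]
    congr 1
    funext t
    simp
  simp only [xs, ys, zs, Matrix.cons_val_one, Matrix.cons_val_fin_one, cst_zero, zero_mul, zero_add,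
    add_zero, invSqrtTwo, h, cst_neg]
  ring

theorem compZero_mem : v.compZero N ∈ polySeries := sumUpTo_mem N fun _ => sum_T_mem _ _ _

theorem compOne_mem : v.compOne N ∈ polySeries := sumUpTo_mem N fun _ => sum_T_mem _ _ _

theorem compTwo_mem : v.compTwo N ∈ polySeries := sumUpTo_mem N fun p => sum_T_mem _ (fun q => -v.vy p q) _

end FormData

/-- A 1-form `O(ρ)` whose coefficients up to the order `ρ^N` are those of the Ansatz: the
polynomials of the coefficient of order `ρ^p` have degree at most `p - 1`, `p` and `p - 1`. -/
structure IsAnsatz (N : ℕ) (U V W : RhoSeries) : Prop where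
  mem_zero : U ∈ polySeries
  mem_one : V ∈ polySeries
  mem_two : W ∈ polySeries
  ord_zero : U ∈ ordGE 1
  ord_one : V ∈ ordGE 1
  ord_two : W ∈ ordGE 1
  formCoeff : ∀ p ∈ Finset.Icc 1 N, ∃ r x s : ℂ[X], r.natDegree ≤ p - 1 ∧ x.natDegree ≤ p ∧
    s.natDegree ≤ p - 1 ∧ FormCoeff U V W p r x s

theorem FormData.isAnsatz (v : FormData) (N : ℕ) :
    IsAnsatz N (v.compZero N) (v.compOne N) (v.compTwo N) where
  mem_zero := v.compZero_mem N
  mem_one := v.compOne_mem N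
  mem_two := v.compTwo_mem N
  ord_zero := sumUpTo_ord _ _
  ord_one := sumUpTo_ord _ _
  ord_two := sumUpTo_ord _ _
  formCoeff p hp := by
    refine ⟨_, _, _, natDegree_sum_weightPoly_le 1 p 1 (v.vz p),
      natDegree_sum_weightPoly_le 0 p 0 (v.vx p),
      natDegree_sum_weightPoly_le 1 p 1 fun q => -v.vy p q, ?_, ?_, ?_⟩
    · rw [compZero, coeff_sumUpTo hp, sum_T_sub _ 1 fun q hq => (Finset.mem_Icc.1 hq).1, pow_one]
    · rw [compOne, coeff_sumUpTo hp]
      exact (sum_T_add _ 0 (fun q _ => q.zero_le) _).trans (by rw [pow_zero, one_mul])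
    · rw [compTwo, coeff_sumUpTo hp, sum_T_add _ 1 (fun q hq => (Finset.mem_Icc.1 hq).1)
        (fun q => -v.vy p q), pow_one]

theorem IsAnsatz.sub {N : ℕ} {U V W U' V' W' : RhoSeries} (h : IsAnsatz N U V W)
    (h' : IsAnsatz N U' V' W') : IsAnsatz N (U - U') (V - V') (W - W') where
  mem_zero := sub_mem h.mem_zero h'.mem_zero
  mem_one := sub_mem h.mem_one h'.mem_one
  mem_two := sub_mem h.mem_two h'.mem_two
  ord_zero := sub_mem h.ord_zero h'.ord_zero
  ord_one := sub_mem h.ord_one h'.ord_one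
  ord_two := sub_mem h.ord_two h'.ord_two
  formCoeff p hp := by
    obtain ⟨r, x, s, hr, hx, hs, hc⟩ := h.formCoeff p hp
    obtain ⟨r', x', s', hr', hx', hs', hc'⟩ := h'.formCoeff p hp
    refine ⟨r - r', x - x', s - s', (natDegree_sub_le _ _).trans (max_le hr hr'),
      (natDegree_sub_le _ _).trans (max_le hx hx'), (natDegree_sub_le _ _).trans (max_le hs hs'),
      ?_, ?_, ?_⟩
    · rw [HahnSeries.coeff_sub, hc.zero, hc'.zero, map_sub, mul_sub]
    · rw [HahnSeries.coeff_sub, hc.one, hc'.one, map_sub]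
    · rw [HahnSeries.coeff_sub, hc.two, hc'.two, map_sub, mul_sub]

/-! ### The seed -/

/-- The component of the seed with `j` indices equal to `1`. -/
def seedComp (a b c : ℝ) (l : ℤ → ℕ → ℂ) (j : ℕ) : RhoSeries :=
  cst ((Nat.choose 4 j : ℂ)⁻¹) * (seedA a j + seedQ b j + seedJ c j + seedLambda l j)

theorem seed_eq (a b c : ℝ) (l : ℤ → ℕ → ℂ) (A B C D : Fin 2) :
    seed a b c l A B C D = seedComp a b c l (A.val + B.val + C.val + D.val) := by
  rw [seed, symSpinor, Finset.sum_eq_single_of_mem (A.val + B.val + C.val + D.val)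
    (Finset.mem_range.2 (by omega))]
  · rw [epsSym, if_pos rfl, seedComp]
  · intro i _ hi
    rw [epsSym, if_neg (Ne.symm hi), cst_zero, zero_mul]

theorem rho_mul_const_mem (n : ℤ) (z : ℂ) (m j k : ℕ) :
    (rho n * const fun t => z * T m j k t) ∈ polySeries :=
  mul_mem (rho_mem_polySeries _)
    (const_mem_polySeries (mul_mem (polyFun.algebraMap_mem z) (T_mem m j k)))

theorem seedComp_mem (a b c : ℝ) (l : ℤ → ℕ → ℂ) (j : ℕ) : seedComp a b c l j ∈ polySeries := by
  refine mul_mem (cst_mem_polySeries _) (add_mem (add_mem (add_mem ?_ ?_) ?_) ?_)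
  · rw [seedA]
    split_ifs
    exacts [rho_mul_const_mem _ _ _ _ _, zero_mem _]
  · rw [seedQ]
    split_ifs
    exacts [rho_mul_const_mem _ _ _ _ _, rho_mul_const_mem _ _ _ _ _, rho_mul_const_mem _ _ _ _ _,
      zero_mem _]
  · rw [seedJ]
    split_ifs
    exacts [rho_mul_const_mem _ _ _ _ _, rho_mul_const_mem _ _ _ _ _, zero_mem _]
  · exact mul_mem (rho_mem_polySeries _) (sumRho_mem_polySeries fun _ => sum_T_mem _ _ _)

theorem weightPoly_one_one : weightPoly 1 1 = C (Real.sqrt 2 : ℂ) := by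
  simp [weightPoly, Nat.choose]
  rw [mul_assoc, ← C_ofNat, ← C_mul, inv_mul_cancel₀ two_ne_zero, C_1, mul_one]

theorem T_two_zero : T 2 1 0 = (fun _ => (Real.sqrt 2 : ℂ)) * MF := by
  have h := T_sub 1 1 le_rfl
  rw [weightPoly_one_one, pu_C, pow_one, mul_comm MF] at h
  exact h

theorem T_two_two : T 2 1 2 = (fun _ => (Real.sqrt 2 : ℂ)) * PF := by
  have h := T_add 1 1 le_rfl
  rw [weightPoly_one_one, pu_C, pow_one, mul_comm PF] at h
  exact h

theorem sqrtTwo_mul_sqrtTwo : (Real.sqrt 2 : ℂ) * Real.sqrt 2 = 2 := by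
  rw [← ofReal_mul, Real.mul_self_sqrt zero_le_two, ofReal_ofNat]

theorem rho_mul_const_sub (n : ℤ) (f g : SU2 → ℂ) :
    rho n * const f - rho n * const g = rho n * const (f - g) := by
  rw [← mul_sub, const, const, const, HahnSeries.single_sub]

theorem cst_mul_rho_mul_const (z : ℂ) (n : ℤ) (f : SU2 → ℂ) :
    cst z * (rho n * const f) = rho n * const ((fun _ => z) * f) := by
  rw [mul_left_comm, cst, const, const, const, HahnSeries.single_mul_single, add_zero]

/-- The difference of two seeds that differ only in `A` and in `J`. -/
theorem seedComp_sub (a b c a' c' : ℝ) (l : ℤ → ℕ → ℂ) (j : ℕ) :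
    seedComp a b c l j - seedComp a' b c' l j = raySeed (a - a' : ℝ) (3 * I * (c - c' : ℝ)) j := by
  have h2 := sqrtTwo_mul_sqrtTwo
  match j with
  | 0 => simp [seedComp, seedA, seedJ, raySeed]
  | 1 =>
    have h : seedComp a b c l 1 - seedComp a' b c' l 1 = cst (Nat.choose 4 1 : ℂ)⁻¹ *
        (seedJ c 1 - seedJ c' 1) := by simp [seedComp, seedA]; ring
    rw [h, seedJ, seedJ, if_pos rfl, if_pos rfl, rho_mul_const_sub, cst_mul_rho_mul_const, raySeed,
      invCube, T_two_zero]
    congr 2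
    funext t
    simp
    linear_combination (6 / 4 * I * (c - c') * MF t) * h2
  | 2 =>
    have h : seedComp a b c l 2 - seedComp a' b c' l 2 = cst (Nat.choose 4 2 : ℂ)⁻¹ *
        (seedA a 2 - seedA a' 2) := by simp [seedComp, seedJ]; ring
    rw [h, seedA, seedA, if_pos rfl, if_pos rfl, rho_mul_const_sub, cst_mul_rho_mul_const, raySeed,
      invCube]
    congr 2
    funext t
    simp [T, Nat.choose]
    ring
  | 3 =>
    have h : seedComp a b c l 3 - seedComp a' b c' l 3 = cst (Nat.choose 4 3 : ℂ)⁻¹ *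
        (seedJ c 3 - seedJ c' 3) := by simp [seedComp, seedA]; ring
    rw [h, seedJ, seedJ, if_neg (by norm_num), if_pos rfl, if_neg (by norm_num), if_pos rfl,
      rho_mul_const_sub, cst_mul_rho_mul_const, raySeed, invCube, T_two_two]
    congr 2
    funext t
    simp [Nat.choose]
    linear_combination (-6 / 4 * I * (c - c') * PF t) * h2
  | j + 4 => simp [seedComp, seedA, seedJ, raySeed]

/-! ### The difference of two solutions -/

/-- The homogeneous system that is satisfied by the difference of two solutions: a combination of
the seeds of mass and of angular momentum is compensated by a 1-form of the Ansatz. -/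
def Compensated (F : FrameData) (c : ConnCoeffs) (a e : ℂ) : Prop :=
  ∃ U V W : RhoSeries, IsAnsatz 4 U V W ∧ ∀ i ≤ 2, ∀ k ≤ (2 : ℤ),
    (divSym F c (fun j => raySeed a e j + cst (1 / 2) * killing F c U V W j) i).coeff k = 0

variable {F : FrameData} {g : Spinor4}

theorem IsLeviCivita.coeff_divSym (hg : IsLeviCivita F g) (v : FormData) (N : ℕ) (a b c : ℝ)
    (l : ℤ → ℕ → ℂ) {k : ℤ} (h : ∀ C D : Fin 2,
      (div4 F g (seed a b c l + conformalKilling F g (v.spinor N)) C D).coeff k = 0)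
    {i : ℕ} (hi : i ≤ 2) : (divSym F (ConnCoeffs.ofSpinor g) (fun j => seedComp a b c l j +
      cst (1 / 2) * killing F (ConnCoeffs.ofSpinor g) (v.compZero N) (v.compOne N) (v.compTwo N) j)
        i).coeff k = 0 := by
  obtain ⟨C, D, rfl⟩ : ∃ C D : Fin 2, C.val + D.val = i := by
    interval_cases i
    exacts [⟨0, 0, rfl⟩, ⟨0, 1, rfl⟩, ⟨1, 1, rfl⟩]
  have h1 := h C D
  rw [div4_eq hg _ (fun j => seedComp a b c l j + cst (1 / 2) * killing F (ConnCoeffs.ofSpinor g)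
    (v.compZero N) (v.compOne N) (v.compTwo N) j) fun A B C D => by
      rw [Pi.add_apply, Pi.add_apply, Pi.add_apply, Pi.add_apply, seed_eq, conformalKilling_eq hg _
        (v.compZero N) (v.compOne N) (v.compTwo N) (v.spinor_zero_zero N) (v.spinor_off N (by simp))
        (v.spinor_off N (by simp)) (v.spinor_one_one N)]] at h1
  rw [apply_eq (divSym _ _ _ _), mul_left_comm, sqrtTwo, coeff_cst_mul, h1, mul_zero]

theorem SolvableUpTo.compensated (hg : IsLeviCivita F g) {a b c a' c' : ℝ} {l : ℤ → ℕ → ℂ}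
    (h : SolvableUpTo 4 F g (seed a b c l)) (h' : SolvableUpTo 4 F g (seed a' b c' l)) :
    Compensated F (ConnCoeffs.ofSpinor g) (a - a' : ℝ) (3 * I * (c - c' : ℝ)) := by
  obtain ⟨v, -, hv⟩ := h
  obtain ⟨v', -, hv'⟩ := h'
  have hA := v.isAnsatz 4
  have hA' := v'.isAnsatz 4
  refine ⟨_, _, _, hA.sub hA', fun i hi k hk => ?_⟩
  have h1 := hg.coeff_divSym v 4 a b c l (fun C D => hv C D k hk) hi
  have h2 := hg.coeff_divSym v' 4 a' b c' l (fun C D => hv' C D k hk) hi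
  have hc := hg.isConnection
  have m1 (j) : seedComp a b c l j + cst (1 / 2) * killing F (ConnCoeffs.ofSpinor g)
      (v.compZero 4) (v.compOne 4) (v.compTwo 4) j ∈ polySeries :=
    add_mem (seedComp_mem _ _ _ _ _) (mul_mem (cst_mem_polySeries _)
      (killing_mem hc hA.mem_zero hA.mem_one hA.mem_two j))
  have m2 (j) : seedComp a' b c' l j + cst (1 / 2) * killing F (ConnCoeffs.ofSpinor g)
      (v'.compZero 4) (v'.compOne 4) (v'.compTwo 4) j ∈ polySeries :=
    add_mem (seedComp_mem _ _ _ _ _) (mul_mem (cst_mem_polySeries _)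
      (killing_mem hc hA'.mem_zero hA'.mem_one hA'.mem_two j))
  have h3 := congrArg (fun f => f.coeff k) (divSym_sub (F := F) (c := ConnCoeffs.ofSpinor g) m1 m2 i)
  simp only [HahnSeries.coeff_sub, h1, h2, sub_zero] at h3
  rw [← h3]
  congr 2
  funext j
  rw [killing_sub hA.mem_zero hA.mem_one hA.mem_two hA'.mem_zero hA'.mem_one hA'.mem_two,
    ← seedComp_sub a b c a' c' l]
  ring

/-- A linear relation between `A` and `J` that holds for all compensated combinations of seeds is
trivial if the parameters of the solvable seeds do not lie on a straight line. -/
theorem eq_zero_of_forall_compensated (hg : IsLeviCivita F g) {b : ℝ} {l : ℤ → ℕ → ℂ}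
    (hsol : ∀ α β δ : ℝ, (α, β) ≠ (0, 0) → ∃ A J : ℝ, α * A + β * J ≠ δ ∧
      SolvableUpTo 4 F g (seed A b J l)) {α β : ℂ}
    (h : ∀ a e, Compensated F (ConnCoeffs.ofSpinor g) a e → a * α + e * β = 0) :
    α = 0 ∧ β = 0 := by
  obtain ⟨A₀, J₀, -, h₀⟩ := hsol 1 0 0 (by simp)
  have key (A J : ℝ) (hs : SolvableUpTo 4 F g (seed A b J l)) :
      ((A - A₀ : ℝ) : ℂ) * α + ((J - J₀ : ℝ) : ℂ) * (3 * I * β) = 0 := by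
    have h1 := h _ _ (hs.compensated hg h₀)
    linear_combination h1
  have hre : (α.re, (3 * I * β).re) = (0, 0) := by
    by_contra hne
    obtain ⟨A, J, h1, h2⟩ := hsol _ _ (α.re * A₀ + (3 * I * β).re * J₀) hne
    have h3 := congrArg Complex.re (key A J h2)
    rw [add_re, re_ofReal_mul, re_ofReal_mul, zero_re] at h3
    exact h1 (by linear_combination h3)
  have him : (α.im, (3 * I * β).im) = (0, 0) := by
    by_contra hne
    obtain ⟨A, J, h1, h2⟩ := hsol _ _ (α.im * A₀ + (3 * I * β).im * J₀) hne
    have h3 := congrArg Complex.im (key A J h2)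
    rw [add_im, im_ofReal_mul, im_ofReal_mul, zero_im] at h3
    exact h1 (by linear_combination h3)
  rw [Prod.mk.injEq] at hre him
  have h4 : 3 * I * β = 0 := Complex.ext hre.2 him.2
  exact ⟨Complex.ext hre.1 him.1, by simpa using h4⟩

end

section

open Complex FrameData Polynomial ConnCoeffs

/-! ### The coefficients of the polynomial system -/

theorem coeff_sq_sub_one_mul (p : ℂ[X]) (n : ℕ) :
    ((X ^ 2 - 1) * p).coeff (n + 2) = p.coeff n - p.coeff (n + 2) := by
  rw [sub_mul, one_mul, coeff_sub, coeff_X_pow_mul]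

theorem coeff_sq_sub_one_mul_derivative (p : ℂ[X]) (n : ℕ) :
    ((X ^ 2 - 1) * derivative p).coeff (n + 1) = n * p.coeff n - (n + 2) * p.coeff (n + 2) := by
  rcases n with _ | n
  · simp [sub_mul, coeff_X_pow_mul', coeff_derivative]; ring
  · rw [coeff_sq_sub_one_mul, coeff_derivative, coeff_derivative]
    push_cast
    ring

theorem coeff_lower (p : ℂ[X]) (n : ℕ) : (lower p).coeff (n + 1) =
    (1 + n / 2) * p.coeff n - (n + 2) / 2 * p.coeff (n + 2) := by
  rw [lower, coeff_add, coeff_X_mul, mul_assoc, coeff_C_mul, coeff_sq_sub_one_mul_derivative]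
  ring

theorem coeff_lower₂ (p : ℂ[X]) (n : ℕ) : (lower₂ p).coeff (n + 1) =
    (1 + n / 4) * p.coeff n - (n + 2) / 4 * p.coeff (n + 2) := by
  rw [lower₂, coeff_add, coeff_X_mul, mul_assoc, coeff_C_mul, coeff_sq_sub_one_mul_derivative]
  ring

theorem coeff_lower₂_zero (p : ℂ[X]) : (lower₂ p).coeff 0 = -(1 / 4) * p.coeff 1 := by
  simp [lower₂, mul_assoc, mul_coeff_zero, coeff_derivative]

/-- The flat operator on the 1-form of order `ρⁿ` with the polynomials `r`, `x`, `s`. -/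
def flatPoly (n : ℤ) (r x s : ℂ[X]) : ℕ → ℂ[X] := divFlatPoly (n - 1) (killingFlatPoly n r x s)

section flat

variable (n : ℤ) (r x s : ℂ[X]) (j : ℕ)

theorem coeff_flatPoly_one : (flatPoly n r x s 1).coeff (j + 1) =
    (1 + j / 2) * (4 * (j + 1) * x.coeff (j + 1) + (n - 1) * (r.coeff j + s.coeff j))
    - (j + 2) / 2 * (4 * (j + 3) * x.coeff (j + 3) + (n - 1) * (r.coeff (j + 2) + s.coeff (j + 2)))
    - (2 * n + 4) * (2 * n * x.coeff (j + 1) + 1 / 3 * ((1 + j / 2) * (r.coeff j + s.coeff j)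
      - (j + 2) / 2 * (r.coeff (j + 2) + s.coeff (j + 2)) - (4 + 2 * n) * x.coeff (j + 1))) := by
  simp only [flatPoly, divFlatPoly, killingFlatPoly, add_mul, sub_mul, mul_assoc, one_mul, coeff_add,
    coeff_sub, coeff_ofNat_mul, coeff_intCast_mul, coeff_C_mul, coeff_lower, coeff_derivative]
  push_cast
  ring

theorem coeff_flatPoly_add : (flatPoly n r x s 0 + flatPoly n r x s 2).coeff (j + 1) =
    4 * (j + 2) * (2 * n * x.coeff (j + 2) + 1 / 3 * ((1 + (j + 1) / 2) *
      (r.coeff (j + 1) + s.coeff (j + 1)) - (j + 3) / 2 * (r.coeff (j + 3) + s.coeff (j + 3))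
      - (4 + 2 * n) * x.coeff (j + 2)))
    + 8 * ((1 + j / 4) * (j + 1) * (r.coeff (j + 1) + s.coeff (j + 1)) - (j + 2) / 4 * (j + 3) *
      (r.coeff (j + 3) + s.coeff (j + 3)))
    - (2 * n + 4) * (4 * (j + 2) * x.coeff (j + 2) +
      (n - 1) * (r.coeff (j + 1) + s.coeff (j + 1))) := by
  simp only [flatPoly, divFlatPoly, killingFlatPoly, add_mul, sub_mul, mul_assoc, one_mul, coeff_add,
    coeff_sub, coeff_ofNat_mul, coeff_intCast_mul, coeff_C_mul, coeff_lower, coeff_lower₂,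
    coeff_derivative]
  push_cast
  ring

/-- The difference of the components of spin weights `-1` and `1` involves only `r - s`; in the
coefficient of degree `n - 1`, that is `j + 2 = n`, the terms in `r - s` of this degree cancel. -/
theorem coeff_flatPoly_sub : (flatPoly n r x s 0 - flatPoly n r x s 2).coeff (j + 1) =
    8 * ((1 + j / 4) * (j + 1) * (r.coeff (j + 1) - s.coeff (j + 1)) - (j + 2) / 4 * (j + 3) *
      (r.coeff (j + 3) - s.coeff (j + 3)))
    - (2 * n + 4) * ((n - 1) * (r.coeff (j + 1) - s.coeff (j + 1))) := by
  simp only [flatPoly, divFlatPoly, killingFlatPoly, add_mul, sub_mul, mul_assoc, one_mul, coeff_add,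
    coeff_sub, coeff_ofNat_mul, coeff_intCast_mul, coeff_C_mul, coeff_lower, coeff_lower₂,
    coeff_derivative]
  push_cast
  ring

end flat

/-- The momentum constraint at the order `ρ^{n-3}`, in terms of the polynomials `k`, `y`, `w` of
the frame at the order `ρⁿ`, is solved by the polynomials `r`, `x`, `s` of a 1-form at the order
`ρ^{n-1}`, up to terms `f` of low degree. -/
def ConstraintAt (n : ℕ) (k y w : ℂ[X]) (a e : ℂ) : Prop :=
  ∃ (r x s : ℂ[X]) (f : ℕ → ℂ[X]), r.natDegree ≤ n - 2 ∧ x.natDegree ≤ n - 1 ∧ s.natDegree ≤ n - 2 ∧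
    (f 0).natDegree ≤ n - 4 ∧ (f 1).natDegree ≤ n - 3 ∧ (f 2).natDegree ≤ n - 4 ∧
    ∀ i ≤ 2, divRayPoly a e n k y w i + C (1 / 2) * (flatPoly (n - 1) r x s i + f i) = 0

section extraction

variable {a e : ℂ} {k y w r x s : ℂ[X]} {m : ℕ}

theorem coeff_divRayPoly_one (n : ℤ) (j : ℕ) : (divRayPoly a e n k y w 1).coeff (j + 2) =
    -a * k.coeff (j + 2) + e * (1 / 2 * ((lower₂ (w - y)).coeff j -
      (lower₂ (w - y)).coeff (j + 2))) := by
  simp only [divRayPoly, ← C_neg, mul_assoc, coeff_add, coeff_C_mul, coeff_sq_sub_one_mul]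

theorem coeff_divRayPoly_sub (n : ℤ) (j : ℕ) :
    (divRayPoly a e n k y w 0 - divRayPoly a e n k y w 2).coeff (j + 2) =
    e * (12 * k.coeff (j + 2) + (n + 1) / 2 * ((w + y).coeff j - (w + y).coeff (j + 2))) := by
  have h : divRayPoly a e n k y w 0 - divRayPoly a e n k y w 2 =
      C e * (12 * k + C (1 / 2) * (((n : ℂ[X]) + 1) * ((X ^ 2 - 1) * (w + y)))) := by
    simp only [divRayPoly]; ring
  simp only [h, add_mul, one_mul, coeff_add, coeff_C_mul, coeff_ofNat_mul, coeff_intCast_mul,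
    coeff_sq_sub_one_mul]
  ring

theorem divRayPoly_add (n : ℤ) : divRayPoly a e n k y w 0 + divRayPoly a e n k y w 2 =
      C e * (C (1 / 2) * (((n : ℂ[X]) + 1) * ((X ^ 2 - 1) * (w - y)))) := by
  simp only [divRayPoly]; ring

theorem ConstraintAt.coeff_top (h : ConstraintAt (m + 2) k y w a e) (hk : k.natDegree ≤ m + 2)
    (hy : y.natDegree ≤ m) (hw : w.natDegree ≤ m) :
    a * k.coeff (m + 2) = e * (1 / 2 * (lower₂ (w - y)).coeff m) ∧
    e * (w - y).coeff m = 0 ∧ e * (12 * k.coeff (m + 2) + (m + 3) / 2 * (w + y).coeff m) = 0 := by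
  obtain ⟨r, x, s, f, hr, hx, hs, h0, h1, h2, hf⟩ := h
  have e1 := hf 1 (by norm_num)
  have v {p : ℂ[X]} {d : ℕ} (hp : p.natDegree ≤ d) (j : ℕ) (hj : d < j) : p.coeff j = 0 :=
    coeff_eq_zero_of_natDegree_lt (hp.trans_lt hj)
  have hd : (w - y).natDegree ≤ m := (natDegree_sub_le _ _).trans (max_le hw hy)
  have hs' : (w + y).natDegree ≤ m := (natDegree_add_le _ _).trans (max_le hw hy)
  refine ⟨?_, ?_, ?_⟩
  · have e2 := congrArg (fun p => p.coeff (m + 2)) e1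
    simp only [coeff_add, coeff_C_mul, coeff_divRayPoly_one, coeff_flatPoly_one, coeff_zero,
      coeff_lower₂ _ (m + 1)] at e2
    rw [v h1 (m + 2) (by omega), v hx (m + 1 + 1) (by omega), v hx (m + 1 + 3) (by omega),
      v hr (m + 1) (by omega), v hs (m + 1) (by omega), v hr (m + 1 + 2) (by omega),
      v hs (m + 1 + 2) (by omega), v hd (m + 1) (by omega), v hd (m + 1 + 2) (by omega)] at e2
    linear_combination -e2
  · have e2 := congrArg (fun p => p.coeff (m + 3)) e1
    simp only [coeff_add, coeff_C_mul, coeff_divRayPoly_one _ (m + 1), coeff_flatPoly_one, coeff_zero,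
      coeff_lower₂] at e2
    rw [v h1 (m + 3) (by omega), v hx (m + 2 + 1) (by omega), v hx (m + 2 + 3) (by omega),
      v hr (m + 2) (by omega), v hs (m + 2) (by omega), v hr (m + 2 + 2) (by omega),
      v hs (m + 2 + 2) (by omega), v hk (m + 1 + 2) (by omega), v hd (m + 2) (by omega),
      v hd (m + 2 + 2) (by omega)] at e2
    have h4 : (1 + m / 4 : ℂ) ≠ 0 := by
      have h5 : ((1 + m / 4 : ℝ) : ℂ) ≠ 0 := ofReal_ne_zero.2 (by positivity)
      simpa using h5
    refine (mul_eq_zero.1 (?_ : (1 + m / 4 : ℂ) * _ = 0)).resolve_left h4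
    linear_combination 2 * e2
  · have h3 : (divRayPoly a e (m + 2 : ℕ) k y w 0 - divRayPoly a e (m + 2 : ℕ) k y w 2) + C (1 / 2) *
        ((flatPoly ((m + 2 : ℕ) - 1) r x s 0 - flatPoly ((m + 2 : ℕ) - 1) r x s 2) +
          (f 0 - f 2)) = 0 := by linear_combination hf 0 (by norm_num) - hf 2 le_rfl
    have e0 := congrArg (fun p => p.coeff (m + 2)) h3
    beta_reduce at e0
    rw [coeff_add, coeff_C_mul, coeff_add, coeff_divRayPoly_sub, coeff_flatPoly_sub _ _ _ _ (m + 1),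
      coeff_sub, v h0 (m + 2) (by omega), v h2 (m + 2) (by omega), v hr (m + 1 + 1) (by omega),
      v hs (m + 1 + 1) (by omega), v hr (m + 1 + 3) (by omega), v hs (m + 1 + 3) (by omega),
      v hs' (m + 2) (by omega), sub_zero, coeff_zero] at e0
    push_cast at e0
    linear_combination e0

/-- The coefficients of the polynomials `x` and `r + s` that enter the second highest coefficients
of the constraint drop out of a linear combination. -/
theorem ConstraintAt.coeff_sub_top (h : ConstraintAt (m + 4) k y w a e) :
    4 * a * k.coeff (m + 2) = e * (2 * ((lower₂ (w - y)).coeff m - (lower₂ (w - y)).coeff (m + 2))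
      - (m + 5) / 2 * ((X ^ 2 - 1) * (w - y)).coeff (m + 1)) ∧
    e * (12 * k.coeff (m + 2) + (m + 5) / 2 * ((w + y).coeff m - (w + y).coeff (m + 2))) = 0 := by
  obtain ⟨r, x, s, f, hr, hx, hs, h0, h1, h2, hf⟩ := h
  have v {p : ℂ[X]} {d : ℕ} (hp : p.natDegree ≤ d) (j : ℕ) (hj : d < j) : p.coeff j = 0 :=
    coeff_eq_zero_of_natDegree_lt (hp.trans_lt hj)
  have e1 := congrArg (fun p => p.coeff (m + 2)) (hf 1 (by norm_num))
  constructor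
  · have h3 : (divRayPoly a e (m + 4 : ℕ) k y w 0 + divRayPoly a e (m + 4 : ℕ) k y w 2) + C (1 / 2) *
        ((flatPoly ((m + 4 : ℕ) - 1) r x s 0 + flatPoly ((m + 4 : ℕ) - 1) r x s 2) +
          (f 0 + f 2)) = 0 := by linear_combination hf 0 (by norm_num) + hf 2 le_rfl
    rw [divRayPoly_add] at h3
    have e0 := congrArg (fun p => p.coeff (m + 1)) h3
    beta_reduce at e0
    rw [coeff_add, coeff_C_mul, coeff_C_mul, coeff_C_mul, add_mul, one_mul, coeff_add,
      coeff_intCast_mul, coeff_add, coeff_flatPoly_add, coeff_add, v h0 (m + 1) (by omega), v h2 (m + 1) (by omega), v hr (m + 3) (by omega),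
      v hs (m + 3) (by omega), add_zero, coeff_zero] at e0
    simp only [coeff_add, coeff_C_mul, coeff_divRayPoly_one, coeff_flatPoly_one, coeff_zero] at e1
    rw [v h1 (m + 2) (by omega), v hx (m + 1 + 3) (by omega), v hr (m + 1 + 2) (by omega),
      v hs (m + 1 + 2) (by omega)] at e1
    push_cast at e0 e1
    linear_combination e0 - 4 * e1
  · have h3 : (divRayPoly a e (m + 4 : ℕ) k y w 0 - divRayPoly a e (m + 4 : ℕ) k y w 2) + C (1 / 2) *
        ((flatPoly ((m + 4 : ℕ) - 1) r x s 0 - flatPoly ((m + 4 : ℕ) - 1) r x s 2) +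
          (f 0 - f 2)) = 0 := by linear_combination hf 0 (by norm_num) - hf 2 le_rfl
    have e0 := congrArg (fun p => p.coeff (m + 2)) h3
    beta_reduce at e0
    rw [coeff_add, coeff_C_mul, coeff_add, coeff_divRayPoly_sub, coeff_flatPoly_sub _ _ _ _ (m + 1),
      coeff_sub, v h0 (m + 2) (by omega), v h2 (m + 2) (by omega), v hr (m + 1 + 3) (by omega),
      v hs (m + 1 + 3) (by omega), sub_zero, coeff_zero] at e0
    push_cast at e0
    linear_combination e0

end extraction

end

section

open Complex FrameData Polynomial ConnCoeffs

/-! ### The obstructions -/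

/-- The pairs `(a, e)` with the property `Φ` do not all lie on a straight line through `0`. -/
def Spanning (Φ : ℂ → ℂ → Prop) : Prop :=
  ∀ α β : ℂ, (∀ a e, Φ a e → a * α + e * β = 0) → α = 0 ∧ β = 0

section obstruction

variable {Φ : ℂ → ℂ → Prop} {k y w : ℂ[X]} {m : ℕ}

theorem Spanning.top (hΦ : Spanning Φ) (h : ∀ a e, Φ a e → ConstraintAt (m + 2) k y w a e)
    (hk : k.natDegree ≤ m + 2) (hy : y.natDegree ≤ m) (hw : w.natDegree ≤ m) :
    k.coeff (m + 2) = 0 ∧ (w - y).coeff m = 0 ∧ (w + y).coeff m = 0 ∧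
      (lower₂ (w - y)).coeff m = 0 := by
  obtain ⟨h1, h2⟩ := hΦ (k.coeff (m + 2)) (-(1 / 2 * (lower₂ (w - y)).coeff m)) fun a e hae => by
    linear_combination ((h a e hae).coeff_top hk hy hw).1
  obtain ⟨-, h3⟩ := hΦ 0 ((w - y).coeff m) fun a e hae => by
    linear_combination ((h a e hae).coeff_top hk hy hw).2.1
  obtain ⟨-, h4⟩ := hΦ 0 (12 * k.coeff (m + 2) + (m + 3) / 2 * (w + y).coeff m) fun a e hae => by
    linear_combination ((h a e hae).coeff_top hk hy hw).2.2
  refine ⟨h1, h3, ?_, by linear_combination -2 * h2⟩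
  have h5 : (m + 3 : ℂ) ≠ 0 := by exact_mod_cast (Nat.succ_ne_zero (m + 2))
  refine (mul_eq_zero.1 (?_ : (m + 3 : ℂ) * _ = 0)).resolve_left h5
  linear_combination 2 * h4 - 24 * h1

theorem Spanning.top_succ (hΦ : Spanning Φ)
    (h : ∀ a e, Φ a e → ConstraintAt (m + 3) k y w a e)
    (hk : k.natDegree ≤ m + 3) (hy : y.natDegree ≤ m + 1) (hw : w.natDegree ≤ m + 1) :
    (w - y).coeff m = 0 := by
  have h1 := (hΦ.top h hk hy hw).2.2.2
  rw [coeff_lower₂, coeff_eq_zero_of_natDegree_lt (n := m + 2)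
    (((natDegree_sub_le _ _).trans (max_le hw hy)).trans_lt (by omega))] at h1
  have h4 : (1 + m / 4 : ℂ) ≠ 0 := by
    have h5 : ((1 + m / 4 : ℝ) : ℂ) ≠ 0 := ofReal_ne_zero.2 (by positivity)
    simpa using h5
  exact (mul_eq_zero.1 (by linear_combination h1)).resolve_left h4

theorem coeff_one_sq_sub_one_mul (p : ℂ[X]) : ((X ^ 2 - 1) * p).coeff 1 = -p.coeff 1 := by
  rw [sub_mul, one_mul, coeff_sub, coeff_X_pow_mul', if_neg (by norm_num), zero_sub]

/-- The order `ρ` of the constraint. -/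
theorem Spanning.four (hΦ : Spanning Φ) (h : ∀ a e, Φ a e → ConstraintAt 4 k y w a e)
    (hk : k.natDegree ≤ 4) (hy : y.natDegree ≤ 2) (hw : w.natDegree ≤ 2) :
    (w + y).coeff 2 = 0 ∧ (w - y).coeff 1 = 0 ∧ (w + y).coeff 0 = 0 := by
  have h2 := (hΦ.top h hk hy hw).2.2.1
  have h1 := hΦ.top_succ h hk hy hw
  have h3 : (w - y).coeff 3 = 0 := coeff_eq_zero_of_natDegree_lt
    (((natDegree_sub_le _ _).trans (max_le hw hy)).trans_lt (by omega))
  obtain ⟨hk2, -⟩ := hΦ (k.coeff 2) 0 fun a e hae => by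
    have h4 := ((h a e hae).coeff_sub_top (m := 0)).1
    rw [coeff_lower₂_zero, zero_add, zero_add, coeff_lower₂ _ 1, coeff_one_sq_sub_one_mul, h1,
      h3] at h4
    linear_combination 1 / 4 * h4
  obtain ⟨-, h5⟩ := hΦ 0 ((w + y).coeff 0) fun a e hae => by
    have h4 := ((h a e hae).coeff_sub_top (m := 0)).2
    rw [zero_add, hk2, h2] at h4
    push_cast at h4
    linear_combination 2 / 5 * h4
  exact ⟨h2, h1, h5⟩

/-- The order `ρ²` of the constraint. -/
theorem Spanning.five (hΦ : Spanning Φ) (h : ∀ a e, Φ a e → ConstraintAt 5 k y w a e)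
    (hk : k.natDegree ≤ 5) (hy : y.natDegree ≤ 3) (hw : w.natDegree ≤ 3) :
    (w + y).coeff 3 = 0 ∧ (w - y).coeff 2 = 0 ∧ (w + y).coeff 1 = 0 ∧ (w - y).coeff 0 = 0 := by
  have h3 := (hΦ.top h hk hy hw).2.2.1
  have h2 := hΦ.top_succ h hk hy hw
  have h4 : (w - y).coeff 4 = 0 := coeff_eq_zero_of_natDegree_lt
    (((natDegree_sub_le _ _).trans (max_le hw hy)).trans_lt (by omega))
  obtain ⟨hk3, h0⟩ := hΦ (k.coeff 3) (1 / 4 * (w - y).coeff 0) fun a e hae => by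
    have h5 := ((h a e hae).coeff_sub_top (m := 1)).1
    rw [coeff_lower₂ _ 0, coeff_lower₂ _ 2, coeff_sq_sub_one_mul, zero_add, h2, h4] at h5
    push_cast at h5
    linear_combination 1 / 4 * h5
  obtain ⟨-, h5⟩ := hΦ 0 ((w + y).coeff 1) fun a e hae => by
    have h6 := ((h a e hae).coeff_sub_top (m := 1)).2
    rw [hk3, h3] at h6
    push_cast at h6
    linear_combination 1 / 3 * h6
  exact ⟨h3, h2, h5, by linear_combination 4 * h0⟩

end obstruction

/-! ### From the constraint to the polynomial system -/

section system

variable {F : FrameData} {c : ConnCoeffs}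

theorem SymCoeff.add {S S' S'' : ℕ → RhoSeries} {n : ℤ} {s s' : ℕ → ℂ[X]} (h : SymCoeff S n s)
    (h' : SymCoeff S' n s') (hS : ∀ i, S'' i = S i + S' i) :
    SymCoeff S'' n (fun i => s i + s' i) := by
  constructor <;>
  simp only [hS, HahnSeries.coeff_add, h.zero, h'.zero, h.one, h'.one, h.two, h'.two, h.three,
    h'.three, h.four, h'.four, map_add] <;>
  ring

theorem FormCoeff.add {U V W U' V' W' U'' V'' W'' : RhoSeries} {n : ℤ} {r x s r' x' s' : ℂ[X]}
    (h : FormCoeff U V W n r x s) (h' : FormCoeff U' V' W' n r' x' s') (h0 : U'' = U + U')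
    (h1 : V'' = V + V') (h2 : W'' = W + W') :
    FormCoeff U'' V'' W'' n (r + r') (x + x') (s + s') := by
  constructor <;>
  simp only [h0, h1, h2, HahnSeries.coeff_add, h.zero, h'.zero, h.one, h'.one, h.two, h'.two,
    map_add] <;>
  ring

theorem FormCoeff.cst_mul {U V W : RhoSeries} {n : ℤ} {r x s : ℂ[X]} (h : FormCoeff U V W n r x s)
    (z : ℂ) : FormCoeff (cst z * U) (cst z * V) (cst z * W) n (C z * r) (C z * x) (C z * s) := by
  constructor <;>
  simp only [coeff_cst_mul, h.zero, h.one, h.two, map_mul, pu_C] <;>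
  ring

theorem FormCoeff.eq_zero {U V W : RhoSeries} {n : ℤ} {r x s : ℂ[X]} (h : FormCoeff U V W n r x s)
    (h0 : U.coeff n = 0) (h1 : V.coeff n = 0) (h2 : W.coeff n = 0) : r = 0 ∧ x = 0 ∧ s = 0 :=
  ⟨MF_mul_pu_eq_zero (h.zero.symm.trans h0), pu_eq_zero (h.one.symm.trans h1),
    PF_mul_pu_eq_zero (h.two.symm.trans h2)⟩

theorem symCoeff_zero {S : ℕ → RhoSeries} {n m : ℤ} (hS : ∀ i, S i ∈ ordGE m) (h : n < m) :
    SymCoeff S n 0 := by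
  constructor <;> simp [hS _ n h]

theorem formCoeff_zero {U V W : RhoSeries} {n m : ℤ} (h0 : U ∈ ordGE m) (h1 : V ∈ ordGE m)
    (h2 : W ∈ ordGE m) (h : n < m) : FormCoeff U V W n 0 0 0 := by
  constructor <;> simp [h0 n h, h1 n h, h2 n h]

theorem killing_ord (h : IsConnection F c) {U V W : RhoSeries} (h0 : U ∈ ordGE 1)
    (h1 : V ∈ ordGE 1) (h2 : W ∈ ordGE 1) (i : ℕ) : killing F c U V W i ∈ ordGE 0 := by
  rw [killing_eq]
  exact add_mem (killingFlat_ord h0 h1 h2 i) (ordGE_mono (by norm_num) (killingPert_ord h h0 h1 h2 i))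

theorem divFlatPoly_add (n : ℤ) (s t : ℕ → ℂ[X]) (i : ℕ) :
    divFlatPoly n (fun j => s j + t j) i = divFlatPoly n s i + divFlatPoly n t i := by
  match i with
  | 0 | 1 | _ + 2 => simp only [divFlatPoly, lower, lower₂, derivative_add]; ring

/-- The coefficients of order `ρ^{n-2}`, `n ≤ 3`, of the divergence of the conformal Killing
operator are those of the flat metric. -/
theorem IsConnection.divSym_killing (h : IsConnection F c) {U V W : RhoSeries} (h0 : U ∈ ordGE 1)
    (h1 : V ∈ ordGE 1) (h2 : W ∈ ordGE 1) {n : ℤ} (hn : n ≤ 3) {r x s : ℂ[X]}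
    (hf : FormCoeff U V W n r x s) :
    FormCoeff (divSym F c (killing F c U V W) 0) (divSym F c (killing F c U V W) 1)
      (divSym F c (killing F c U V W) 2) (n - 2)
      (flatPoly n r x s 0) (flatPoly n r x s 1) (flatPoly n r x s 2) := by
  have e1 := hf.killingFlat.add (symCoeff_zero (n := n - 1) (killingPert_ord h h0 h1 h2) (by omega))
    (killing_eq U V W)
  have e2 := e1.divSymFlat
  have o := divSymPert_ord h (killing_ord h h0 h1 h2)
  have e3 := e2.add (formCoeff_zero (n := n - 1 - 1) (o 0) (o 1) (o 2) (by omega))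
    (divSym_eq _ 0) (divSym_eq _ 1) (divSym_eq _ 2)
  simp only [Pi.zero_apply, add_zero] at e3
  rwa [sub_sub] at e3

/-- At the order `ρ²` there are also corrections, which come from the coefficients of order `ρ` of
the 1-form and of order `ρ²` of the frame. -/
def corrPoly (z r x s : ℂ[X]) (i : ℕ) : ℂ[X] :=
  divFlatPoly 3 (killingPertPoly z r x s) i + divPertPoly z (killingFlatPoly 1 r x s) i

theorem IsConnection.divSym_killing_two (h : IsConnection F c) {U V W : RhoSeries}
    (h0 : U ∈ ordGE 1) (h1 : V ∈ ordGE 1) (h2 : W ∈ ordGE 1) {z : ℂ[X]} (hz : FrameCoeff F 2 z 0 0)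
    {r x s r' x' s' : ℂ[X]} (hf : FormCoeff U V W 4 r x s) (hf' : FormCoeff U V W 1 r' x' s') :
    FormCoeff (divSym F c (killing F c U V W) 0) (divSym F c (killing F c U V W) 1)
      (divSym F c (killing F c U V W) 2) 2
      (flatPoly 4 r x s 0 + corrPoly z r' x' s' 0) (flatPoly 4 r x s 1 + corrPoly z r' x' s' 1)
      (flatPoly 4 r x s 2 + corrPoly z r' x' s' 2) := by
  have e1 := (hf.killingFlat.add (h.killingPert hz hf' h0 h1 h2) (killing_eq U V W)).divSymFlat
  have e0 := hf'.killingFlat.add (symCoeff_zero (n := 1 - 1) (killingPert_ord h h0 h1 h2)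
    (by norm_num)) (killing_eq U V W)
  have e2 := h.divSymPert hz e0 (killing_ord h h0 h1 h2)
  have e3 := e1.add e2 (divSym_eq _ 0) (divSym_eq _ 1) (divSym_eq _ 2)
  simp only [Pi.zero_apply, add_zero, divFlatPoly_add] at e3
  simp only [corrPoly, flatPoly, ← add_assoc]
  exact e3

theorem corrPoly_natDegree {z r x s : ℂ[X]} (hz : z.natDegree ≤ 1) (hr : r.natDegree ≤ 0)
    (hx : x.natDegree ≤ 1) (hs : s.natDegree ≤ 0) :
    (corrPoly z r x s 0).natDegree ≤ 1 ∧ (corrPoly z r x s 1).natDegree ≤ 2 ∧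
      (corrPoly z r x s 2).natDegree ≤ 1 := by
  obtain ⟨z1, z0, rfl⟩ := exists_eq_X_add_C_of_natDegree_le_one hz
  obtain ⟨x1, x0, rfl⟩ := exists_eq_X_add_C_of_natDegree_le_one hx
  rw [eq_C_of_natDegree_le_zero hr, eq_C_of_natDegree_le_zero hs]
  generalize r.coeff 0 = r
  generalize s.coeff 0 = s
  refine ⟨?_, ?_, ?_⟩
  all_goals
    simp only [corrPoly, divFlatPoly, killingPertPoly, divPertPoly, killingFlatPoly, lower, lower₂,
      derivative_add, derivative_sub, derivative_mul, derivative_C, derivative_X, derivative_one,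
      derivative_X_pow, derivative_ofNat, derivative_zero, mul_zero, zero_mul, mul_one, one_mul,
      add_zero, zero_add, Int.cast_one, sub_self, sub_zero]
    compute_degree

end system

end

section

open Complex FrameData Polynomial ConnCoeffs

section system

variable {F : FrameData} {c : ConnCoeffs}

theorem IsConnection.exists_constraint (h : IsConnection F c) {U V W : RhoSeries}
    (hA : IsAnsatz 4 U V W) {a e : ℂ} {n : ℤ} (hv : ∀ i ≤ 2, (divSym F c
      (fun j => raySeed a e j + cst (1 / 2) * killing F c U V W j) i).coeff n = 0)
    {d r : ℕ → ℂ[X]}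
    (hr : FormCoeff (divSym F c (raySeed a e) 0) (divSym F c (raySeed a e) 1)
      (divSym F c (raySeed a e) 2) n (r 0) (r 1) (r 2))
    (hd : FormCoeff (divSym F c (killing F c U V W) 0) (divSym F c (killing F c U V W) 1)
      (divSym F c (killing F c U V W) 2) n (d 0) (d 1) (d 2)) :
    ∀ i ≤ 2, r i + C (1 / 2) * d i = 0 := by
  have hm := killing_mem h hA.mem_zero hA.mem_one hA.mem_two
  have key (i : ℕ) : divSym F c (fun j => raySeed a e j + cst (1 / 2) * killing F c U V W j) i =
      divSym F c (raySeed a e) i + cst (1 / 2) * divSym F c (killing F c U V W) i := by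
    rw [divSym_add (raySeed_mem a e) fun j => mul_mem (cst_mem_polySeries _) (hm j), divSym_cst_mul]
  obtain ⟨h0, h1, h2⟩ := (hr.add (hd.cst_mul (1 / 2)) (key 0) (key 1) (key 2)).eq_zero
    (hv 0 (by norm_num)) (hv 1 (by norm_num)) (hv 2 le_rfl)
  intro i hi
  interval_cases i
  exacts [h0, h1, h2]

theorem Compensated.constraintAt (h : IsConnection F c) {n : ℕ} (hn : 2 ≤ n) (hn' : n ≤ 4)
    {z y w : ℂ[X]} (hz : FrameCoeff F n z y w) {a e : ℂ} (hc : Compensated F c a e) :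
    ConstraintAt n (((n : ℂ[X]) + 1) * z) y w a e := by
  obtain ⟨U, V, W, hA, hv⟩ := hc
  obtain ⟨r, x, s, hr, hx, hs, hf⟩ := hA.formCoeff (n - 1) (Finset.mem_Icc.2 (by omega))
  have hL : IsConnection.LinearOrder F n := ⟨by omega, by omega⟩
  have hk : c.kappa.coeff n = pu (((n : ℂ[X]) + 1) * z) := by
    rw [h.coeff_kappa hL, if_neg (by omega), sub_zero, hz.zPlus, map_mul, map_add, map_natCast,
      map_one, Int.cast_natCast]
  have e1 := h.divSym_raySeed hL hk hz a e
  rw [Nat.cast_sub (by omega)] at hf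
  have e2 := h.divSym_killing hA.ord_zero hA.ord_one hA.ord_two (by push_cast; omega) hf
  rw [show ((n : ℤ) - (1 : ℕ) - 2 : ℤ) = n - 3 by push_cast; ring] at e2
  refine ⟨r, x, s, 0, by omega, hx, by omega, by simp, by simp, by simp, ?_⟩
  simp only [Pi.zero_apply, add_zero]
  exact h.exists_constraint hA (fun i hi => hv i hi (n - 3) (by omega)) e1 e2

theorem Compensated.constraintAt_five (h : IsConnection F c) {z₂ z y w : ℂ[X]}
    (hz₂ : FrameCoeff F 2 z₂ 0 0) (hd : z₂.natDegree ≤ 1) (hz : FrameCoeff F 5 z y w) {a e : ℂ}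
    (hc : Compensated F c a e) : ConstraintAt 5 (6 * z - 3 * z₂ ^ 2) y w a e := by
  obtain ⟨U, V, W, hA, hv⟩ := hc
  obtain ⟨r, x, s, hr, hx, hs, hf⟩ := hA.formCoeff 4 (by simp)
  obtain ⟨r', x', s', hr', hx', hs', hf'⟩ := hA.formCoeff 1 (by simp)
  have hL : IsConnection.LinearOrder F 5 := by
    refine ⟨le_rfl, fun _ => ⟨?_, ?_⟩⟩
    · rw [hz₂.yPlus, map_zero, mul_zero]
    · rw [hz₂.zMinus, map_zero, mul_zero]
  have hk : c.kappa.coeff 5 = pu (6 * z - 3 * z₂ ^ 2) := by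
    rw [h.coeff_kappa hL, if_pos rfl, hz.zPlus, hz₂.zPlus, map_sub, map_mul, map_mul, map_pow,
      map_ofNat, map_ofNat]
    push_cast
    ring
  have e1 := h.divSym_raySeed hL hk hz a e
  have e2 := h.divSym_killing_two hA.ord_zero hA.ord_one hA.ord_two hz₂ hf hf'
  obtain ⟨d0, d1, d2⟩ := corrPoly_natDegree hd hr' hx' hs'
  exact ⟨r, x, s, corrPoly z₂ r' x' s', hr, hx, hs, d0, d1, d2,
    h.exists_constraint (d := fun i => flatPoly 4 r x s i + corrPoly z₂ r' x' s' i) hA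
      (fun i hi => hv i hi 2 le_rfl) e1 e2⟩

/-! ### The coefficients of the frame -/

/-- The polynomial of a frame coefficient of spin weight `±j` at the order `ρ^p`. -/
def framePoly (j p : ℕ) (f : ℕ → ℂ) : ℂ[X] := ∑ q ∈ Finset.Icc j p, C (f q) * weightPoly q j

theorem framePoly_natDegree (j p : ℕ) (f : ℕ → ℂ) : (framePoly j p f).natDegree ≤ p - j :=
  natDegree_sum_weightPoly_le j p j f

theorem framePoly_add (j p : ℕ) (f g : ℕ → ℂ) :
    framePoly j p f + framePoly j p g = framePoly j p (f + g) := by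
  simp only [framePoly, ← Finset.sum_add_distrib, Pi.add_apply, C_add, add_mul]

theorem framePoly_sub (j p : ℕ) (f g : ℕ → ℂ) :
    framePoly j p f - framePoly j p g = framePoly j p (f - g) := by
  simp only [framePoly, ← Finset.sum_sub_distrib, Pi.sub_apply, C_sub, sub_mul]

theorem FrameData.frameCoeff (F : FrameData) {p : ℕ} (hp : 2 ≤ p) :
    FrameCoeff F p (framePoly 0 p (F.Zp p)) (framePoly 2 p (F.Yp p)) (framePoly 2 p (F.Zm p)) where
  zPlus := by
    rw [zPlus, coeff_sumRho, if_pos hp]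
    exact (sum_T_add _ 0 (fun q _ => q.zero_le) _).trans (by rw [pow_zero, one_mul]; rfl)
  yPlus := by
    rw [yPlus, coeff_sumRho, if_pos hp]
    exact sum_T_add _ 2 (fun q hq => (Finset.mem_Icc.1 hq).1) _
  zMinus := by
    rw [zMinus, coeff_sumRho, if_pos hp]
    exact sum_T_sub _ 2 (fun q hq => (Finset.mem_Icc.1 hq).1) _

/-- The polynomial `weightPoly q 2` up to normalisation. -/
def weightTwoShape (q : ℕ) : ℂ[X] :=
  ∑ i ∈ Finset.range (q - 2 + 1), C (((q - 2).choose i * (q + 2).choose (q - i) : ℕ) : ℂ) *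
      ((C (1 / 2) * (X + 1)) ^ i * (C (1 / 2) * (X - 1)) ^ (q - 2 - i))

theorem exists_weightPoly_two (q : ℕ) (hq : 2 ≤ q) :
    ∃ z ≠ (0 : ℂ), weightPoly q 2 = C z * weightTwoShape q := by
  refine ⟨_, ?_, rfl⟩
  have h1 : 0 < (2 * q).choose q := Nat.choose_pos (by omega)
  have h2 : 0 < (2 * q).choose (q + 2) := Nat.choose_pos (by omega)
  refine mul_ne_zero (mul_ne_zero (ofReal_ne_zero.2 (Real.sqrt_ne_zero'.2 (by exact_mod_cast h1)))
    (ofReal_ne_zero.2 (Real.sqrt_ne_zero'.2 (by exact_mod_cast h2)))) (inv_ne_zero ?_)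
  exact_mod_cast h1.ne'

theorem C_half_mul_two : (C (1 / 2) : ℂ[X]) * 2 = 1 := by
  rw [← C_ofNat, ← C_mul, one_div_mul_cancel two_ne_zero, C_1]

theorem weightTwoShape_two : weightTwoShape 2 = 6 := by
  simp [weightTwoShape, Nat.choose]

theorem weightTwoShape_three : weightTwoShape 3 = 10 * X := by
  simp [weightTwoShape, Finset.sum_range_succ, Nat.choose]
  have h := C_half_mul_two
  simp at h
  linear_combination (10 * X) * h

theorem weightTwoShape_four : weightTwoShape 4 = C (35 / 2) * X ^ 2 - C (5 / 2) := by
  have h2 : (2 : ℂ[X]) * C (1 / 2) = 1 := by rw [mul_comm, C_half_mul_two]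
  have h35 : (C (35 / 2) : ℂ[X]) = 35 * C (1 / 2) := by rw [← C_ofNat, ← C_mul]; norm_num
  have h5 : (C (5 / 2) : ℂ[X]) = 5 * C (1 / 2) := by rw [← C_ofNat, ← C_mul]; norm_num
  rw [h35, h5]
  simp [weightTwoShape, Finset.sum_range_succ, Nat.choose, -one_div]
  generalize (C (1 / 2) : ℂ[X]) = u at h2 ⊢
  linear_combination ((35 * X ^ 2 - 5) * u) * h2

theorem weightTwoShape_five : weightTwoShape 5 = C (63 / 2) * X ^ 3 - C (21 / 2) * X := by
  have h2 : (2 : ℂ[X]) * C (1 / 2) = 1 := by rw [mul_comm, C_half_mul_two]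
  have h63 : (C (63 / 2) : ℂ[X]) = 63 * C (1 / 2) := by rw [← C_ofNat, ← C_mul]; norm_num
  have h21 : (C (21 / 2) : ℂ[X]) = 21 * C (1 / 2) := by rw [← C_ofNat, ← C_mul]; norm_num
  rw [h63, h21]
  simp [weightTwoShape, Finset.sum_range_succ, Nat.choose, -one_div]
  generalize (C (1 / 2) : ℂ[X]) = u at h2 ⊢
  linear_combination ((63 * X ^ 3 - 21 * X) * u * (2 * u + 1)) * h2

end system

section coefficients

variable (f : ℕ → ℂ)

theorem coeff_framePoly (p j : ℕ) : (framePoly 2 p f).coeff j =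
    ∑ q ∈ Finset.Icc 2 p, f q * (weightPoly q 2).coeff j := by
  simp only [framePoly, finsetSum_coeff, coeff_C_mul]

theorem coeff_weightPoly_two_eq_zero {q j : ℕ} (h : q - 2 < j) : (weightPoly q 2).coeff j = 0 :=
  coeff_eq_zero_of_natDegree_lt ((natDegree_weightPoly_le q 2).trans_lt h)

/-- The polynomials `weightPoly q 2` are even or odd, with a nonzero leading coefficient. -/
theorem coeff_weightPoly_two :
    (weightPoly 2 2).coeff 0 ≠ 0 ∧
    (weightPoly 3 2).coeff 1 ≠ 0 ∧ (weightPoly 3 2).coeff 0 = 0 ∧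
    (weightPoly 4 2).coeff 2 ≠ 0 ∧ (weightPoly 4 2).coeff 1 = 0 ∧
    (weightPoly 5 2).coeff 3 ≠ 0 ∧ (weightPoly 5 2).coeff 2 = 0 ∧ (weightPoly 5 2).coeff 0 = 0 := by
  obtain ⟨z₂, h₂, e₂⟩ := exists_weightPoly_two 2 le_rfl
  obtain ⟨z₃, h₃, e₃⟩ := exists_weightPoly_two 3 (by norm_num)
  obtain ⟨z₄, h₄, e₄⟩ := exists_weightPoly_two 4 (by norm_num)
  obtain ⟨z₅, h₅, e₅⟩ := exists_weightPoly_two 5 (by norm_num)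
  rw [e₂, e₃, e₄, e₅, weightTwoShape_two, weightTwoShape_three, weightTwoShape_four,
    weightTwoShape_five]
  simp [h₂, h₃, h₄, h₅, coeff_X, coeff_X_pow, coeff_C]

theorem framePoly_two_eq_zero (h : (framePoly 2 2 f).coeff 0 = 0) : f 2 = 0 := by
  obtain ⟨a₂, -⟩ := coeff_weightPoly_two
  rw [coeff_framePoly, Finset.Icc_self, Finset.sum_singleton] at h
  exact (mul_eq_zero.1 h).resolve_right a₂

theorem framePoly_three_one (h : (framePoly 2 3 f).coeff 1 = 0) : f 3 = 0 := by
  obtain ⟨-, a₃, -⟩ := coeff_weightPoly_two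
  rw [coeff_framePoly, Finset.sum_Icc_succ_top (by norm_num), Finset.Icc_self,
    Finset.sum_singleton, coeff_weightPoly_two_eq_zero (by norm_num), mul_zero, zero_add] at h
  exact (mul_eq_zero.1 h).resolve_right a₃

theorem framePoly_three_zero (h : (framePoly 2 3 f).coeff 0 = 0) : f 2 = 0 := by
  obtain ⟨a₂, -, b₃, -⟩ := coeff_weightPoly_two
  rw [coeff_framePoly, Finset.sum_Icc_succ_top (by norm_num), Finset.Icc_self,
    Finset.sum_singleton, b₃, mul_zero, add_zero] at h
  exact (mul_eq_zero.1 h).resolve_right a₂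

theorem framePoly_four_two (h : (framePoly 2 4 f).coeff 2 = 0) : f 4 = 0 := by
  obtain ⟨-, -, -, a₄, -⟩ := coeff_weightPoly_two
  rw [coeff_framePoly, Finset.sum_Icc_succ_top (by norm_num), Finset.sum_Icc_succ_top (by norm_num),
    Finset.Icc_self, Finset.sum_singleton, coeff_weightPoly_two_eq_zero (by norm_num),
    coeff_weightPoly_two_eq_zero (by norm_num), mul_zero, mul_zero, add_zero, zero_add] at h
  exact (mul_eq_zero.1 h).resolve_right a₄

theorem framePoly_four_one (h : (framePoly 2 4 f).coeff 1 = 0) : f 3 = 0 := by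
  obtain ⟨-, a₃, -, -, b₄, -⟩ := coeff_weightPoly_two
  rw [coeff_framePoly, Finset.sum_Icc_succ_top (by norm_num), Finset.sum_Icc_succ_top (by norm_num),
    Finset.Icc_self, Finset.sum_singleton, coeff_weightPoly_two_eq_zero (by norm_num), b₄,
    mul_zero, mul_zero, add_zero, zero_add] at h
  exact (mul_eq_zero.1 h).resolve_right a₃

theorem framePoly_four_zero (h : (framePoly 2 4 f).coeff 0 = 0) (h4 : f 4 = 0) : f 2 = 0 := by
  obtain ⟨a₂, -, b₃, -⟩ := coeff_weightPoly_two
  rw [coeff_framePoly, Finset.sum_Icc_succ_top (by norm_num), Finset.sum_Icc_succ_top (by norm_num),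
    Finset.Icc_self, Finset.sum_singleton, b₃, h4, mul_zero, zero_mul, add_zero, add_zero] at h
  exact (mul_eq_zero.1 h).resolve_right a₂

theorem framePoly_five_three (h : (framePoly 2 5 f).coeff 3 = 0) : f 5 = 0 := by
  obtain ⟨-, -, -, -, -, a₅, -⟩ := coeff_weightPoly_two
  rw [coeff_framePoly, Finset.sum_Icc_succ_top (by norm_num), Finset.sum_Icc_succ_top (by norm_num),
    Finset.sum_Icc_succ_top (by norm_num), Finset.Icc_self, Finset.sum_singleton,
    coeff_weightPoly_two_eq_zero (by norm_num), coeff_weightPoly_two_eq_zero (by norm_num),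
    coeff_weightPoly_two_eq_zero (by norm_num), mul_zero, mul_zero, mul_zero, add_zero, add_zero,
    zero_add] at h
  exact (mul_eq_zero.1 h).resolve_right a₅

theorem framePoly_five_two (h : (framePoly 2 5 f).coeff 2 = 0) : f 4 = 0 := by
  obtain ⟨-, -, -, a₄, -, -, b₅, -⟩ := coeff_weightPoly_two
  rw [coeff_framePoly, Finset.sum_Icc_succ_top (by norm_num), Finset.sum_Icc_succ_top (by norm_num),
    Finset.sum_Icc_succ_top (by norm_num), Finset.Icc_self, Finset.sum_singleton, b₅,
    coeff_weightPoly_two_eq_zero (by norm_num), coeff_weightPoly_two_eq_zero (by norm_num), mul_zero,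
    mul_zero, mul_zero, add_zero, add_zero, zero_add] at h
  exact (mul_eq_zero.1 h).resolve_right a₄

theorem framePoly_five_one (h : (framePoly 2 5 f).coeff 1 = 0) (h5 : f 5 = 0) : f 3 = 0 := by
  obtain ⟨-, a₃, -, -, b₄, -⟩ := coeff_weightPoly_two
  rw [coeff_framePoly, Finset.sum_Icc_succ_top (by norm_num), Finset.sum_Icc_succ_top (by norm_num),
    Finset.sum_Icc_succ_top (by norm_num), Finset.Icc_self, Finset.sum_singleton, h5, b₄,
    coeff_weightPoly_two_eq_zero (by norm_num), mul_zero, mul_zero, zero_mul, add_zero, add_zero,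
    zero_add] at h
  exact (mul_eq_zero.1 h).resolve_right a₃

theorem framePoly_five_zero (h : (framePoly 2 5 f).coeff 0 = 0) (h4 : f 4 = 0) : f 2 = 0 := by
  obtain ⟨a₂, -, b₃, -, -, -, -, b₅⟩ := coeff_weightPoly_two
  rw [coeff_framePoly, Finset.sum_Icc_succ_top (by norm_num), Finset.sum_Icc_succ_top (by norm_num),
    Finset.sum_Icc_succ_top (by norm_num), Finset.Icc_self, Finset.sum_singleton, h4, b₃, b₅,
    mul_zero, mul_zero, zero_mul, add_zero, add_zero, add_zero] at h
  exact (mul_eq_zero.1 h).resolve_right a₂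

end coefficients

end

/-! ### The symmetry of the frame -/

/-- The reality of the frame is not needed for its symmetry. -/
theorem zm_eq_neg_one_pow_mul_yp {F : FrameData} {g : Spinor4} (hg : IsLeviCivita F g) (Q : ℝ)
    (L : ℤ → ℕ → ℂ)
    (hsol : ∀ α β δ : ℝ, (α, β) ≠ (0, 0) → ∃ A J : ℝ, α * A + β * J ≠ δ ∧
      SolvableUpTo 4 F g (seed A Q J L)) :
    ∀ p ∈ Finset.Icc 2 5, ∀ q ∈ Finset.Icc 2 p,
      F.Zm p q = (-1) ^ (p + q + 1) * F.Yp p q := by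
  have h := hg.isConnection
  have hΦ : Spanning (Compensated F (ConnCoeffs.ofSpinor g)) := fun α β hαβ =>
    eq_zero_of_forall_compensated hg hsol hαβ
  have hS (p : ℕ) := framePoly_add 2 p (F.Zm p) (F.Yp p)
  have hD (p : ℕ) := framePoly_sub 2 p (F.Zm p) (F.Yp p)
  have hk (p : ℕ) : (((p : Polynomial ℂ) + 1) * framePoly 0 p (F.Zp p)).natDegree ≤ p := by
    have h1 := framePoly_natDegree 0 p (F.Zp p)
    rw [← Nat.cast_succ, ← Polynomial.C_eq_natCast]
    exact (Polynomial.natDegree_C_mul_le _ _).trans h1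
  have hc {p : ℕ} (hp : 2 ≤ p) (hp' : p ≤ 4) (a e : ℂ) (hae : Compensated F _ a e) :=
    hae.constraintAt h hp hp' (F.frameCoeff hp)
  have hy (p : ℕ) := framePoly_natDegree 2 p (F.Yp p)
  have hw (p : ℕ) := framePoly_natDegree 2 p (F.Zm p)
  -- the order `ρ⁻¹` of the constraint
  obtain ⟨z22, d20, s20, -⟩ := hΦ.top (m := 0) (hc le_rfl (by norm_num)) (hk 2) (hy 2) (hw 2)
  rw [hD] at d20
  rw [hS] at s20
  have D22 := framePoly_two_eq_zero _ d20
  have S22 := framePoly_two_eq_zero _ s20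
  -- the order `ρ⁰`
  obtain ⟨-, -, s31, -⟩ := hΦ.top (m := 1) (hc (p := 3) (by norm_num) (by norm_num)) (hk 3) (hy 3) (hw 3)
  have d30 := hΦ.top_succ (m := 0) (hc (p := 3) (by norm_num) (by norm_num)) (hk 3) (hy 3) (hw 3)
  rw [hD] at d30
  rw [hS] at s31
  have S33 := framePoly_three_one _ s31
  have D32 := framePoly_three_zero _ d30
  -- the order `ρ`
  obtain ⟨s42, d41, s40⟩ := hΦ.four (hc (by norm_num) le_rfl) (hk 4) (hy 4) (hw 4)
  rw [hD] at d41
  rw [hS] at s42 s40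
  have S44 := framePoly_four_two _ s42
  have D43 := framePoly_four_one _ d41
  have S42 := framePoly_four_zero _ s40 S44
  simp only [Pi.add_apply, Pi.sub_apply] at D22 S22 S33 D32 S44 D43 S42
  -- the order `ρ²`, where the quadratic terms in the frame drop out because of `Y⁺ = Z⁻ = O(ρ³)`
  have hY : F.Yp 2 2 = 0 := by linear_combination (S22 - D22) / 2
  have hZ : F.Zm 2 2 = 0 := by linear_combination (S22 + D22) / 2
  have h2 : FrameCoeff F 2 (framePoly 0 2 (F.Zp 2)) 0 0 := by
    have h3 := F.frameCoeff le_rfl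
    rw [framePoly, framePoly, framePoly, Finset.Icc_self, Finset.sum_singleton, Finset.sum_singleton,
      hY, hZ, Polynomial.C_0, zero_mul] at h3
    exact h3
  have h2d : (framePoly 0 2 (F.Zp 2)).natDegree ≤ 1 := by
    rw [Polynomial.natDegree_le_iff_coeff_eq_zero]
    intro N hN
    rcases (show 2 ≤ N from hN).eq_or_lt with rfl | hN
    · rw [← Nat.cast_succ, ← Polynomial.C_eq_natCast, Polynomial.coeff_C_mul] at z22
      exact (mul_eq_zero.1 z22).resolve_left (Nat.cast_ne_zero.2 (by norm_num))
    · exact Polynomial.coeff_eq_zero_of_natDegree_lt ((framePoly_natDegree 0 2 _).trans_lt hN)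
  have hk5 : (6 * framePoly 0 5 (F.Zp 5) - 3 * framePoly 0 2 (F.Zp 2) ^ 2).natDegree ≤ 5 := by
    have h1 := framePoly_natDegree 0 5 (F.Zp 5)
    rw [← Polynomial.C_ofNat, ← Polynomial.C_ofNat]
    refine (Polynomial.natDegree_sub_le _ _).trans (max_le
      ((Polynomial.natDegree_C_mul_le _ _).trans h1) ((Polynomial.natDegree_C_mul_le _ _).trans
        ((Polynomial.natDegree_pow_le_of_le 2 h2d).trans (by norm_num))))
  obtain ⟨s53, d52, s51, d50⟩ := hΦ.five (fun a e hae => hae.constraintAt_five h h2 h2d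
    (F.frameCoeff (p := 5) (by norm_num))) hk5 (hy 5) (hw 5)
  rw [hD] at d52 d50
  rw [hS] at s53 s51
  have S55 := framePoly_five_three _ s53
  have D54 := framePoly_five_two _ d52
  have S53 := framePoly_five_one _ s51 S55
  have D52 := framePoly_five_zero _ d50 D54
  simp only [Pi.add_apply, Pi.sub_apply] at S55 D54 S53 D52
  intro p hp q hq
  rw [Finset.mem_Icc] at hp hq
  obtain ⟨hp2, hp5⟩ := hp
  obtain ⟨hq2, hqp⟩ := hq
  interval_cases p <;> interval_cases q
  · linear_combination S22
  · linear_combination D32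
  · linear_combination S33
  · linear_combination S42
  · linear_combination D43
  · linear_combination S44
  · linear_combination D52
  · linear_combination S53
  · linear_combination D54
  · linear_combination S55

end MomentumExpansion

end

theorem theorem3
    -- the frame, with its coefficients and its Levi-Civita connection
    (F : MomentumExpansion.FrameData) (hF : F.IsReal)
    (g : MomentumExpansion.Spinor4) (hg : MomentumExpansion.IsLeviCivita F g)
    -- the parameters of the seed other than `A` and `J`
    (Q : ℝ) (L : ℤ → ℕ → ℂ)
    -- the `(A, J)` for which the constraint is solvable do not all lie on one line
    (hsol : ∀ α β δ : ℝ, (α, β) ≠ (0, 0) → ∃ A J : ℝ, α * A + β * J ≠ δ ∧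
      MomentumExpansion.SolvableUpTo 4 F g (MomentumExpansion.seed A Q J L)) :
    ∀ p ∈ Finset.Icc 2 5, ∀ q ∈ Finset.Icc 2 p,
      F.Zm p q = (-1) ^ (p + q + 1) * F.Yp p q :=
  MomentumExpansion.zm_eq_neg_one_pow_mul_yp hg Q L hsol
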